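/- Let $k$ be a field for which there is an algebraic closure $F$ such that $F/k$ is separable (algebraic). Let $H$ be a Hopf algebra over $k$ that is semisimple as a ring, cosemisimple as a coalgebra (i.e. $H$ is the sum of its simple subcoalgebras), and commutative or cocommutative. Let $R$ be a unital $k$-algebra and let $R\#_\sigma H$ be a crossed product. That is, there are a $k$-linear map $H\otimes R\to R$, $h\otimes r\mapsto h\cdot r$, and a convolution-invertible $k$-linear map $\sigma:H\otimes H\to R$ such that for all $h,g,l\in H$ and $r,s\in R$ $$1\cdot r=r,\qquad h\cdot 1=\varepsilon(h)1,\qquad h\cdot(rs)=\sum (h_1\cdot r)(h_2\cdot s),\qquad \sigma(h,1)=\sigma(1,h)=\varepsilon(h)1,$$ $$h\cdot(g\cdot r)=\sum\sigma(h_1,g_1)(h_2g_2\cdot r)\sigma^{-1}(h_3,g_3),$$ $$\sum (h_1\cdot\sigma(g_1,l_1))\,\sigma(h_2,g_2l_2)=\sum\sigma(h_1,g_1)\,\sigma(h_2g_2,l),$$ and $R\#_\sigma H$ is the vector space $R\otimes_k H$ (with $a\# h$ denoting $a\otimes h$), with unit $1\#1$ and the associative multiplication $(a\#h)(b\#g)=\sum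 a(h_1\cdot b)\sigma(h_2,g_1)\#h_3g_2$. Let $r_j$ denote the Jacobson radical, and let $r_{jH}(R)=\{x\in R\mid h\cdot x\in r_j(R)\text{ for all }h\in H\}$. An $R$-$H$-module is a left $R$-module $M$ with a $k$-linear map $H\otimes M\to M$ such that $1m=m$, $h(am)=\sum(h_1\cdot a)(h_2m)$ and $h(gm)=\sum\sigma(h_1,g_1)\big((h_2g_2)m\big)$ for all $h,g\in H$, $a\in R$, $m\in M$. It is irreducible if $RM\neq0$ and its only $R$-submodules stable under $H$ are $0$ and $M$. Let $r_{Hj}(R)$ be the intersection of the annihilators in $R$ of all irreducible $R$-$H$-modules. For an ideal $I$ of $R$ let $I\#_\sigma H$ be the $k$-span of all $x\#h$ with $x\in I$, $h\in H$. Then (1) $r_j(R)=r_{Hj}(R)=r_{jH}(R)$; (2) $r_j(R\#_\sigma H)=r_{Hj}(R)\#_\sigma H$. -/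

import Mathlib

open TensorProduct Coalgebra WithConv

universe u v w

/-! ### Cosemisimple coalgebras -/

section Cosemisimple

variable (k : Type*) {C : Type*} [Field k] [AddCommGroup C] [Module k C] [Coalgebra k C]

/-- A subspace `D` of a coalgebra over a field is a subcoalgebra if `Δ(D) ⊆ D ⊗ D`. -/
def IsSubcoalgebra (D : Submodule k C) : Prop :=
  ∀ d ∈ D, comul (R := k) d ∈ LinearMap.range (TensorProduct.map D.subtype D.subtype)

/-- A simple subcoalgebra: nonzero, with no subcoalgebras other than `0` and itself. -/
def IsSimpleSubcoalgebra (D : Submodule k C) : Prop :=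
  IsSubcoalgebra k D ∧ D ≠ ⊥ ∧ ∀ E : Submodule k C, IsSubcoalgebra k E → E ≤ D → E = ⊥ ∨ E = D

variable (C) in
/-- A coalgebra is cosemisimple if it is the sum of its simple subcoalgebras. -/
def IsCosemisimple : Prop :=
  sSup {D : Submodule k C | IsSimpleSubcoalgebra k D} = ⊤

end Cosemisimple

/-! ### Twisted module algebras and crossed products -/

/-- The data `(·, σ)` of a crossed product `R #_σ H`: a weak action `h · r` of the Hopf algebra `H`
on the algebra `R` together with a convolution-invertible normalized 2-cocycle
`σ : H ⊗ H → R` making `R` a twisted `H`-module algebra.  Here `ℛ k h` is a chosen way of writing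
`Δ(h) = ∑ h₁ ⊗ h₂` (none of the sums depends on the choice), and `WithConv (H ⊗ H →ₗ R)` is the
space of linear maps with the convolution product. -/
structure CrossedSystem (k : Type u) (H : Type v) (R : Type w) [Field k] [Ring H]
    [HopfAlgebra k H] [Ring R] [Algebra k R] where
  /-- the weak action, `act h r = h · r` -/
  act : H →ₗ[k] R →ₗ[k] R
  /-- `1 · r = r` -/
  one_act : ∀ r : R, act 1 r = r
  /-- `h · 1 = ε(h) 1` -/
  act_one : ∀ h : H, act h 1 = algebraMap k R (counit h)
  /-- `h · (r s) = ∑ (h₁ · r) (h₂ · s)` -/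
  act_mul : ∀ (h : H) (r s : R), act h (r * s) =
    ∑ i ∈ (ℛ k h).index, act ((ℛ k h).left i) r * act ((ℛ k h).right i) s
  /-- the cocycle `σ`, a unit of the convolution algebra -/
  σ : (WithConv (H ⊗[k] H →ₗ[k] R))ˣ
  /-- `σ(h, 1) = ε(h) 1` -/
  σ_one_right : ∀ h : H, σ.val (h ⊗ₜ 1) = algebraMap k R (counit h)
  /-- `σ(1, h) = ε(h) 1` -/
  σ_one_left : ∀ h : H, σ.val (1 ⊗ₜ h) = algebraMap k R (counit h)
  /-- `h · (g · r) = ∑ σ(h₁, g₁) (h₂ g₂ · r) σ⁻¹(h₃, g₃)` -/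
  twisted : ∀ r : R, toConv (TensorProduct.lift (act.compl₂ (act.flip r))) =
    σ.val * toConv (act.flip r ∘ₗ LinearMap.mul' k H) * σ⁻¹.val
  /-- `∑ (h₁ · σ(g₁, l₁)) σ(h₂, g₂ l₂) = ∑ σ(h₁, g₁) σ(h₂ g₂, l)` -/
  cocycle : ∀ h g l : H,
    ∑ a ∈ (ℛ k h).index, ∑ b ∈ (ℛ k g).index, ∑ c ∈ (ℛ k l).index,
      act ((ℛ k h).left a) (σ.val ((ℛ k g).left b ⊗ₜ (ℛ k l).left c)) *
        σ.val ((ℛ k h).right a ⊗ₜ ((ℛ k g).right b * (ℛ k l).right c)) =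
    ∑ a ∈ (ℛ k h).index, ∑ b ∈ (ℛ k g).index,
      σ.val ((ℛ k h).left a ⊗ₜ (ℛ k g).left b) *
        σ.val (((ℛ k h).right a * (ℛ k g).right b) ⊗ₜ l)

namespace CrossedSystem
section General
variable {k : Type*} [Field k] {C D E A : Type*} [AddCommMonoid C] [Module k C] [Coalgebra k C]
  [AddCommMonoid D] [Module k D] [Coalgebra k D] [AddCommMonoid E] [Module k E] [Coalgebra k E]
  [Ring A] [Algebra k A]

/-- Precomposition with a coalgebra homomorphism. -/
noncomputable def pull (f : D →ₗc[k] C) (φ : WithConv (C →ₗ[k] A)) : WithConv (D →ₗ[k] A) :=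
  toConv (φ.ofConv ∘ₗ f.toLinearMap)

lemma pull_apply (f : D →ₗc[k] C) (φ : WithConv (C →ₗ[k] A)) (x : D) :
    pull f φ x = φ (f x) := rfl

lemma pull_mul (f : D →ₗc[k] C) (φ ψ : WithConv (C →ₗ[k] A)) :
    pull f (φ * ψ) = pull f φ * pull f ψ :=
  ofConv_injective (LinearMap.convMul_comp_coalgHom_distrib φ ψ f)

lemma pull_pull (f : D →ₗc[k] C) (g : E →ₗc[k] D) (φ : WithConv (C →ₗ[k] A)) :
    pull g (pull f φ) = pull (f.comp g) φ := rfl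

variable (k D E) in
/-- The coalgebra homomorphism `x ⊗ y ↦ ε(y) x`. -/
noncomputable def fstC : D ⊗[k] E →ₗc[k] D :=
  (Coalgebra.TensorProduct.rid k k D : D ⊗[k] k →ₗc[k] D).comp
    (Coalgebra.TensorProduct.map (CoalgHom.id k D) (counitCoalgHom k E))

lemma fstC_tmul (x : D) (y : E) : fstC k D E (x ⊗ₜ y) = counit (R := k) y • x := rfl

lemma convMul_tmul {ι κ : Type*} (φ ψ : WithConv (D ⊗[k] E →ₗ[k] A)) {x : D} {y : E}
    (𝓡 : Coalgebra.Repr k x ι) (𝓢 : Coalgebra.Repr k y κ) :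
    (φ * ψ) (x ⊗ₜ y) = ∑ i ∈ 𝓡.index, ∑ j ∈ 𝓢.index,
      φ (𝓡.left i ⊗ₜ 𝓢.left j) * ψ (𝓡.right i ⊗ₜ 𝓢.right j) := by
  have h : comul (R := k) (x ⊗ₜ[k] y) = ∑ i ∈ 𝓡.index, ∑ j ∈ 𝓢.index,
      (𝓡.left i ⊗ₜ[k] 𝓢.left j) ⊗ₜ[k] (𝓡.right i ⊗ₜ[k] 𝓢.right j) := by
    rw [TensorProduct.comul_tmul, ← 𝓡.eq, ← 𝓢.eq]
    simp only [TensorProduct.sum_tmul, TensorProduct.tmul_sum, map_sum]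
    exact Finset.sum_comm
  rw [LinearMap.convMul_apply, h]
  simp

lemma fst_mul_apply {ι : Type*} (φ : WithConv (D →ₗ[k] A)) (ψ : WithConv (D ⊗[k] E →ₗ[k] A))
    {x : D} (𝓡 : Coalgebra.Repr k x ι) (y : E) :
    (pull (fstC k D E) φ * ψ) (x ⊗ₜ y) =
      ∑ i ∈ 𝓡.index, φ (𝓡.left i) * ψ (𝓡.right i ⊗ₜ y) := by
  rw [convMul_tmul _ _ 𝓡 (ℛ k y)]
  simp only [pull_apply, fstC_tmul]
  refine Finset.sum_congr rfl fun i _ => ?_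
  conv_rhs => rw [← sum_counit_smul (ℛ k y)]
  simp [TensorProduct.tmul_sum, Finset.mul_sum]

variable {B : Type*} [Ring B] [Algebra k B]
/-- Postcomposition with an algebra homomorphism. -/
noncomputable def push (f : A →ₐ[k] B) (φ : WithConv (C →ₗ[k] A)) : WithConv (C →ₗ[k] B) :=
  toConv (f.toLinearMap ∘ₗ φ.ofConv)

lemma push_apply {C : Type*} [AddCommMonoid C] [Module k C] (f : A →ₐ[k] B)
    (φ : WithConv (C →ₗ[k] A)) (x : C) : push f φ x = f (φ x) := rfl

lemma push_mul (f : A →ₐ[k] B) (φ ψ : WithConv (C →ₗ[k] A)) :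
    push f (φ * ψ) = push f φ * push f ψ :=
  ofConv_injective (LinearMap.algHom_comp_convMul_distrib f φ ψ)

lemma pull_push (f : A →ₐ[k] B) (φ : WithConv (C →ₗ[k] A)) (g : D →ₗc[k] C) :
    pull g (push f φ) = push f (pull g φ) := rfl
end General

variable {k : Type u} {H : Type v} {R : Type w} [Field k] [Ring H]
    [HopfAlgebra k H] [Ring R] [Algebra k R] (X : CrossedSystem k H R)

/-- `h ↦ h · b` -/
noncomputable def actH (b : R) : WithConv (H →ₗ[k] R) := toConv (X.act.flip b)

/-- `h ⊗ d ↦ h · φ(d)` -/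
noncomputable def actL {D : Type*} [AddCommMonoid D] [Module k D]
    (φ : WithConv (D →ₗ[k] R)) : WithConv (H ⊗[k] D →ₗ[k] R) :=
  toConv (TensorProduct.lift (X.act.compl₂ φ.ofConv))

lemma actL_tmul {D : Type*} [AddCommMonoid D] [Module k D]
    (φ : WithConv (D →ₗ[k] R)) (h : H) (d : D) : X.actL φ (h ⊗ₜ d) = X.act h (φ d) := rfl

lemma actL_mul {D : Type*} [AddCommMonoid D] [Module k D] [Coalgebra k D]
    (φ ψ : WithConv (D →ₗ[k] R)) : X.actL (φ * ψ) = X.actL φ * X.actL ψ := by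
  apply WithConv.ext
  refine TensorProduct.ext' fun h d => ?_
  change X.actL _ (h ⊗ₜ d) = (X.actL φ * X.actL ψ) (h ⊗ₜ d)
  rw [convMul_tmul _ _ (ℛ k h) (ℛ k d), actL_tmul, (ℛ k d).convMul_apply]
  simp only [actL_tmul, map_sum, X.act_mul]
  exact Finset.sum_comm

lemma twisted_mul (r : R) : X.actL (X.actH r) * X.σ.val =
    X.σ.val * pull (Bialgebra.mulCoalgHom k H) (X.actH r) := by
  have := X.twisted r
  rw [Units.eq_mul_inv_iff_mul_eq] at this
  exact this

/-- `x ⊗ y ⊗ z ↦ ε(z) x ⊗ y` -/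
noncomputable def p12 : H ⊗[k] (H ⊗[k] H) →ₗc[k] H ⊗[k] H :=
  Coalgebra.TensorProduct.map (CoalgHom.id k H) (fstC k H H)

/-- `x ⊗ y ⊗ z ↦ x y ⊗ z` -/
noncomputable def mulL : H ⊗[k] (H ⊗[k] H) →ₗc[k] H ⊗[k] H :=
  (Coalgebra.TensorProduct.map (Bialgebra.mulCoalgHom k H) (CoalgHom.id k H)).comp
    (Coalgebra.TensorProduct.assoc k k H H H).symm.toCoalgHom

/-- `x ⊗ y ⊗ z ↦ x ⊗ y z` -/
noncomputable def mulR : H ⊗[k] (H ⊗[k] H) →ₗc[k] H ⊗[k] H :=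
  Coalgebra.TensorProduct.map (CoalgHom.id k H) (Bialgebra.mulCoalgHom k H)

lemma hom_ext {E : Type*} [AddCommMonoid E] [Module k E] [Coalgebra k E]
    {f g : H ⊗[k] (H ⊗[k] H) →ₗc[k] E}
    (h : ∀ x y z : H, f (x ⊗ₜ (y ⊗ₜ z)) = g (x ⊗ₜ (y ⊗ₜ z))) : f = g := by
  apply CoalgHom.coe_linearMap_injective
  ext x y z
  exact h x y z

lemma mulL_tmul (x y z : H) : mulL (k := k) (x ⊗ₜ (y ⊗ₜ z)) = (x * y) ⊗ₜ z := rfl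
lemma mulR_tmul (x y z : H) : mulR (k := k) (x ⊗ₜ (y ⊗ₜ z)) = x ⊗ₜ (y * z) := rfl
lemma p12_tmul (x y z : H) : p12 (k := k) (x ⊗ₜ (y ⊗ₜ z)) = x ⊗ₜ (counit (R := k) z • y) := rfl

lemma conv_hom_ext {A : Type*} [Ring A] [Algebra k A]
    {f g : WithConv (H ⊗[k] (H ⊗[k] H) →ₗ[k] A)}
    (h : ∀ x y z : H, f (x ⊗ₜ (y ⊗ₜ z)) = g (x ⊗ₜ (y ⊗ₜ z))) : f = g := by
  apply WithConv.ext
  ext x y z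
  exact h x y z

lemma cocycle_mul : X.actL X.σ.val * pull mulR X.σ.val = pull p12 X.σ.val * pull mulL X.σ.val := by
  apply conv_hom_ext
  intro h g l
  rw [((ℛ k h).tmul ((ℛ k g).tmul (ℛ k l))).convMul_apply,
    ((ℛ k h).tmul ((ℛ k g).tmul (ℛ k l))).convMul_apply]
  simp only [Coalgebra.Repr.tmul_index, Coalgebra.Repr.tmul_left, Coalgebra.Repr.tmul_right,
    Finset.sum_product, actL_tmul, pull_apply, mulR_tmul, mulL_tmul, p12_tmul]
  rw [X.cocycle]
  refine Finset.sum_congr rfl fun i _ => Finset.sum_congr rfl fun j _ => ?_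
  conv_lhs => rw [← sum_counit_smul (ℛ k l)]
  simp [TensorProduct.tmul_sum, Finset.mul_sum]

/-- The convolution product `(h, g) ↦ ∑ (h₁ · b) σ(h₂, g)`. -/
noncomputable def P (b : R) : WithConv (H ⊗[k] H →ₗ[k] R) :=
  pull (fstC k H H) (X.actH b) * X.σ.val

lemma key (b c : R) :
    pull (fstC k H (H ⊗[k] H)) (X.actH b) * (X.actL (X.P c) * pull mulR X.σ.val) =
      pull p12 (X.P b) * pull mulL (X.P c) := by
  have e1 : X.actL (pull (fstC k H H) (X.actH c)) = pull p12 (X.actL (X.actH c)) := by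
    apply conv_hom_ext
    intro x y z
    simp [actL_tmul, pull_apply, p12_tmul, fstC_tmul]
  have e2 : pull p12 (pull (fstC k H H) (X.actH b)) = pull (fstC k H (H ⊗[k] H)) (X.actH b) := by
    rw [pull_pull]
    congr 1
    apply hom_ext
    intro x y z
    simp [p12_tmul, fstC_tmul, smul_smul, mul_comm]
  have e3 : pull p12 (pull (Bialgebra.mulCoalgHom k H) (X.actH c)) =
      pull mulL (pull (fstC k H H) (X.actH c)) := by
    rw [pull_pull, pull_pull]
    congr 1
    apply hom_ext
    intro x y z
    simp [p12_tmul, fstC_tmul, mulL_tmul]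
  have e4 := congrArg (pull p12) (X.twisted_mul c)
  rw [pull_mul, pull_mul] at e4
  calc _ = pull (fstC k H (H ⊗[k] H)) (X.actH b) * (pull p12 (X.actL (X.actH c)) *
        (X.actL X.σ.val * pull mulR X.σ.val)) := by rw [P, actL_mul, e1, mul_assoc]
    _ = pull (fstC k H (H ⊗[k] H)) (X.actH b) * (pull p12 (X.actL (X.actH c)) * pull p12 X.σ.val *
        pull mulL X.σ.val) := by rw [cocycle_mul, mul_assoc]
    _ = _ := by
      rw [e4, e3, P, P, pull_mul, pull_mul, e2]
      simp only [mul_assoc]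



variable (k H R) in
/-- `h ⊗ g ↦ 1 ⊗ h g` -/
noncomputable def mulH : WithConv (H ⊗[k] H →ₗ[k] R ⊗[k] H) :=
  toConv ((Algebra.TensorProduct.includeRight : H →ₐ[k] R ⊗[k] H).toLinearMap ∘ₗ
    LinearMap.mul' k H)

/-- `(h, g) ↦ ∑ (h₁ · b) σ(h₂, g₁) ⊗ h₃ g₂` -/
noncomputable def Q (b : R) : WithConv (H ⊗[k] H →ₗ[k] R ⊗[k] H) :=
  push Algebra.TensorProduct.includeLeft (X.P b) * mulH k H R

lemma Q_apply (b : R) {ι κ : Type*} {x y : H} (𝓡 : Coalgebra.Repr k x ι)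
    (𝓢 : Coalgebra.Repr k y κ) : X.Q b (x ⊗ₜ y) = ∑ i ∈ 𝓡.index, ∑ j ∈ 𝓢.index,
      X.P b (𝓡.left i ⊗ₜ 𝓢.left j) ⊗ₜ (𝓡.right i * 𝓢.right j) := by
  rw [Q, convMul_tmul _ _ 𝓡 𝓢]
  simp [push_apply, mulH]

lemma P_add (b c : R) : X.P (b + c) = X.P b + X.P c := by
  have : X.actH (b + c) = X.actH b + X.actH c := by
    simp [actH]
  have h2 : pull (fstC k H H) (X.actH b + X.actH c) = 
    pull (fstC k H H) (X.actH b) + pull (fstC k H H) (X.actH c) := rfl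
  rw [P, this, h2, add_mul]; rfl

lemma P_smul (r : k) (c : R) : X.P (r • c) = r • X.P c := by
  have : X.actH (r • c) = r • X.actH c := by
    simp [actH]
  have h2 : pull (fstC k H H) (r • X.actH c) = 
    r • pull (fstC k H H) (X.actH c) := rfl
  rw [P, this, h2, smul_mul_assoc]; rfl

/-- `b ⊗ g ↦ ∑ (h₁ · b) σ(h₂, g₁) ⊗ h₃ g₂` -/
noncomputable def mulRight (h : H) : R ⊗[k] H →ₗ[k] R ⊗[k] H :=
  TensorProduct.lift (LinearMap.mk₂ k (fun b g => X.Q b (h ⊗ₜ g))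
    (fun b c g => by
      simp only [Q_apply X _ (ℛ k h) (ℛ k g), P_add, TensorProduct.add_tmul,
        Finset.sum_add_distrib, WithConv.ofConv_add, LinearMap.add_apply])
    (fun r b g => by
      simp only [Q_apply X _ (ℛ k h) (ℛ k g), P_smul, TensorProduct.smul_tmul', Finset.smul_sum,
        WithConv.ofConv_smul, LinearMap.smul_apply])
    (fun b g g' => by rw [TensorProduct.tmul_add, map_add])
    (fun r b g => by rw [TensorProduct.tmul_smul, map_smul]))

/-- The crossed product multiplication on `R ⊗ H`:
`(a ⊗ h) (b ⊗ g) = ∑ a (h₁ · b) σ(h₂, g₁) ⊗ h₃ g₂`, see `mulMap_sweedler`. -/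
noncomputable def mulMap : R ⊗[k] H →ₗ[k] R ⊗[k] H →ₗ[k] R ⊗[k] H :=
  TensorProduct.lift (LinearMap.mk₂ k
    (fun a h => LinearMap.mulLeft k (a ⊗ₜ[k] (1 : H)) ∘ₗ X.mulRight h)
    (fun a b h => by
      ext b g; simp [TensorProduct.add_tmul, add_mul])
    (fun r a h => by
      ext b g; simp [← TensorProduct.smul_tmul'])
    (fun a h h' => by
      ext b g
      simp [mulRight, TensorProduct.add_tmul, mul_add])
    (fun r a h => by
      ext b g
      simp [mulRight, ← TensorProduct.smul_tmul']))

lemma mulMap_tmul (a b : R) (h g : H) :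
    X.mulMap (a ⊗ₜ h) (b ⊗ₜ g) = (a ⊗ₜ[k] (1 : H)) * X.Q b (h ⊗ₜ g) := rfl

/-- The defining formula of the crossed product in Sweedler notation. -/
theorem mulMap_sweedler (a b : R) (h g : H) :
    X.mulMap (a ⊗ₜ h) (b ⊗ₜ g) =
      ∑ i ∈ (ℛ k h).index, ∑ j ∈ (ℛ k ((ℛ k h).right i)).index, ∑ l ∈ (ℛ k g).index,
        (a * X.act ((ℛ k h).left i) b *
          X.σ.val ((ℛ k ((ℛ k h).right i)).left j ⊗ₜ (ℛ k g).left l)) ⊗ₜ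
        ((ℛ k ((ℛ k h).right i)).right j * (ℛ k g).right l) := by
  rw [mulMap_tmul, Q, P, push_mul, ← pull_push, mul_assoc, fst_mul_apply _ _ (ℛ k h), Finset.mul_sum]
  refine Finset.sum_congr rfl fun i _ => ?_
  rw [convMul_tmul _ _ (ℛ k _) (ℛ k g)]
  simp [Finset.mul_sum, push_apply, mulH, actH, mul_assoc]

lemma mulMap_left (a : R) (z y : R ⊗[k] H) :
    X.mulMap ((a ⊗ₜ 1) * z) y = (a ⊗ₜ 1) * X.mulMap z y := by
  induction z with
  | zero => simp
  | add z w hz hw => simp [mul_add, hz, hw]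
  | tmul b h =>
    induction y with
    | zero => simp
    | add z w hz hw => simp only [map_add, mul_add, hz, hw]
    | tmul c g =>
      rw [Algebra.TensorProduct.tmul_mul_tmul, mulMap_tmul, mulMap_tmul, ← mul_assoc, one_mul,
        Algebra.TensorProduct.tmul_mul_tmul, one_mul]

lemma mulMap_Q_left (b c : R) (x : H ⊗[k] H) (m : H) :
    X.mulMap (X.Q b x) (c ⊗ₜ m) =
      (pull (fstC k (H ⊗[k] H) H) (push Algebra.TensorProduct.includeLeft (X.P b)) *
        pull (Coalgebra.TensorProduct.map (Bialgebra.mulCoalgHom k H) (CoalgHom.id k H))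
          (X.Q c) : WithConv ((H ⊗[k] H) ⊗[k] H →ₗ[k] R ⊗[k] H)) (x ⊗ₜ m) := by
  rw [fst_mul_apply _ _ (ℛ k x), Q, (ℛ k x).convMul_apply, map_sum, LinearMap.sum_apply]
  refine Finset.sum_congr rfl fun i _ => ?_
  have : (push Algebra.TensorProduct.includeLeft (X.P b)) ((ℛ k x).left i) =
    (X.P b ((ℛ k x).left i)) ⊗ₜ[k] (1 : H) := rfl
  have e2 : mulH k H R ((ℛ k x).right i) = 1 ⊗ₜ[k] (LinearMap.mul' k H ((ℛ k x).right i)) := rfl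
  rw [this, mulMap_left, e2, mulMap_tmul, ← Algebra.TensorProduct.one_def, one_mul]
  rfl

lemma actH_mul (b c : R) : X.actH (b * c) = X.actH b * X.actH c := by
  apply WithConv.ext
  ext h
  change X.actH (b * c) h = (X.actH b * X.actH c) h
  rw [(ℛ k h).convMul_apply]
  exact X.act_mul h b c

lemma mulMap_one_left (b : R) (h g : H) : X.mulMap (1 ⊗ₜ h) (b ⊗ₜ g) = X.Q b (h ⊗ₜ g) := by
  rw [mulMap_tmul, ← Algebra.TensorProduct.one_def, one_mul]

lemma Q_eq (b : R) : X.Q b =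
    pull (fstC k H H) (push Algebra.TensorProduct.includeLeft (X.actH b)) *
      (push Algebra.TensorProduct.includeLeft X.σ.val * mulH k H R) := by
  rw [Q, P, push_mul, pull_push, mul_assoc]

lemma Q_mul (b c : R) : X.Q (b * c) =
    pull (fstC k H H) (push Algebra.TensorProduct.includeLeft (X.actH b)) * X.Q c := by
  rw [Q_eq, Q_eq, actH_mul, push_mul, pull_mul, mul_assoc]

lemma mulMap_Q_right (b c : R) (h : H) (y : H ⊗[k] H) :
    X.mulMap (1 ⊗ₜ h) ((b ⊗ₜ 1) * X.Q c y) =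
      (pull (fstC k H (H ⊗[k] H)) (push Algebra.TensorProduct.includeLeft (X.actH b)) *
        (push Algebra.TensorProduct.includeLeft (X.actL (X.P c)) *
          pull mulR (push Algebra.TensorProduct.includeLeft X.σ.val * mulH k H R)) :
        WithConv (H ⊗[k] (H ⊗[k] H) →ₗ[k] R ⊗[k] H)) (h ⊗ₜ y) := by
  have e (i) : (push (Algebra.TensorProduct.includeLeft : R →ₐ[k] R ⊗[k] H) (X.P c))
    ((ℛ k y).left i) = (X.P c ((ℛ k y).left i)) ⊗ₜ[k] (1 : H) := rfl
  have e' (i) : mulH k H R ((ℛ k y).right i) = 1 ⊗ₜ[k] (LinearMap.mul' k H ((ℛ k y).right i)) := rfl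
  rw [fst_mul_apply _ _ (ℛ k h), Q, (ℛ k y).convMul_apply, Finset.mul_sum, map_sum]
  simp only [e, e', Algebra.TensorProduct.tmul_mul_tmul, one_mul, mul_one, mulMap_one_left, Q_mul]
  simp only [fst_mul_apply _ _ (ℛ k h)]
  rw [Finset.sum_comm]
  refine Finset.sum_congr rfl fun i _ => ?_
  rw [← Finset.mul_sum]
  congr 1
  rw [convMul_tmul _ _ (ℛ k _) (ℛ k y), Finset.sum_comm]
  refine Finset.sum_congr rfl fun j _ => ?_
  rw [Q_eq, fst_mul_apply _ _ (ℛ k _)]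
  rfl

variable (k H) in
/-- The associator. -/
noncomputable def asc : (H ⊗[k] H) ⊗[k] H →ₗc[k] H ⊗[k] (H ⊗[k] H) :=
  (Coalgebra.TensorProduct.assoc k k H H H : (H ⊗[k] H) ⊗[k] H →ₗc[k] H ⊗[k] (H ⊗[k] H))

variable (k H) in
/-- `(x ⊗ y) ⊗ z ↦ x y ⊗ z` -/
noncomputable def mulFst : (H ⊗[k] H) ⊗[k] H →ₗc[k] H ⊗[k] H :=
  Coalgebra.TensorProduct.map (Bialgebra.mulCoalgHom k H) (CoalgHom.id k H)

lemma mulMap_assoc (x y z : R ⊗[k] H) :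
    X.mulMap (X.mulMap x y) z = X.mulMap x (X.mulMap y z) := by
  induction x with
  | zero => simp
  | add z w hz hw => simp [hz, hw]
  | tmul a h =>
  induction y with
  | zero => simp
  | add z w hz hw => simp [hz, hw]
  | tmul b g =>
  induction z with
  | zero => simp
  | add z w hz hw => simp [hz, hw]
  | tmul c l =>
    have e : (a ⊗ₜ[k] h : R ⊗[k] H) = (a ⊗ₜ 1) * (1 ⊗ₜ h) := by simp
    rw [mulMap_tmul, mulMap_left, mulMap_Q_left, mulMap_tmul, e, mulMap_left, mulMap_Q_right]
    congr 1
    have hm : pull (asc k H) (pull mulR (mulH k H R)) = pull (mulFst k H) (mulH k H R) := by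
      apply WithConv.ext
      ext x y z
      simp [pull, mulH, mulR, mulFst, asc, mul_assoc]
    have h1 : p12.comp (asc k H) = fstC k (H ⊗[k] H) H := by
      apply CoalgHom.coe_linearMap_injective
      ext x y z
      simp [p12, asc, fstC]
    have h2 : mulL.comp (asc k H) = mulFst k H := by
      apply CoalgHom.coe_linearMap_injective
      ext x y z
      simp [mulL, asc, mulFst]
    have hk := congrArg (fun φ => pull (asc k H)
      (push (Algebra.TensorProduct.includeLeft : R →ₐ[k] R ⊗[k] H) φ * pull mulR (mulH k H R)))
      (X.key b c)
    simp only [push_mul, pull_mul, hm, mul_assoc, ← pull_push, pull_pull, h1, h2] at hk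
    have hL : (pull (fstC k (H ⊗[k] H) H) (push Algebra.TensorProduct.includeLeft (X.P b)) *
          pull (mulFst k H) (X.Q c) : WithConv ((H ⊗[k] H) ⊗[k] H →ₗ[k] R ⊗[k] H)) =
        pull (asc k H) (pull (fstC k H (H ⊗[k] H))
          (push Algebra.TensorProduct.includeLeft (X.actH b)) *
        (push Algebra.TensorProduct.includeLeft (X.actL (X.P c)) *
          pull mulR (push Algebra.TensorProduct.includeLeft X.σ.val * mulH k H R))) := by
      rw [Q, pull_mul, ← hk]
      simp only [pull_mul, pull_pull, ← hm]
    exact congrArg (fun φ : WithConv ((H ⊗[k] H) ⊗[k] H →ₗ[k] R ⊗[k] H) =>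
      φ ((h ⊗ₜ g) ⊗ₜ l)) hL

lemma mulMap_one_mul (x : R ⊗[k] H) : X.mulMap (1 ⊗ₜ 1) x = x := by
  induction x with
  | zero => simp
  | add z w hz hw => simp [hz, hw]
  | tmul b g =>
    let r : Coalgebra.Repr k (1 : H) Unit := ⟨{()}, fun _ => 1, fun _ => 1, by simp; rfl⟩
    rw [mulMap_one_left, Q_eq, fst_mul_apply _ _ r, Finset.sum_singleton,
      convMul_tmul _ _ r (ℛ k g), Finset.sum_singleton]
    simp only [r, push_apply, X.σ_one_left, mulH]
    conv_rhs => rw [← sum_counit_smul (ℛ k g)]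
    simp [actH, X.one_act, TensorProduct.tmul_sum, Finset.mul_sum, Algebra.algebraMap_eq_smul_one]

lemma mulMap_mul_one (x : R ⊗[k] H) : X.mulMap x (1 ⊗ₜ 1) = x := by
  induction x with
  | zero => simp
  | add z w hz hw => simp [hz, hw]
  | tmul b g =>
    let r : Coalgebra.Repr k (1 : H) Unit := ⟨{()}, fun _ => 1, fun _ => 1, by simp; rfl⟩
    have h1 : X.actH 1 = 1 := by
      apply WithConv.ext
      ext h
      exact X.act_one h
    have h2 : X.P 1 = X.σ.val := by
      rw [P, h1]
      convert one_mul _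
      apply WithConv.ext
      ext x y
      simp [pull, fstC, Algebra.smul_def]
    rw [mulMap_tmul, Q_apply X _ (ℛ k g) r]
    simp only [h2]
    simp only [r, Finset.sum_singleton, X.σ_one_right]
    conv_rhs => rw [← sum_counit_smul (ℛ k g)]
    simp [TensorProduct.tmul_sum, Finset.mul_sum, Algebra.algebraMap_eq_smul_one,
      ← TensorProduct.smul_tmul']

/-- The crossed product `R #_σ H`: the vector space `R ⊗ H` with multiplication
`(a # h) (b # g) = ∑ a (h₁ · b) σ(h₂, g₁) # h₃ g₂` and unit `1 # 1`. -/
def CrossedProduct (_X : CrossedSystem k H R) : Type (max v w) := R ⊗[k] H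

noncomputable instance : AddCommGroup X.CrossedProduct := inferInstanceAs (AddCommGroup (R ⊗[k] H))

noncomputable instance : Module k X.CrossedProduct := inferInstanceAs (Module k (R ⊗[k] H))

/-- The identity map from `R ⊗ H` to the crossed product; `a # h` is `X.hash (a ⊗ₜ h)`. -/
noncomputable def hash : R ⊗[k] H ≃ₗ[k] X.CrossedProduct := LinearEquiv.refl k (R ⊗[k] H)

noncomputable instance : Mul X.CrossedProduct := ⟨fun x y => X.hash (X.mulMap (X.hash.symm x) (X.hash.symm y))⟩

noncomputable instance : One X.CrossedProduct := ⟨X.hash (1 ⊗ₜ 1)⟩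

noncomputable instance : Ring X.CrossedProduct where
  __ := (inferInstance : AddCommGroup X.CrossedProduct)
  left_distrib x y z := (X.mulMap (X.hash.symm x)).map_add _ _
  right_distrib x y z := LinearMap.congr_fun (X.mulMap.map_add _ _) _
  zero_mul x := LinearMap.congr_fun X.mulMap.map_zero _
  mul_zero x := (X.mulMap (X.hash.symm x)).map_zero
  mul_assoc x y z := X.mulMap_assoc _ _ _
  one_mul _ := X.mulMap_one_mul _
  mul_one x := X.mulMap_mul_one _

noncomputable instance : Algebra k X.CrossedProduct :=
  Algebra.ofModule (fun r x _ => LinearMap.congr_fun (X.mulMap.map_smul r (X.hash.symm x)) _)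
    (fun r x _ => (X.mulMap (X.hash.symm x)).map_smul r _)

theorem hash_mul_hash (a b : R) (h g : H) :
    X.hash (a ⊗ₜ h) * X.hash (b ⊗ₜ g) =
      ∑ i ∈ (ℛ k h).index, ∑ j ∈ (ℛ k ((ℛ k h).right i)).index, ∑ l ∈ (ℛ k g).index,
        X.hash ((a * X.act ((ℛ k h).left i) b *
          X.σ.val ((ℛ k ((ℛ k h).right i)).left j ⊗ₜ (ℛ k g).left l)) ⊗ₜ
        ((ℛ k ((ℛ k h).right i)).right j * (ℛ k g).right l)) := by
  simp only [← map_sum]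
  exact congrArg X.hash (X.mulMap_sweedler a b h g)

theorem one_def : (1 : X.CrossedProduct) = X.hash (1 ⊗ₜ 1) := rfl

/-- For an ideal `I` of `R`, the subspace `I #_σ H` of `R #_σ H` spanned by the `x # h`, `x ∈ I`. -/
noncomputable def smashIdeal (I : Ideal R) : Submodule k X.CrossedProduct :=
  Submodule.span k {y | ∃ x ∈ I, ∃ h : H, y = X.hash (x ⊗ₜ h)}

/-! ### The radicals -/

/-- `(I : H) = {x ∈ R | h · x ∈ I for all h ∈ H}`, the largest `H`-ideal contained in `I`. -/
def colonH (I : Ideal R) : Ideal R where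
  carrier := {x | ∀ h : H, X.act h x ∈ I}
  add_mem' hx hy h := by
    rw [map_add]
    exact I.add_mem (hx h) (hy h)
  zero_mem' h := by
    rw [map_zero]
    exact I.zero_mem
  smul_mem' r x hx h := by
    rw [smul_eq_mul, X.act_mul]
    exact I.sum_mem fun i _ => I.mul_mem_left _ (hx _)

/-- `r_{jH}(R) = (r_j(R) : H)`. -/
def jacobsonH : Ideal R := X.colonH (Ring.jacobson R)

/-- The structure of an `R`-`H`-module on a left `R`-module `M`, for a twisted `H`-module algebra
`R`: a linear map `H ⊗ M → M`, `h ⊗ m ↦ h m`, with `1 m = m`, `h (a m) = ∑ (h₁ · a) (h₂ m)` and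
`h (g m) = ∑ σ(h₁, g₁) ((h₂ g₂) m)`.  When `σ` is trivial, the last condition says that `M` is an
`H`-module. -/
structure RHModule (M : Type*) [AddCommGroup M] [Module k M] [Module R M]
    [IsScalarTower k R M] where
  /-- `hsmul h m = h m` -/
  hsmul : H →ₗ[k] M →ₗ[k] M
  one_hsmul : ∀ m : M, hsmul 1 m = m
  hsmul_smul : ∀ (h : H) (a : R) (m : M), hsmul h (a • m) =
    ∑ i ∈ (ℛ k h).index, X.act ((ℛ k h).left i) a • hsmul ((ℛ k h).right i) m
  hsmul_hsmul : ∀ (h g : H) (m : M), hsmul h (hsmul g m) =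
    ∑ i ∈ (ℛ k h).index, ∑ j ∈ (ℛ k g).index,
      X.σ.val ((ℛ k h).left i ⊗ₜ (ℛ k g).left j) •
        hsmul ((ℛ k h).right i * (ℛ k g).right j) m

variable {X} in
/-- An `R`-`H`-module `M` is irreducible if `R M ≠ 0` and its only `R`-`H`-submodules are `0`
and `M`. -/
def RHModule.IsIrreducible {M : Type*} [AddCommGroup M] [Module k M] [Module R M]
    [IsScalarTower k R M] (V : X.RHModule M) : Prop :=
  (∃ (a : R) (m : M), a • m ≠ 0) ∧
    ∀ N : Submodule R M, (∀ (h : H), ∀ m ∈ N, V.hsmul h m ∈ N) → N = ⊥ ∨ N = ⊤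

/-- The `H`-Jacobson radical `r_{Hj}(R)`: the intersection of the annihilators in `R` of all
irreducible `R`-`H`-modules.  An irreducible `R`-`H`-module is generated by any nonzero element
`m`, hence is the image of `R ⊗ H` under `a ⊗ h ↦ a (h m)`, so it suffices to let `M` range
over the universe of `R ⊗ H`. -/
def hJacobson : Ideal R where
  carrier := {x | ∀ (M : Type (max v w)) [AddCommGroup M] [Module k M] [Module R M]
    [IsScalarTower k R M] (V : X.RHModule M), V.IsIrreducible → ∀ m : M, x • m = 0}
  add_mem' hx hy M _ _ _ _ V hV m := by
    rw [add_smul, hx M V hV m, hy M V hV m, add_zero]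
  zero_mem' M _ _ _ _ V hV m := zero_smul R m
  smul_mem' r x hx M _ _ _ _ V hV m := by
    rw [smul_eq_mul, mul_smul, hx M V hV m, smul_zero]

end CrossedSystem

/-! Write A = R #_σ H, γ(h) = 1 # h and J for the Jacobson radical. Semisimplicity of H gives a
normalized integral t in H, which forces dim H < ∞; cosemisimplicity gives a normalized integral l
on H. By `jacobson_eq_of_stable` it is enough that J(R) is stable under H and that the coefficients
in R of every element of J(A) lie in J(R). Stability gives J(R) ⊆ J(A) by Nakayama's lemma, since
simple A-modules are finitely generated over R. The inclusion J(A) ∩ R ⊆ J(R) is read off from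
inverses, and r_{Hj}(R) = J(A) ∩ R because R-H-modules are the same as A-modules.

Both conditions come from complete reducibility of coinduced modules Hom_R(A, V), identified with
Hom(H, V): a radical kills every completely reducible module, and testing on rank-one maps f ⊗ v
recovers the coefficients and the elements h · x. The source of complete reducibility is the
pointwise action on Hom(H, V), a finite power of V. It is transferred by
`CompletelyReducible.of_centralizing`: two actions are interchangeable when they generate the same
algebra together with a finite-dimensional separable algebra commuting with both.

If H is cocommutative, V is a simple R-module and the separable algebra is the dual of H, which is
central in the convolution algebra; `adjoin_actH_union` compares the two actions of R, and averaging
with t (`completelyReducible_of_comp_incl`) passes from R to A. If H is commutative, V is a simple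
A-module and the separable algebra is H, acting by translations; convolution with γ turns the
coinduced action into a diagonal one. There l splits V off the coinduced module
(`completelyReducible_of_coind`), so V is completely reducible over R and J(R) ⊆ J(A). -/

/-! ### Completely reducible sets of endomorphisms -/

section CompletelyReducible

variable {k M : Type*} [Field k] [AddCommGroup M] [Module k M]

/-- A set of endomorphisms of a vector space is completely reducible if every stable subspace
is the image of a projection commuting with the set. -/
def CompletelyReducible (T : Set (Module.End k M)) : Prop :=
  ∀ W : Submodule k M, (∀ f ∈ T, ∀ m ∈ W, f m ∈ W) →
    ∃ π : Module.End k M, (∀ m, π m ∈ W) ∧ (∀ m ∈ W, π m = m) ∧ ∀ f ∈ T, Commute f π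

/-- Stability of W and commutation with π depend only on the generated algebra: the endomorphisms
commuting with π form a subalgebra, the centralizer. -/
lemma CompletelyReducible.of_adjoin {T T' : Set (Module.End k M)}
    (h : T ⊆ Algebra.adjoin k T') (h' : T' ⊆ Algebra.adjoin k T) (hT : CompletelyReducible T) :
    CompletelyReducible T' := by
  intro W hW
  have key : ∀ f ∈ Algebra.adjoin k T', ∀ m ∈ W, f m ∈ W := by
    intro f hf
    induction hf using Algebra.adjoin_induction with
    | mem x hx => exact hW x hx
    | algebraMap r => exact fun m hm => W.smul_mem r hm
    | add x y _ _ hx hy => exact fun m hm => W.add_mem (hx m hm) (hy m hm)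
    | mul x y _ _ hx hy => exact fun m hm => hx _ (hy m hm)
  obtain ⟨π, h1, h2, h3⟩ := hT W fun f hf => key f (h hf)
  refine ⟨π, h1, h2, fun f hf => ?_⟩
  have : Algebra.adjoin k T ≤ Subalgebra.centralizer k {π} := by
    rw [Algebra.adjoin_le_iff]
    intro f hf
    rw [SetLike.mem_coe, Subalgebra.mem_centralizer_iff]
    rintro _ rfl
    exact (h3 f hf).symm
  exact ((Subalgebra.mem_centralizer_iff k).1 (this (h' hf)) π rfl).symm

lemma completelyReducible_adjoin {T : Set (Module.End k M)} :
    CompletelyReducible (Algebra.adjoin k T : Set (Module.End k M)) ↔ CompletelyReducible T :=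
  ⟨.of_adjoin subset_rfl (Algebra.subset_adjoin.trans Algebra.subset_adjoin),
    .of_adjoin (Algebra.subset_adjoin.trans Algebra.subset_adjoin) subset_rfl⟩

/-- A projection commuting with the action has a stable kernel complementing its image, and
conversely a stable complement defines such a projection. -/
lemma completelyReducible_range_iff {A : Type*} [Ring A] [Algebra k A] [Module A M]
    [IsScalarTower k A M] (α : A →ₐ[k] Module.End k M) (hα : ∀ a m, α a m = a • m) :
    CompletelyReducible (Set.range α) ↔ IsSemisimpleModule A M := by
  constructor
  · intro h
    rw [isSemisimpleModule_iff]
    refine ⟨fun N => ?_⟩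
    obtain ⟨π, h1, h2, h3⟩ := h (N.restrictScalars k) (by
      rintro _ ⟨a, rfl⟩ m hm
      rw [hα]
      exact N.smul_mem a hm)
    let p : M →ₗ[A] N :=
      { toFun := fun m => ⟨π m, h1 m⟩
        map_add' := fun x y => Subtype.ext (map_add π x y)
        map_smul' := fun a x => Subtype.ext (by
          have := LinearMap.congr_fun (h3 _ ⟨a, rfl⟩) x
          simp only [Module.End.mul_apply, hα] at this
          exact this.symm) }
    exact ⟨LinearMap.ker p, LinearMap.isCompl_of_proj fun x => Subtype.ext (h2 x x.2)⟩
  · intro h W hW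
    let N : Submodule A M :=
      { W with smul_mem' := fun a m hm => by rw [← hα]; exact hW _ ⟨a, rfl⟩ m hm }
    obtain ⟨N', hN'⟩ := exists_isCompl N
    refine ⟨(N.subtype ∘ₗ N.projectionOnto N' hN').restrictScalars k, fun m => ?_,
      fun m hm => ?_, ?_⟩
    · exact (N.projectionOnto N' hN' m).2
    · exact congrArg Subtype.val (Submodule.projectionOnto_apply_left hN' (⟨m, hm⟩ : N))
    · rintro _ ⟨a, rfl⟩
      ext m
      simp [hα]

lemma completelyReducible_iff_isSemisimpleModule {T : Set (Module.End k M)} :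
    CompletelyReducible T ↔ IsSemisimpleModule (Algebra.adjoin k T) M := by
  rw [← completelyReducible_adjoin,
    ← completelyReducible_range_iff (Algebra.adjoin k T).val fun _ _ => rfl]
  simp

/-- Each orbit map A → M sends the radical of A into the radical of M, which vanishes for semisimple
M. Complete reducibility is turned into statements about radicals through this lemma. -/
lemma CompletelyReducible.jacobson_apply {A : Type*} [Ring A] [Algebra k A]
    {α : A →ₐ[k] Module.End k M} (h : CompletelyReducible (Set.range α)) {z : A}
    (hz : z ∈ Ring.jacobson A) : α z = 0 := by
  let _ : Module A M := Module.compHom M α.toRingHom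
  have : IsScalarTower k A M := ⟨fun r a m => by
    change α (r • a) m = r • α a m
    simp⟩
  have := (completelyReducible_range_iff α fun _ _ => rfl).1 h
  ext m
  have := Module.le_comap_jacobson (LinearMap.toSpanSingleton A M m) hz
  rw [IsSemisimpleModule.jacobson_eq_bot] at this
  exact this

/-- A separability idempotent of an algebra `C`. -/
structure IsCasimir {C : Type*} [Ring C] [Algebra k C] (e : C ⊗[k] C) : Prop where
  mul'_eq_one : LinearMap.mul' k C e = 1
  comm : ∀ c : C, (c ⊗ₜ 1) * e = e * (1 ⊗ₜ c)

/-- Maschke's theorem for a centralizing separable extension. -/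
lemma CompletelyReducible.union_of_isCasimir {C : Type*} [Ring C] [Algebra k C] {e : C ⊗[k] C}
    (he : IsCasimir e) {T : Set (Module.End k M)} (hT : CompletelyReducible T)
    (c : C →ₐ[k] Module.End k M) (hc : ∀ f ∈ T, ∀ x, Commute f (c x)) :
    CompletelyReducible (T ∪ Set.range c) := by
  intro W hW
  obtain ⟨π, h1, h2, h3⟩ := hT W fun f hf => hW f (Or.inl hf)
  have hcW (x : C) : ∀ m ∈ W, c x m ∈ W := hW _ (Or.inr ⟨x, rfl⟩)
  -- Averaging: x ⊗ y is sent to c(x) π c(y), and the required projection is the value at the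
  -- separability idempotent e.
  let Φ : C ⊗[k] C →ₗ[k] Module.End k M := LinearMap.mul' k _ ∘ₗ
    TensorProduct.map (LinearMap.mulRight k π ∘ₗ c.toLinearMap) c.toLinearMap
  have hΦ (x y : C) : Φ (x ⊗ₜ y) = c x * π * c y := rfl
  have hl (x : C) (z : C ⊗[k] C) : Φ ((x ⊗ₜ 1) * z) = c x * Φ z := by
    induction z with
    | zero => simp
    | add z w hz hw => simp only [mul_add, map_add, hz, hw]
    | tmul y z => simp [hΦ, mul_assoc]
  have hr (x : C) (z : C ⊗[k] C) : Φ (z * (1 ⊗ₜ x)) = Φ z * c x := by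
    induction z with
    | zero => simp
    | add z w hz hw => simp only [add_mul, map_add, hz, hw]
    | tmul y z => simp [hΦ, mul_assoc]
  have hmem (z : C ⊗[k] C) (m : M) : Φ z m ∈ W := by
    induction z with
    | zero => simp
    | add z w hz hw => rw [map_add]; exact W.add_mem hz hw
    | tmul x y => exact hcW _ _ (h1 _)
  have hid (z : C ⊗[k] C) (m : M) (hm : m ∈ W) : Φ z m = c (LinearMap.mul' k C z) m := by
    induction z with
    | zero => simp
    | add z w hz hw => simp only [map_add, LinearMap.add_apply, hz, hw]
    | tmul x y => simp [hΦ, h2 _ (hcW y m hm)]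
  have hcomm (f) (hf : f ∈ T) (z : C ⊗[k] C) : Commute f (Φ z) := by
    induction z with
    | zero => simp
    | add z w hz hw => rw [map_add]; exact hz.add_right hw
    | tmul x y => exact ((hc f hf x).mul_right (h3 f hf)).mul_right (hc f hf y)
  refine ⟨Φ e, hmem e, fun m hm => ?_, ?_⟩
  · rw [hid e m hm, he.mul'_eq_one, map_one, Module.End.one_apply]
  · rintro f (hf | ⟨x, rfl⟩)
    · exact hcomm f hf e
    · rw [commute_iff_eq, ← hl, he.comm, hr]

/-- A finitely generated module is semisimple if finitely many endomorphisms separate its points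
modulo each maximal submodule. -/
lemma isSemisimpleModule_of_iInf_comap_eq_bot {S U ι : Type*} [Ring S] [AddCommGroup U] [Module S U]
    [Module.Finite S U] [Nontrivial U] [Finite ι] (f : ι → Module.End S U)
    (h : ∀ Q : Submodule S U, Q ≠ ⊤ → ⨅ i, Q.comap (f i) = ⊥) : IsSemisimpleModule S U := by
  -- One maximal submodule Q is enough: the hypothesis embeds U into a finite power of the simple
  -- module U ⧸ Q.
  obtain ⟨Q, hQ, -⟩ := (eq_top_or_exists_le_coatom (⊥ : Submodule S U)).resolve_left bot_ne_top
  have : IsSimpleModule S (U ⧸ Q) := isSimpleModule_iff_isCoatom.2 hQ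
  refine IsSemisimpleModule.of_injective (LinearMap.pi fun i => Q.mkQ ∘ₗ f i)
    (LinearMap.ker_eq_bot.1 ?_)
  rw [← h Q hQ.1, LinearMap.ker_pi]
  simp [LinearMap.ker_comp]

/-- If `S' m = ∑ S (c i m)` for finitely many `S`-endomorphisms `c i`, which come from `S'`, then
semisimple `S'`-modules are semisimple over `S`. -/
lemma IsSemisimpleModule.of_finite_centralizing {S S' M ι : Type*} [Ring S] [Ring S']
    [AddCommGroup M] [Module S M] [Module S' M] [Finite ι] (c : ι → Module.End S M)
    (hS : ∀ s : S, ∃ s' : S', ∀ m : M, s' • m = s • m)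
    (hc : ∀ i, ∃ s' : S', ∀ m : M, s' • m = c i m)
    (hspan : ∀ (s' : S') (m : M), s' • m ∈ Submodule.span S (Set.range fun i => c i m))
    [IsSemisimpleModule S' M] : IsSemisimpleModule S M := by
  let res (U : Submodule S' M) : Submodule S M :=
    { U with
      smul_mem' := fun s m hm => by
        obtain ⟨s', h⟩ := hS s
        rw [← h]
        exact U.smul_mem s' hm }
  have hcU (U : Submodule S' M) (i) (m : M) (hm : m ∈ U) : c i m ∈ U := by
    obtain ⟨s', h⟩ := hc i
    rw [← h]
    exact U.smul_mem s' hm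
  have hsimple (U : Submodule S' M) (hU : IsSimpleModule S' U) :
      IsSemisimpleModule S (res U) := by
    have hat := isSimpleModule_iff_isAtom.1 hU
    obtain ⟨u, hu, hu0⟩ := (Submodule.ne_bot_iff _).1 hat.1
    have hfg : res U = Submodule.span S (Set.range fun i => c i u) := by
      apply le_antisymm
      · intro m hm
        have h : Submodule.span S' {u} = U :=
          (hat.le_iff.1 (Submodule.span_singleton_le_iff_mem _ _ |>.2 hu)).resolve_left
            (by simpa using hu0)
        have hm' : m ∈ Submodule.span S' {u} := h ▸ hm
        obtain ⟨s', rfl⟩ := Submodule.mem_span_singleton.1 hm'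
        exact hspan s' u
      · rw [Submodule.span_le]
        rintro _ ⟨i, rfl⟩
        exact hcU U i u hu
    have hfin : Module.Finite S (res U) := by
      rw [Module.Finite.iff_fg, hfg]
      exact Submodule.fg_span (Set.finite_range _)
    have hnt : Nontrivial (res U) := ⟨⟨u, hu⟩, 0, fun h => hu0 (congrArg Subtype.val h)⟩
    refine isSemisimpleModule_of_iInf_comap_eq_bot
      (fun i => (c i).restrict fun m hm => hcU U i m hm) fun Q hQ => ?_
    -- The largest S'-submodule inside Q. Simplicity of U makes it zero since Q is proper, and by
    -- `hspan` it contains the intersection to be computed.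
    let N : Submodule S' M :=
      { carrier := {m | ∀ s' : S', s' • m ∈ Q.map (res U).subtype}
        add_mem' := fun hx hy s' => by rw [smul_add]; exact Submodule.add_mem _ (hx s') (hy s')
        zero_mem' := fun s' => by rw [smul_zero]; exact Submodule.zero_mem _
        smul_mem' := fun s m hm s' => by rw [smul_smul]; exact hm _ }
    have hNQ (m : M) (hm : m ∈ N) : m ∈ Q.map (res U).subtype := by simpa using hm 1
    have hN : N = ⊥ := by
      refine (hat.le_iff.1 fun m hm => ?_).resolve_right fun h => hQ ?_
      · obtain ⟨x, -, rfl⟩ := hNQ m hm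
        exact x.2
      · rw [eq_top_iff]
        rintro m -
        obtain ⟨x, hx, e⟩ := hNQ m (h.ge (show (m : M) ∈ U from m.2))
        obtain rfl : x = m := Subtype.ext e
        exact hx
    rw [eq_bot_iff]
    intro m hm
    have : (m : M) ∈ N := by
      intro s'
      refine Submodule.span_le.2 ?_ (hspan s' m)
      rintro _ ⟨i, rfl⟩
      exact ⟨_, (Submodule.mem_iInf _).1 hm i, rfl⟩
    rw [hN] at this
    exact Subtype.ext this
  refine isSemisimpleModule_of_isSemisimpleModule_submodule'
    (p := fun U : {U : Submodule S' M // IsSimpleModule S' U} => res U.1)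
    (fun U => hsimple U.1 U.2) ?_
  rw [eq_top_iff]
  -- This sum is formed over S, but it is stable under every c i and hence, by `hspan`, under S';
  -- semisimplicity over S' then makes it everything.
  let V := ⨆ U : {U : Submodule S' M // IsSimpleModule S' U}, res U.1
  have hV (s' : S') (m : M) (hm : m ∈ V) : s' • m ∈ V := by
    have h (i) : V ≤ V.comap (c i) := iSup_le fun U m hm =>
      (le_iSup (fun U : {U : Submodule S' M // IsSimpleModule S' U} => res U.1) U) (hcU _ i m hm)
    refine Submodule.span_le.2 ?_ (hspan s' m)
    rintro _ ⟨i, rfl⟩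
    exact h i hm
  let V' : Submodule S' M := { V with smul_mem' := fun s m hm => hV s m hm }
  have hV' : V' = ⊤ := by
    rw [eq_top_iff, ← IsSemisimpleModule.sSup_simples_eq_top S' M]
    exact sSup_le fun U hU =>
      le_iSup (fun U : {U : Submodule S' M // IsSimpleModule S' U} => res U.1) ⟨U, hU⟩
  rintro m -
  have : m ∈ V' := hV' ▸ Submodule.mem_top
  exact this

/-- Restriction of complete reducibility along a finite centralizing extension. -/
lemma CompletelyReducible.of_union {C : Type*} [Ring C] [Algebra k C] [Module.Finite k C]
    {T : Set (Module.End k M)} (c : C →ₐ[k] Module.End k M) (hc : ∀ f ∈ T, ∀ x, Commute f (c x))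
    (hT : CompletelyReducible (T ∪ Set.range c)) : CompletelyReducible T := by
  rw [completelyReducible_iff_isSemisimpleModule] at hT ⊢
  have hle : Algebra.adjoin k T ≤ Algebra.adjoin k (T ∪ Set.range c) :=
    Algebra.adjoin_mono Set.subset_union_left
  have hcS (s : Algebra.adjoin k T) (x : C) (m : M) : c x (s • m) = s • c x m := by
    have : Algebra.adjoin k T ≤ Subalgebra.centralizer k (Set.range c) := by
      rw [Algebra.adjoin_le_iff]
      intro f hf
      rw [SetLike.mem_coe, Subalgebra.mem_centralizer_iff]
      rintro _ ⟨x, rfl⟩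
      exact (hc f hf x).symm.eq
    exact LinearMap.congr_fun ((Subalgebra.mem_centralizer_iff k).1 (this s.2) (c x) ⟨x, rfl⟩) m
  let cS (x : C) : Module.End (Algebra.adjoin k T) M :=
    { (c x) with map_smul' := fun s m => hcS s x m }
  have hcSmul (x y : C) (m : M) : cS x (cS y m) = cS (x * y) m := by
    change c x (c y m) = c (x * y) m
    rw [map_mul, Module.End.mul_apply]
  -- A finite basis of C supplies the finitely many S-endomorphisms required by
  -- `IsSemisimpleModule.of_finite_centralizing`.
  let b := Module.finBasis k C
  have hmem (x : C) (m : M) :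
      cS x m ∈ Submodule.span (Algebra.adjoin k T) (Set.range fun i => cS (b i) m) := by
    have : c x m = ∑ i, b.repr x i • c (b i) m := by
      conv_lhs => rw [← b.sum_repr x]
      simp only [map_sum, map_smul, LinearMap.sum_apply, LinearMap.smul_apply]
    change c x m ∈ _
    rw [this]
    exact Submodule.sum_mem _ fun i _ => Submodule.smul_mem _
      (algebraMap k (Algebra.adjoin k T) _) (Submodule.subset_span ⟨i, rfl⟩)
  refine IsSemisimpleModule.of_finite_centralizing
    (S' := Algebra.adjoin k (T ∪ Set.range c)) (fun i => cS (b i))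
    (fun s => ⟨⟨s, hle s.2⟩, fun m => rfl⟩)
    (fun i => ⟨⟨c (b i), Algebra.subset_adjoin (Or.inr ⟨_, rfl⟩)⟩, fun m => rfl⟩) ?_
  rintro ⟨s, hs⟩ m
  have hN (x : C) (n : M)
      (hn : n ∈ Submodule.span (Algebra.adjoin k T) (Set.range fun i => cS (b i) m)) :
      c x n ∈ Submodule.span (Algebra.adjoin k T) (Set.range fun i => cS (b i) m) := by
    refine (Submodule.span_le (p := (Submodule.span (Algebra.adjoin k T)
      (Set.range fun i => cS (b i) m)).comap (cS x))).2 ?_ hn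
    rintro _ ⟨i, rfl⟩
    rw [SetLike.mem_coe, Submodule.mem_comap, hcSmul]
    exact hmem _ m
  have key : ∀ n ∈ Submodule.span (Algebra.adjoin k T) (Set.range fun i => cS (b i) m),
      s n ∈ Submodule.span (Algebra.adjoin k T) (Set.range fun i => cS (b i) m) := by
    induction hs using Algebra.adjoin_induction with
    | mem x hx =>
      rcases hx with hx | ⟨y, rfl⟩
      · exact fun n hn =>
          Submodule.smul_mem _ (⟨x, Algebra.subset_adjoin hx⟩ : Algebra.adjoin k T) hn
      · exact hN y
    | algebraMap r => exact fun n hn => Submodule.smul_mem _ (algebraMap k (Algebra.adjoin k T) r) hn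
    | add x y _ _ hx hy => exact fun n hn => Submodule.add_mem _ (hx n hn) (hy n hn)
    | mul x y _ _ hx hy => exact fun n hn => hx _ (hy n hn)
  -- Since c(1) = 1, the vector m itself lies in the span.
  refine key m ?_
  have := hmem 1 m
  change c 1 m ∈ _ at this
  rwa [map_one, Module.End.one_apply] at this

/-- If two sets of endomorphisms generate the same algebra together with a finite-dimensional
separable algebra centralizing both of them, then one is completely reducible if the other is. -/
lemma CompletelyReducible.of_centralizing {C : Type*} [Ring C] [Algebra k C] [Module.Finite k C]
    {e : C ⊗[k] C} (he : IsCasimir e) (c : C →ₐ[k] Module.End k M) {T T' : Set (Module.End k M)}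
    (hc : ∀ f ∈ T, ∀ x, Commute f (c x)) (hc' : ∀ f ∈ T', ∀ x, Commute f (c x))
    (h : T ⊆ Algebra.adjoin k (T' ∪ Set.range c)) (h' : T' ⊆ Algebra.adjoin k (T ∪ Set.range c))
    (hT : CompletelyReducible T) : CompletelyReducible T' :=
  .of_union c hc' <| (hT.union_of_isCasimir he c hc).of_adjoin
    (Set.union_subset h (Set.subset_union_right.trans Algebra.subset_adjoin))
    (Set.union_subset h' (Set.subset_union_right.trans Algebra.subset_adjoin))

end CompletelyReducible

/-! ### Convolution algebras -/

namespace CrossedSystem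

section Convolution

variable {k : Type*} [Field k] {C D E A B : Type*} [AddCommMonoid C] [Module k C] [Coalgebra k C]
  [AddCommMonoid D] [Module k D] [Coalgebra k D] [AddCommMonoid E] [Module k E] [Coalgebra k E]
  [Ring A] [Algebra k A] [Ring B] [Algebra k B]

lemma pull_one (f : D →ₗc[k] C) : pull f (1 : WithConv (C →ₗ[k] A)) = 1 := by
  apply WithConv.ext
  ext x
  change algebraMap k A (counit (f x)) = algebraMap k A (counit x)
  rw [CoalgHomClass.counit_comp_apply]

lemma push_one (f : A →ₐ[k] B) : push f (1 : WithConv (C →ₗ[k] A)) = 1 := by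
  apply WithConv.ext
  ext x
  change f (algebraMap k A (counit x)) = algebraMap k B (counit x)
  simp

/-- Precomposition with a coalgebra homomorphism on convolution units. -/
noncomputable def pullUnits (f : D →ₗc[k] C) (φ : (WithConv (C →ₗ[k] A))ˣ) :
    (WithConv (D →ₗ[k] A))ˣ where
  val := pull f φ.val
  inv := pull f φ⁻¹.val
  val_inv := by rw [← pull_mul, Units.mul_inv, pull_one]
  inv_val := by rw [← pull_mul, Units.inv_mul, pull_one]

/-- Postcomposition with an algebra homomorphism on convolution units. -/
noncomputable def pushUnits (f : A →ₐ[k] B) (φ : (WithConv (C →ₗ[k] A))ˣ) :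
    (WithConv (C →ₗ[k] B))ˣ where
  val := push f φ.val
  inv := push f φ⁻¹.val
  val_inv := by rw [← push_mul, Units.mul_inv, push_one]
  inv_val := by rw [← push_mul, Units.inv_mul, push_one]

variable (k D) in
/-- The map `d ↦ ε(d) a`. -/
noncomputable def cst (a : A) : WithConv (D →ₗ[k] A) :=
  toConv (LinearMap.toSpanSingleton k A a ∘ₗ counit)

lemma cst_apply (a : A) (d : D) : cst k D a d = counit (R := k) d • a := rfl

lemma sum_counit_smul_left {ι : Type*} {d : D} (𝓡 : Coalgebra.Repr k d ι) :
    ∑ i ∈ 𝓡.index, counit (R := k) (𝓡.right i) • 𝓡.left i = d := by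
  have := congrArg (TensorProduct.rid k D) (sum_tmul_counit_eq 𝓡)
  simpa only [map_sum, TensorProduct.rid_tmul, one_smul] using this

lemma mul_cst_apply (φ : WithConv (D →ₗ[k] A)) (a : A) (d : D) :
    (φ * cst k D a) d = φ d * a := by
  rw [(ℛ k d).convMul_apply]
  conv_rhs => rw [← sum_counit_smul_left (ℛ k d)]
  simp [cst_apply, Finset.sum_mul]

lemma cst_mul_apply (φ : WithConv (D →ₗ[k] A)) (a : A) (d : D) :
    (cst k D a * φ) d = a * φ d := by
  rw [(ℛ k d).convMul_apply]
  conv_rhs => rw [← sum_counit_smul (ℛ k d)]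
  simp [cst_apply, Finset.mul_sum]

variable (k D A) in
/-- `a ↦ ε(·) a` as an algebra homomorphism. -/
noncomputable def cstHom : A →ₐ[k] WithConv (D →ₗ[k] A) :=
  AlgHom.ofLinearMap
    { toFun := cst k D
      map_add' := fun a b => by apply WithConv.ext; ext d; simp [cst]
      map_smul' := fun r a => by apply WithConv.ext; ext d; exact smul_comm _ _ _ }
    (by apply WithConv.ext; ext d; exact (Algebra.algebraMap_eq_smul_one _).symm)
    (fun a b => by
      apply WithConv.ext
      ext d
      change cst k D (a * b) d = (cst k D a * cst k D b) d
      rw [cst_mul_apply, cst_apply, cst_apply, mul_smul_comm])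

lemma pull_cst (f : D →ₗc[k] C) (a : A) : pull f (cst k C a) = cst k D a := by
  apply WithConv.ext
  ext x
  change cst k C a (f x) = cst k D a x
  rw [cst_apply, cst_apply, CoalgHomClass.counit_comp_apply]

lemma push_cst (f : A →ₐ[k] B) (a : A) : push f (cst k C a) = cst k C (f a) := by
  apply WithConv.ext
  ext x
  simp [push, cst]

/-- Elements commuting with all values of `φ` commute with `φ`. -/
lemma cst_commute (a : A) (φ : WithConv (D →ₗ[k] A)) (h : ∀ d, Commute a (φ d)) :
    Commute (cst k D a) φ := by
  apply WithConv.ext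
  ext d
  change (cst k D a * φ) d = (φ * cst k D a) d
  rw [cst_mul_apply, mul_cst_apply, h d]

variable (k D E) in
/-- The coalgebra homomorphism `x ⊗ y ↦ ε(x) y`. -/
noncomputable def sndC : D ⊗[k] E →ₗc[k] E :=
  (Coalgebra.TensorProduct.lid k E : k ⊗[k] E →ₗc[k] E).comp
    (Coalgebra.TensorProduct.map (counitCoalgHom k D) (CoalgHom.id k E))

lemma sndC_tmul (x : D) (y : E) : sndC k D E (x ⊗ₜ y) = counit (R := k) x • y := rfl

lemma fst_mul_snd_apply (φ : WithConv (D →ₗ[k] A)) (ψ : WithConv (E →ₗ[k] A)) (x : D) (y : E) :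
    (pull (fstC k D E) φ * pull (sndC k D E) ψ) (x ⊗ₜ y) = φ x * ψ y := by
  rw [fst_mul_apply _ _ (ℛ k x)]
  simp only [pull_apply, sndC_tmul]
  conv_rhs => rw [← sum_counit_smul_left (ℛ k x)]
  simp [Finset.sum_mul]

lemma mul_snd_apply {κ : Type*} (φ : WithConv (D ⊗[k] E →ₗ[k] A)) (ψ : WithConv (E →ₗ[k] A))
    (x : D) {y : E} (𝓡 : Coalgebra.Repr k y κ) :
    (φ * pull (sndC k D E) ψ) (x ⊗ₜ y) =
      ∑ i ∈ 𝓡.index, φ (x ⊗ₜ 𝓡.left i) * ψ (𝓡.right i) := by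
  rw [convMul_tmul _ _ (ℛ k x) 𝓡, Finset.sum_comm]
  simp only [pull_apply, sndC_tmul]
  refine Finset.sum_congr rfl fun i _ => ?_
  conv_rhs => rw [← sum_counit_smul_left (ℛ k x)]
  simp [TensorProduct.sum_tmul, Finset.sum_mul, ← TensorProduct.smul_tmul']

/-- Scalar-valued maps on a cocommutative coalgebra are central. -/
lemma push_ofId_commute [IsCocomm k D] (s : WithConv (D →ₗ[k] k)) (φ : WithConv (D →ₗ[k] A)) :
    Commute (push (Algebra.ofId k A) s) φ := by
  apply WithConv.ext
  refine LinearMap.ext fun d => ?_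
  change (push (Algebra.ofId k A) s * φ) d = (φ * push (Algebra.ofId k A) s) d
  rw [LinearMap.convMul_apply, LinearMap.convMul_apply, ← comm_comul k d, TensorProduct.map_comm,
    comm_comul]
  generalize comul (R := k) d = z
  induction z with
  | zero => simp
  | add z w hz hw => simp only [map_add, hz, hw]
  | tmul x y =>
    simp only [TensorProduct.map_tmul, TensorProduct.comm_tmul, LinearMap.mul'_apply]
    exact Algebra.commutes _ _

end Convolution

/-! ### The convolution action on Hom(D, M) -/

section ConvolutionModule

variable {k : Type*} [Field k] {C D A M : Type*} [AddCommMonoid C] [Module k C] [Coalgebra k C]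
  [AddCommMonoid D] [Module k D] [Coalgebra k D]
  [Ring A] [Algebra k A] [AddCommGroup M] [Module k M] [Module A M] [IsScalarTower k A M]

/-- The convolution action `(x ψ)(d) = ∑ x(d₁) ψ(d₂)`. -/
noncomputable def convAct (x : WithConv (D →ₗ[k] A)) (ψ : D →ₗ[k] M) : D →ₗ[k] M :=
  TensorProduct.lift (Algebra.lsmul k k M : A →ₐ[k] Module.End k M).toLinearMap ∘ₗ
    TensorProduct.map x.ofConv ψ ∘ₗ comul

lemma convAct_apply {ι : Type*} (x : WithConv (D →ₗ[k] A)) (ψ : D →ₗ[k] M) {d : D}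
    (𝓡 : Coalgebra.Repr k d ι) :
    convAct x ψ d = ∑ i ∈ 𝓡.index, x (𝓡.left i) • ψ (𝓡.right i) := by
  simp [convAct, ← 𝓡.eq]

lemma convAct_mul (x y : WithConv (D →ₗ[k] A)) (ψ : D →ₗ[k] M) :
    convAct (x * y) ψ = convAct x (convAct y ψ) := by
  ext d
  have := congrArg (TensorProduct.lift (Algebra.lsmul k k M : A →ₐ[k] Module.End k M).toLinearMap ∘ₗ
    TensorProduct.map x.ofConv (TensorProduct.lift
      (Algebra.lsmul k k M : A →ₐ[k] Module.End k M).toLinearMap ∘ₗ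
      TensorProduct.map y.ofConv ψ)) (sum_tmul_tmul_eq (ℛ k d) (fun i => ℛ k _) (fun i => ℛ k _))
  simp only [map_sum, LinearMap.comp_apply, TensorProduct.map_tmul, TensorProduct.lift.tmul] at this
  rw [convAct_apply _ _ (ℛ k d), convAct_apply _ _ (ℛ k d)]
  simp only [convAct_apply _ _ (ℛ k _), (ℛ k _).convMul_apply, Finset.smul_sum, Finset.sum_smul,
    mul_smul]
  exact this

lemma convAct_one (ψ : D →ₗ[k] M) : convAct (1 : WithConv (D →ₗ[k] A)) ψ = ψ := by
  ext d
  rw [convAct_apply _ _ (ℛ k d)]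
  conv_rhs => rw [← sum_counit_smul (ℛ k d)]
  simp

lemma convAct_cst (a : A) (ψ : D →ₗ[k] M) (d : D) : convAct (cst k D a) ψ d = a • ψ d := by
  rw [convAct_apply _ _ (ℛ k d)]
  conv_rhs => rw [← sum_counit_smul (ℛ k d)]
  simp [cst_apply, Finset.smul_sum, smul_comm a]

variable (k D A M) in
/-- The convolution action as a representation. -/
noncomputable def convActHom : WithConv (D →ₗ[k] A) →ₐ[k] Module.End k (D →ₗ[k] M) :=
  AlgHom.ofLinearMap
    { toFun := fun x =>
        { toFun := convAct x
          map_add' := fun ψ φ => by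
            ext d; simp [convAct_apply _ _ (ℛ k d), Finset.sum_add_distrib]
          map_smul' := fun r ψ => by
            ext d; simp [convAct_apply _ _ (ℛ k d), Finset.smul_sum, smul_comm r] }
      map_add' := fun x y => by
        ext ψ d; simp [convAct_apply _ _ (ℛ k d), Finset.sum_add_distrib, add_smul]
      map_smul' := fun r x => by
        ext ψ d; simp [convAct_apply _ _ (ℛ k d), Finset.smul_sum] }
    (LinearMap.ext convAct_one) (fun x y => LinearMap.ext (convAct_mul x y))

lemma convActHom_apply (x : WithConv (D →ₗ[k] A)) (ψ : D →ₗ[k] M) :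
    convActHom k D A M x ψ = convAct x ψ := rfl

/-- Naturality in the coalgebra; it is needed for f the multiplication H ⊗ H → H. -/
lemma convAct_pull (f : D →ₗc[k] C) (x : WithConv (C →ₗ[k] A)) (ψ : C →ₗ[k] M) :
    convAct (pull f x) (ψ ∘ₗ f.toLinearMap) = convAct x ψ ∘ₗ f.toLinearMap := by
  have := f.map_comp_comul
  have e : TensorProduct.map (pull f x).ofConv (ψ ∘ₗ f.toLinearMap) =
      TensorProduct.map x.ofConv ψ ∘ₗ TensorProduct.map f.toLinearMap f.toLinearMap :=
    TensorProduct.map_comp _ _ _ _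
  rw [convAct, convAct, LinearMap.comp_assoc, LinearMap.comp_assoc, ← this, e, LinearMap.comp_assoc]

end ConvolutionModule
end CrossedSystem

/-! ### Semisimple and cosemisimple Hopf algebras -/

namespace CrossedSystem

section Hopf

variable {k H : Type*} [Field k] [Ring H] [HopfAlgebra k H]

open HopfAlgebra

/-- A semisimple Hopf algebra has a normalized left integral. -/
lemma exists_left_integral [IsSemisimpleRing H] :
    ∃ t : H, counit (R := k) t = 1 ∧ ∀ h : H, h * t = counit (R := k) h • t := by
  -- The integral is the component of 1 in a left ideal L complementing the augmentation ideal: (h -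
  -- ε(h)) t lies in both, so it is zero.
  obtain ⟨L, hL⟩ := exists_isCompl (RingHom.ker (Bialgebra.counitAlgHom k H))
  have h1 : (1 : H) ∈ RingHom.ker (Bialgebra.counitAlgHom k H) ⊔ L := by
    rw [hL.sup_eq_top]; trivial
  obtain ⟨z, hz, t, ht, hzt⟩ := Submodule.mem_sup.1 h1
  refine ⟨t, ?_, fun h => ?_⟩
  · have := congrArg (Bialgebra.counitAlgHom k H) hzt
    rw [map_add, RingHom.mem_ker.1 hz, zero_add, map_one] at this
    exact this
  · have hmem : (h - algebraMap k H (counit h)) * t ∈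
        RingHom.ker (Bialgebra.counitAlgHom k H) ⊓ L := by
      refine ⟨?_, L.mul_mem_left _ ht⟩
      rw [SetLike.mem_coe, RingHom.mem_ker, map_mul, map_sub, AlgHom.commutes]
      simp
    rw [hL.inf_eq_bot, Ideal.mem_bot, sub_mul, sub_eq_zero] at hmem
    rw [hmem, Algebra.smul_def]

/-- A semisimple Hopf algebra has a normalized right integral. -/
lemma exists_right_integral [IsSemisimpleRing H] :
    ∃ t : H, counit (R := k) t = 1 ∧ ∀ h : H, t * h = counit (R := k) h • t := by
  -- The same splitting over the opposite ring, which is again semisimple and whose left ideals are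
  -- the right ideals of H.
  let K : Ideal Hᵐᵒᵖ :=
    { carrier := {x | counit (R := k) x.unop = 0}
      add_mem' := fun {x y} hx hy => by
        simp only [Set.mem_ofPred_eq] at hx hy ⊢
        rw [MulOpposite.unop_add, map_add, hx, hy, add_zero]
      zero_mem' := by simp
      smul_mem' := fun x y hy => by
        simp only [Set.mem_ofPred_eq] at hy ⊢
        rw [smul_eq_mul, MulOpposite.unop_mul, Bialgebra.counit_mul, hy, zero_mul] }
  obtain ⟨L, hL⟩ := exists_isCompl K
  have h1 : (1 : Hᵐᵒᵖ) ∈ K ⊔ L := by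
    rw [hL.sup_eq_top]; trivial
  obtain ⟨z, hz, t, ht, hzt⟩ := Submodule.mem_sup.1 h1
  have hz' : counit (R := k) z.unop = 0 := hz
  refine ⟨t.unop, ?_, fun h => ?_⟩
  · have := congrArg (fun x : Hᵐᵒᵖ => counit (R := k) x.unop) hzt
    simpa [hz'] using this
  · have hmem : MulOpposite.op (h - algebraMap k H (counit h)) * t ∈ K ⊓ L := by
      refine ⟨?_, L.mul_mem_left _ ht⟩
      change counit (R := k) (t.unop * (h - algebraMap k H (counit h))) = 0
      simp
    rw [hL.inf_eq_bot, Ideal.mem_bot] at hmem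
    have := congrArg MulOpposite.unop hmem
    rw [MulOpposite.unop_mul, MulOpposite.unop_op, MulOpposite.unop_zero, mul_sub,
      sub_eq_zero] at this
    rw [this, Algebra.smul_def, Algebra.commutes]

variable (k H) in
/-- The identity of `H` as an element of its convolution algebra. -/
noncomputable def idC : WithConv (H →ₗ[k] H) := toConv LinearMap.id

variable (k H) in
/-- The antipode of `H` as an element of its convolution algebra. -/
noncomputable def antC : WithConv (H →ₗ[k] H) := toConv (antipode k)

lemma antC_mul_idC : antC k H * idC k H = 1 := LinearMap.antipode_mul_id

lemma idC_mul_antC : idC k H * antC k H = 1 := LinearMap.id_mul_antipode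

lemma comul_eq_conv : (toConv comul : WithConv (H →ₗ[k] H ⊗[k] H)) =
    push Algebra.TensorProduct.includeLeft (idC k H) *
      push Algebra.TensorProduct.includeRight (idC k H) := by
  apply WithConv.ext
  ext h
  change comul (R := k) h = (push Algebra.TensorProduct.includeLeft (idC k H) *
      push Algebra.TensorProduct.includeRight (idC k H) : WithConv (H →ₗ[k] H ⊗[k] H)) h
  rw [(ℛ k h).convMul_apply, ← (ℛ k h).eq]
  simp [push_apply, idC]

lemma sum_antipode_tmul_one_mul_comul (h : H) :
    ∑ i ∈ (ℛ k h).index, (antipode k ((ℛ k h).left i) ⊗ₜ[k] 1) * comul (R := k) ((ℛ k h).right i) =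
      1 ⊗ₜ h := by
  have : push Algebra.TensorProduct.includeLeft (antC k H) *
      (toConv comul : WithConv (H →ₗ[k] H ⊗[k] H)) =
        push Algebra.TensorProduct.includeRight (idC k H) := by
    rw [comul_eq_conv, ← mul_assoc, ← push_mul, antC_mul_idC, push_one, one_mul]
  have := congrArg (fun φ : WithConv (H →ₗ[k] H ⊗[k] H) => φ h) this
  rwa [(ℛ k h).convMul_apply] at this

/-- Replace 1 ⊗ h by ∑ (S(h₁) ⊗ 1) Δ(h₂) and absorb h₂ into t. Multiplication on the second leg of
Δ(t) is thereby traded for multiplication on the first. -/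
lemma one_tmul_mul_comul_left_integral {t : H} (ht : ∀ h : H, h * t = counit (R := k) h • t)
    (h : H) : ((1 : H) ⊗ₜ[k] h) * comul t = (antipode k h ⊗ₜ 1) * comul (R := k) t := by
  rw [← sum_antipode_tmul_one_mul_comul, Finset.sum_mul]
  simp only [mul_assoc, ← Bialgebra.comul_mul, ht, map_smul]
  conv_rhs => rw [← sum_counit_smul_left (ℛ k h)]
  simp [TensorProduct.sum_tmul, Finset.sum_mul, ← TensorProduct.smul_tmul']

/-- A Hopf algebra with a normalized integral is finite-dimensional. -/
lemma finite_of_left_integral {t : H} (ht : ∀ h : H, h * t = counit (R := k) h • t)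
    (ht1 : counit (R := k) t = 1) : Module.Finite k H := by
  classical
  let B := Module.Basis.ofVectorSpace k H
  obtain ⟨c, hc⟩ := TensorProduct.eq_repr_basis_left B (comul (R := k) t)
  let D : Submodule k H := Submodule.span k (c.support.image c)
  have hcoord (f : H →ₗ[k] k) : TensorProduct.lid k H (f.rTensor H (comul (R := k) t)) ∈ D := by
    rw [← hc, Finsupp.sum, map_sum, map_sum]
    refine Submodule.sum_mem _ fun i hi => ?_
    rw [LinearMap.rTensor_tmul, TensorProduct.lid_tmul]
    exact D.smul_mem _ (Submodule.subset_span (Finset.mem_coe.2 (Finset.mem_image_of_mem c hi)))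
  -- The i-th coordinate functional on the first leg of Δ(t) picks out c i. Moving h to the first
  -- leg only changes the functional, so h c i is again a slice of Δ(t).
  have hleft (h : H) (i) : h * c i ∈ D := by
    have h1 (x : H ⊗[k] H) : TensorProduct.lid k H ((B.coord i).rTensor H ((1 ⊗ₜ h) * x)) =
        h * TensorProduct.lid k H ((B.coord i).rTensor H x) := by
      induction x with
      | zero => simp
      | add z w hz hw => simp only [map_add, mul_add, hz, hw]
      | tmul x y => simp
    have h2 (x : H ⊗[k] H) :
        TensorProduct.lid k H ((B.coord i).rTensor H ((antipode k h ⊗ₜ 1) * x)) =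
        TensorProduct.lid k H ((B.coord i ∘ₗ LinearMap.mulLeft k (antipode k h)).rTensor H x) := by
      induction x with
      | zero => simp
      | add z w hz hw => simp only [map_add, mul_add, hz, hw]
      | tmul x y => simp
    have h3 : TensorProduct.lid k H ((B.coord i).rTensor H (comul (R := k) t)) = c i := by
      rw [← hc, Finsupp.sum, map_sum, map_sum]
      simp [Finsupp.single_apply, eq_comm]
    rw [← h3, ← h1, one_tmul_mul_comul_left_integral ht, h2]
    exact hcoord _
  -- The antipode identity ∑ S(t₁) t₂ = ε(t) = 1 puts 1 into the left ideal D.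
  have h1 : (1 : H) = ∑ i ∈ c.support, antipode k (B i) * c i := by
    have := mul_antipode_rTensor_comul_apply (R := k) t
    rw [← hc, ht1, map_one, Finsupp.sum, map_sum, map_sum] at this
    simpa using this.symm
  have hD : D = ⊤ := by
    rw [eq_top_iff]
    rintro h -
    rw [← mul_one h, h1, Finset.mul_sum]
    refine Submodule.sum_mem _ fun i _ => ?_
    rw [← mul_assoc]
    exact hleft _ i
  exact ⟨⟨c.support.image c, hD⟩⟩

/-- `h ⊗ g ↦ h ⊗ S(g)` of `Δ(t)`, for a left integral `t`, is a separability idempotent. -/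
lemma isCasimir_of_left_integral {t : H} (ht : ∀ h : H, h * t = counit (R := k) h • t)
    (ht1 : counit (R := k) t = 1) : IsCasimir ((antipode k).lTensor H (comul (R := k) t)) where
  mul'_eq_one := by rw [mul_antipode_lTensor_comul_apply, ht1, map_one]
  comm c := by
    set e := (antipode k).lTensor H (comul (R := k) t) with he
    -- Applying id ⊗ S to Δ(ht) = ε(h) Δ(t) gives ∑ (h₁ ⊗ 1) e (1 ⊗ S(h₂)) = ε(h) e. Convolving on
    -- the right with the identity cancels S and leaves the Casimir relation.
    have h1 : push Algebra.TensorProduct.includeLeft (idC k H) * cst k H e *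
        push Algebra.TensorProduct.includeRight (antC k H) = cst k H e := by
      apply WithConv.ext
      refine LinearMap.ext fun h => ?_
      change (push Algebra.TensorProduct.includeLeft (idC k H) * cst k H e *
        push Algebra.TensorProduct.includeRight (antC k H) : WithConv (H →ₗ[k] H ⊗[k] H)) h =
          cst k H e h
      rw [(ℛ k h).convMul_apply]
      have h2 (x y : H) (z : H ⊗[k] H) : (antipode k).lTensor H ((x ⊗ₜ y) * z) =
          (x ⊗ₜ 1) * (antipode k).lTensor H z * (1 ⊗ₜ antipode k y) := by
        induction z with
        | zero => simp
        | add z w hz hw => simp only [map_add, mul_add, add_mul, hz, hw]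
        | tmul a b => simp [antipode_mul_antidistrib]
      have h3 := congrArg ((antipode k).lTensor H) (congrArg (comul (R := k)) (ht h))
      rw [Bialgebra.comul_mul, ← (ℛ k h).eq, Finset.sum_mul, map_sum, map_smul, map_smul] at h3
      simp only [h2] at h3
      rw [cst_apply, ← h3]
      refine Finset.sum_congr rfl fun i _ => ?_
      rw [mul_cst_apply]
      rfl
    have h4 : push Algebra.TensorProduct.includeLeft (idC k H) * cst k H e =
        cst k H e * push Algebra.TensorProduct.includeRight (idC k H) := by
      conv_rhs => rw [← h1]
      rw [mul_assoc, mul_assoc, ← push_mul, antC_mul_idC, push_one, mul_one]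
    have := congrArg (fun φ : WithConv (H →ₗ[k] H ⊗[k] H) => φ c) h4
    simp only [mul_cst_apply, cst_mul_apply] at this
    exact this

/-- A cosemisimple Hopf algebra has a normalized integral in its dual. -/
lemma exists_dual_integral (hH : IsCosemisimple k H) : ∃ l : H →ₗ[k] k, l 1 = 1 ∧
    idC k H * push (Algebra.ofId k H) (toConv l) = push (Algebra.ofId k H) (toConv l) := by
  let 𝒟 : Set (Submodule k H) := {D | IsSimpleSubcoalgebra k D ∧ (1 : H) ∉ D}
  -- A convolution product vanishes on a subcoalgebra as soon as one factor does, and evaluation at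
  -- the group-like element 1 is multiplicative. Hence one functional can kill finitely many members
  -- of 𝒟 without killing 1.
  have hfin (s : Finset (Submodule k H)) (hs : ↑s ⊆ 𝒟) :
      ∃ f : H →ₗ[k] k, f 1 = 1 ∧ ∀ D ∈ s, ∀ d ∈ D, f d = 0 := by
    classical
    induction s using Finset.induction_on with
    | empty => exact ⟨counit, Bialgebra.counit_one, by simp⟩
    | insert D s _ ih =>
      rw [Finset.coe_insert, Set.insert_subset_iff] at hs
      obtain ⟨g, hg1, hg⟩ := ih hs.2
      obtain ⟨f, hf1, hf⟩ := Submodule.exists_le_ker_of_notMem hs.1.2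
      refine ⟨LinearMap.mul' k k ∘ₗ TensorProduct.map ((f 1)⁻¹ • f) g ∘ₗ comul, ?_, ?_⟩
      · simp [Algebra.TensorProduct.one_def, hf1, hg1]
      · intro E hE d hd
        have hEs : IsSubcoalgebra k E := by
          rcases Finset.mem_insert.1 hE with rfl | hE
          · exact hs.1.1.1
          · exact (hs.2 hE).1.1
        obtain ⟨z, hz⟩ := hEs d hd
        rw [LinearMap.comp_apply, LinearMap.comp_apply, ← hz]
        clear hz
        induction z with
        | zero => simp
        | add z w hz hw => simp only [map_add, hz, hw, add_zero]
        | tmul x y =>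
          rcases Finset.mem_insert.1 hE with rfl | hE
          · simp [LinearMap.mem_ker.1 (hf x.2)]
          · simp [hg E hE y y.2]
  have h1 : (1 : H) ∉ sSup 𝒟 := by
    intro h
    obtain ⟨s, hs, h⟩ := Submodule.mem_sSup_iff_exists_finset.1 h
    obtain ⟨f, hf1, hf⟩ := hfin s hs
    have : (⨆ D ∈ s, D) ≤ LinearMap.ker f := iSup₂_le fun D hD d hd => hf D hD d hd
    have := this h
    rw [LinearMap.mem_ker, hf1] at this
    exact one_ne_zero this
  obtain ⟨f, hf1, hf⟩ := Submodule.exists_le_ker_of_notMem h1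
  refine ⟨(f 1)⁻¹ • f, by simp [hf1], ?_⟩
  set l := (f 1)⁻¹ • f with hl
  have hlD (D) (hD : D ∈ 𝒟) (d) (hd : d ∈ D) : l d = 0 := by
    have : f d = 0 := hf (le_sSup hD hd)
    simp [hl, this]
  apply WithConv.ext
  rw [← LinearMap.eqLocus_eq_top, eq_top_iff]
  have hH' : sSup {D : Submodule k H | IsSimpleSubcoalgebra k D} = ⊤ := hH
  rw [← hH']
  refine sSup_le fun D hD d hd => ?_
  change (idC k H * push (Algebra.ofId k H) (toConv l)) d = push (Algebra.ofId k H) (toConv l) d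
  by_cases h1D : (1 : H) ∈ D
  -- The line through 1 is a subcoalgebra, so a simple subcoalgebra containing 1 equals it.
  · have hspan : Submodule.span k {(1 : H)} = D := by
      refine (hD.2.2 _ ?_ ?_).resolve_left ?_
      · intro x hx
        obtain ⟨r, rfl⟩ := Submodule.mem_span_singleton.1 hx
        refine ⟨(⟨_, hx⟩ : Submodule.span k {(1 : H)}) ⊗ₜ
          (⟨1, Submodule.mem_span_singleton_self _⟩ : Submodule.span k {(1 : H)}), ?_⟩
        simp [Algebra.TensorProduct.one_def, TensorProduct.smul_tmul']
      · simpa using h1D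
      · intro h
        have : (1 : H) = 0 := by simpa using h
        have := congrArg (counit (R := k)) this
        simp at this
    rw [← hspan] at hd
    obtain ⟨r, rfl⟩ := Submodule.mem_span_singleton.1 hd
    rw [LinearMap.convMul_apply]
    simp [Algebra.TensorProduct.one_def, idC, push, hl, hf1]
  -- Here l vanishes on D, and Δ(D) ⊆ D ⊗ D makes both sides zero.
  · obtain ⟨z, hz⟩ := hD.1 d hd
    rw [LinearMap.convMul_apply, ← hz, push_apply]
    have : (toConv l : WithConv (H →ₗ[k] k)) d = 0 := hlD D ⟨hD, h1D⟩ d hd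
    rw [this, map_zero]
    clear hz
    induction z with
    | zero => simp
    | add z w hz hw => simp only [map_add, hz, hw, add_zero]
    | tmul x y =>
      simp [push, hlD D ⟨hD, h1D⟩ y y.2]

end Hopf
end CrossedSystem

/-! ### Separability of the dual of a cocommutative Hopf algebra -/

namespace CrossedSystem

/-- Transport of structure: Θ turns the two outer multiplications on C ⊗ C into multiplication by i
f and j f, and the product map into m. It will be applied with E the dual of H ⊗ H, where elements
are functions of two variables. -/
lemma isCasimir_of_linearEquiv {k C E : Type*} [Field k] [Ring C] [Algebra k C] [Ring E]
    [Algebra k E] (Θ : C ⊗[k] C ≃ₗ[k] E) (i j : C → E) (hi : ∀ f g, i (f * g) = i f * i g)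
    (hj : ∀ f g, j (f * g) = j f * j g) (hΘ : ∀ f g, Θ (f ⊗ₜ g) = i f * j g) (m : E →ₗ[k] C)
    (hm : ∀ f g, m (i f * j g) = f * g) {Λ : E} (hΛ1 : m Λ = 1) (hΛ : ∀ f, i f * Λ = Λ * j f) :
    IsCasimir (Θ.symm Λ) where
  mul'_eq_one := by
    have (z : C ⊗[k] C) : LinearMap.mul' k C z = m (Θ z) := by
      induction z with
      | zero => simp
      | add z w hz hw => simp only [map_add, hz, hw]
      | tmul a b => rw [hΘ, hm, LinearMap.mul'_apply]
    rw [this, LinearEquiv.apply_symm_apply, hΛ1]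
  comm f := by
    have hl (z : C ⊗[k] C) : Θ ((f ⊗ₜ 1) * z) = i f * Θ z := by
      induction z with
      | zero => simp
      | add z w hz hw => simp only [map_add, mul_add, hz, hw]
      | tmul a b => rw [Algebra.TensorProduct.tmul_mul_tmul, hΘ, hΘ, one_mul, hi, mul_assoc]
    have hr (z : C ⊗[k] C) : Θ (z * (1 ⊗ₜ f)) = Θ z * j f := by
      induction z with
      | zero => simp
      | add z w hz hw => simp only [map_add, add_mul, hz, hw]
      | tmul a b => rw [Algebra.TensorProduct.tmul_mul_tmul, hΘ, hΘ, mul_one, hj, mul_assoc]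
    apply Θ.injective
    rw [hl, hr, LinearEquiv.apply_symm_apply, hΛ]

section Cocomm

variable {k H : Type*} [Field k] [Ring H] [HopfAlgebra k H] [IsCocomm k H]

open HopfAlgebra

variable (k H) in
-- Both sides are convolution inverses of Δ. For (S ⊗ S) ∘ Δ this uses cocommutativity: Δ is then a
-- coalgebra map, so (S ⊗ S) * (id ⊗ id) = 1 can be pulled back along it.
lemma comul_comp_antipode : comul ∘ₗ antipode k (A := H) =
    TensorProduct.map (antipode k) (antipode k) ∘ₗ comul := by
  have h1 := LinearMap.comul_right_inv (R := k) (C := H)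
  have h2 : pull (comulCoalgHom k H) (toConv (TensorProduct.map (antipode k) (antipode k))) *
      (toConv comul : WithConv (H →ₗ[k] H ⊗[k] H)) = 1 := by
    have : (toConv comul : WithConv (H →ₗ[k] H ⊗[k] H)) =
      pull (comulCoalgHom k H) (toConv (TensorProduct.map LinearMap.id LinearMap.id)) := by
      rw [TensorProduct.map_id]; rfl
    rw [this, ← pull_mul]
    have e := TensorProduct.map_convMul_map (f := antC k H) (h := idC k H) (g := antC k H)
      (k := idC k H)
    rw [antC_mul_idC] at e
    have e1 : toConv (TensorProduct.map (1 : WithConv (H →ₗ[k] H)).ofConv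
        (1 : WithConv (H →ₗ[k] H)).ofConv) = (1 : WithConv (H ⊗[k] H →ₗ[k] H ⊗[k] H)) := by
      apply WithConv.ext
      ext x y
      simp [Algebra.algebraMap_eq_smul_one, Algebra.TensorProduct.one_def,
        TensorProduct.smul_tmul', TensorProduct.tmul_smul, smul_smul, mul_comm]
    rw [e1] at e
    change pull (comulCoalgHom k H) (toConv (TensorProduct.map (antC k H).ofConv (antC k H).ofConv)
      * toConv (TensorProduct.map (idC k H).ofConv (idC k H).ofConv)) = 1
    rw [e, pull_one]
  exact congrArg WithConv.ofConv (left_inv_eq_right_inv h2 h1).symm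

variable (k H) in
/-- The antipode of a cocommutative Hopf algebra as a coalgebra homomorphism. -/
noncomputable def antipodeC : H →ₗc[k] H where
  __ := antipode k
  counit_comp := counit_comp_antipode
  map_comp_comul := (comul_comp_antipode k H).symm

variable (k H) in
/-- `h ↦ h₁ ⊗ S(h₂)` -/
noncomputable def comulAntipode : H →ₗc[k] H ⊗[k] H :=
  (Coalgebra.TensorProduct.map (CoalgHom.id k H) (antipodeC k H)).comp (comulCoalgHom k H)

variable (k H) in
/-- `h ⊗ g ↦ h S(g)` -/
noncomputable def mulAntipode : H ⊗[k] H →ₗc[k] H :=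
  (Bialgebra.mulCoalgHom k H).comp (Coalgebra.TensorProduct.map (CoalgHom.id k H) (antipodeC k H))

variable (k H) in
lemma mulAntipode_mul_snd : pull (mulAntipode k H) (idC k H) * pull (sndC k H H) (idC k H) =
    pull (fstC k H H) (idC k H) := by
  apply WithConv.ext
  ext h g
  change (pull (mulAntipode k H) (idC k H) * pull (sndC k H H) (idC k H)) (h ⊗ₜ g) =
    pull (fstC k H H) (idC k H) (h ⊗ₜ g)
  rw [mul_snd_apply _ _ _ (ℛ k g)]
  change ∑ i ∈ (ℛ k g).index, (h * antipode k ((ℛ k g).left i)) * (ℛ k g).right i =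
    counit (R := k) g • h
  simp only [mul_assoc]
  rw [← Finset.mul_sum, sum_antipode_mul_eq_smul, mul_smul_comm, mul_one]

/-- Pulling the invariance of l back along h ⊗ g ↦ h S(g) gives ∑ h₁ l(h₂ S(g)) = ∑ l(h S(g₁)) g₂;
applying f shows that the function l(h S(g)) satisfies the Casimir relation in the dual. -/
lemma dual_integral_comm {l : H →ₗ[k] k} (hl : idC k H * push (Algebra.ofId k H) (toConv l) =
    push (Algebra.ofId k H) (toConv l)) (f : WithConv (H →ₗ[k] k)) :
    pull (fstC k H H) f * pull (mulAntipode k H) (toConv l) =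
      pull (mulAntipode k H) (toConv l) * pull (sndC k H H) f := by
  have key : pull (fstC k H H) (idC k H) *
      push (Algebra.ofId k H) (pull (mulAntipode k H) (toConv l)) =
      push (Algebra.ofId k H) (pull (mulAntipode k H) (toConv l)) *
        pull (sndC k H H) (idC k H) := by
    rw [← mulAntipode_mul_snd, mul_assoc,
      (push_ofId_commute (pull (mulAntipode k H) (toConv l)) (pull (sndC k H H) (idC k H))).eq.symm,
      ← mul_assoc, ← pull_push, ← pull_mul, hl]
  have hf (φ : WithConv (H ⊗[k] H →ₗ[k] H)) (s : WithConv (H ⊗[k] H →ₗ[k] k)) :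
      (toConv (f.ofConv ∘ₗ (φ * push (Algebra.ofId k H) s).ofConv)) =
        (toConv (f.ofConv ∘ₗ φ.ofConv)) * s := by
    apply WithConv.ext
    refine LinearMap.ext fun d => ?_
    change f ((φ * push (Algebra.ofId k H) s) d) = (toConv (f.ofConv ∘ₗ φ.ofConv) * s) d
    rw [(ℛ k d).convMul_apply, (ℛ k d).convMul_apply, map_sum]
    refine Finset.sum_congr rfl fun i _ => ?_
    rw [push_apply, Algebra.ofId_apply, ← Algebra.commutes, ← Algebra.smul_def, map_smul,
      smul_eq_mul, mul_comm]
    rfl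
  have := congrArg (fun φ : WithConv (H ⊗[k] H →ₗ[k] H) => toConv (f.ofConv ∘ₗ φ.ofConv)) key
  rw [hf, (push_ofId_commute _ _).eq, hf] at this
  rw [mul_comm (pull (mulAntipode k H) _)]
  exact this

/-- The dual of a cosemisimple cocommutative finite-dimensional Hopf algebra is separable. -/
lemma exists_isCasimir_dual [Module.Finite k H] {l : H →ₗ[k] k} (hl1 : l 1 = 1)
    (hl : idC k H * push (Algebra.ofId k H) (toConv l) = push (Algebra.ofId k H) (toConv l)) :
    ∃ e : WithConv (H →ₗ[k] k) ⊗[k] WithConv (H →ₗ[k] k), IsCasimir e := by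
  let Θ : WithConv (H →ₗ[k] k) ⊗[k] WithConv (H →ₗ[k] k) ≃ₗ[k] WithConv (H ⊗[k] H →ₗ[k] k) :=
    (TensorProduct.congr (WithConv.linearEquiv k _) (WithConv.linearEquiv k _)).trans
      ((TensorProduct.dualDistribEquiv k H H).trans (WithConv.linearEquiv k _).symm)
  have hΘ (f g : WithConv (H →ₗ[k] k)) :
      Θ (f ⊗ₜ g) = pull (fstC k H H) f * pull (sndC k H H) g := by
    apply WithConv.ext
    ext x y
    exact (fst_mul_snd_apply f g x y).symm
  let m : WithConv (H ⊗[k] H →ₗ[k] k) →ₗ[k] WithConv (H →ₗ[k] k) :=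
    { toFun := pull (comulCoalgHom k H)
      map_add' := fun _ _ => rfl
      map_smul' := fun _ _ => rfl }
  refine ⟨_, isCasimir_of_linearEquiv Θ (pull (fstC k H H)) (pull (sndC k H H))
    (pull_mul _) (pull_mul _) hΘ m (fun f g => ?_) (Λ := pull (mulAntipode k H) (toConv l)) ?_
    (dual_integral_comm hl)⟩
  · change pull (comulCoalgHom k H) _ = _
    rw [pull_mul, pull_pull, pull_pull]
    have h1 : (fstC k H H).comp (comulCoalgHom k H) = CoalgHom.id k H := by
      apply CoalgHom.coe_linearMap_injective
      ext x
      change fstC k H H (comul x) = x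
      rw [← (ℛ k x).eq, map_sum]
      exact sum_counit_smul_left _
    have h2 : (sndC k H H).comp (comulCoalgHom k H) = CoalgHom.id k H := by
      apply CoalgHom.coe_linearMap_injective
      ext x
      change sndC k H H (comul x) = x
      rw [← (ℛ k x).eq, map_sum]
      exact sum_counit_smul _
    rw [h1, h2]
    rfl
  · change pull (comulCoalgHom k H) _ = _
    rw [pull_pull]
    apply WithConv.ext
    ext x
    change l (LinearMap.mul' k H (TensorProduct.map LinearMap.id (antipode k) (comul x))) =
      counit x
    have := mul_antipode_lTensor_comul_apply (R := k) x
    rw [LinearMap.lTensor] at this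
    rw [this, Algebra.algebraMap_eq_smul_one, map_smul, hl1, smul_eq_mul, mul_one]

end Cocomm
end CrossedSystem

/-! ### The cleft structure of a crossed product -/

namespace CrossedSystem

variable {k : Type u} {H : Type v} {R : Type w} [Field k] [Ring H]
    [HopfAlgebra k H] [Ring R] [Algebra k R] (X : CrossedSystem k H R)

open HopfAlgebra

lemma hash_mul (x y : R ⊗[k] H) : X.hash x * X.hash y = X.hash (X.mulMap x y) := rfl

/-- The embedding `r ↦ r # 1`. -/
noncomputable def incl : R →ₐ[k] X.CrossedProduct :=
  AlgHom.ofLinearMap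
    (X.hash.toLinearMap ∘ₗ (Algebra.TensorProduct.includeLeft : R →ₐ[k] R ⊗[k] H).toLinearMap) rfl
    (fun a b => by
      change X.hash ((a * b) ⊗ₜ 1) = X.hash (a ⊗ₜ 1) * X.hash (b ⊗ₜ 1)
      have h := X.mulMap_left a (1 ⊗ₜ 1) (b ⊗ₜ 1)
      rw [mulMap_one_mul] at h
      simp only [Algebra.TensorProduct.tmul_mul_tmul, mul_one] at h
      rw [hash_mul, h])

/-- The map `h ↦ 1 # h`. -/
noncomputable def sect : H →ₗ[k] X.CrossedProduct :=
  X.hash.toLinearMap ∘ₗ (Algebra.TensorProduct.includeRight : H →ₐ[k] R ⊗[k] H).toLinearMap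

lemma incl_mul_hash (a : R) (x : R ⊗[k] H) : X.incl a * X.hash x = X.hash ((a ⊗ₜ 1) * x) := by
  have h := X.mulMap_left a (1 ⊗ₜ 1) x
  rw [mulMap_one_mul, ← Algebra.TensorProduct.one_def, mul_one] at h
  exact congrArg X.hash h

lemma incl_mul_sect (a : R) (h : H) : X.incl a * X.sect h = X.hash (a ⊗ₜ h) := by
  have := X.incl_mul_hash a (1 ⊗ₜ h)
  rwa [Algebra.TensorProduct.tmul_mul_tmul, mul_one, one_mul] at this

lemma sect_one : X.sect 1 = 1 := rfl

@[elab_as_elim]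
lemma crossedProduct_induction {p : X.CrossedProduct → Prop} (z : X.CrossedProduct)
    (h0 : p 0) (hadd : ∀ x y, p x → p y → p (x + y)) (h : ∀ r h, p (X.incl r * X.sect h)) : p z := by
  obtain ⟨x, rfl⟩ := X.hash.surjective z
  induction x with
  | zero => rwa [map_zero]
  | add x y hx hy => rw [map_add]; exact hadd _ _ hx hy
  | tmul r g => rw [← incl_mul_sect]; exact h r g

/-- `h ↦ 1 # h` as an element of the convolution algebra. -/
noncomputable def sectC : WithConv (H →ₗ[k] X.CrossedProduct) := toConv X.sect

lemma sectC_apply (h : H) : X.sectC h = X.sect h := rfl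

lemma Q_one : X.Q 1 = push Algebra.TensorProduct.includeLeft X.σ.val * mulH k H R := by
  have h1 : X.actH 1 = 1 := by
    apply WithConv.ext
    ext h
    exact X.act_one h
  rw [Q_eq, h1, push_one, pull_one, one_mul]

lemma sect_mul_incl (h : H) (b : R) {ι : Type*} (𝓡 : Coalgebra.Repr k h ι) :
    X.sect h * X.incl b =
      ∑ i ∈ 𝓡.index, X.incl (X.act (𝓡.left i) b) * X.sect (𝓡.right i) := by
  have e : X.sect h * X.incl b = X.hash (X.mulMap (1 ⊗ₜ h) (b ⊗ₜ 1)) := rfl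
  have e2 (g : H) : X.Q 1 (g ⊗ₜ 1) = 1 ⊗ₜ g := by rw [← mulMap_one_left, mulMap_mul_one]
  have e3 := X.Q_mul b 1
  rw [mul_one] at e3
  rw [e, mulMap_one_left, e3, fst_mul_apply _ _ 𝓡, map_sum]
  refine Finset.sum_congr rfl fun i _ => ?_
  rw [e2, incl_mul_sect, push_apply, Algebra.TensorProduct.includeLeft_apply,
    Algebra.TensorProduct.tmul_mul_tmul, mul_one, one_mul]
  rfl

lemma sectC_mul_cst (b : R) :
    X.sectC * cst k H (X.incl b) = push X.incl (X.actH b) * X.sectC := by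
  apply WithConv.ext
  refine LinearMap.ext fun h => ?_
  change (X.sectC * cst k H (X.incl b)) h = (push X.incl (X.actH b) * X.sectC) h
  rw [mul_cst_apply, (ℛ k h).convMul_apply]
  exact X.sect_mul_incl h b (ℛ k h)

/-- Together with `sectC_mul_cst` this puts the multiplication of the crossed product into
convolution form, where inverses of γ and σ can be moved around without Sweedler indices. -/
lemma sectC_mul_sectC : pull (fstC k H H) X.sectC * pull (sndC k H H) X.sectC =
    push X.incl X.σ.val * pull (Bialgebra.mulCoalgHom k H) X.sectC := by
  apply WithConv.ext
  ext h g
  change (pull (fstC k H H) X.sectC * pull (sndC k H H) X.sectC) (h ⊗ₜ g) =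
    (push X.incl X.σ.val * pull (Bialgebra.mulCoalgHom k H) X.sectC) (h ⊗ₜ g)
  rw [fst_mul_snd_apply]
  change X.hash (X.mulMap (1 ⊗ₜ h) (1 ⊗ₜ g)) = _
  rw [mulMap_one_left, Q_one, (ℛ k _).convMul_apply, (ℛ k _).convMul_apply, map_sum]
  refine Finset.sum_congr rfl fun i _ => ?_
  rw [push_apply, push_apply, Algebra.TensorProduct.includeLeft_apply, ← incl_mul_hash]
  rfl

/-! #### The convolution inverse of `h ↦ 1 # h` -/

section CleftInverse

variable (k H) in
/-- `g ⊗ h ↦ g h₁ ⊗ h₂` -/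
noncomputable def galois : H ⊗[k] H ≃ₗ[k] H ⊗[k] H :=
  let f (φ : H →ₗ[k] H ⊗[k] H) : H ⊗[k] H →ₗ[k] H ⊗[k] H :=
    TensorProduct.lift ((LinearMap.mul k (H ⊗[k] H)).compl₂ φ ∘ₗ
      (Algebra.TensorProduct.includeLeft : H →ₐ[k] H ⊗[k] H).toLinearMap)
  -- Both maps have the form g ⊗ h ↦ g φ(h₁) ⊗ h₂ and compose by convolving φ, so the identity and
  -- the antipode give mutually inverse maps.
  have hf (φ ψ : WithConv (H →ₗ[k] H)) (h : φ * ψ = 1) :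
      f (push Algebra.TensorProduct.includeLeft ψ *
        push Algebra.TensorProduct.includeRight (idC k H)).ofConv ∘ₗ
      f (push Algebra.TensorProduct.includeLeft φ *
        push Algebra.TensorProduct.includeRight (idC k H)).ofConv = LinearMap.id := by
    have hl (φ) (a : H) (z : H ⊗[k] H) : f φ ((a ⊗ₜ 1) * z) = (a ⊗ₜ 1) * f φ z := by
      induction z with
      | zero => simp
      | add z w hz hw => simp only [mul_add, map_add, hz, hw]
      | tmul x y => simp [f, ← mul_assoc]
    ext x y
    change f _ ((x ⊗ₜ 1) * (push Algebra.TensorProduct.includeLeft φ *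
        push Algebra.TensorProduct.includeRight (idC k H) : WithConv (H →ₗ[k] H ⊗[k] H)) y) = x ⊗ₜ y
    have e : (push Algebra.TensorProduct.includeLeft φ *
      (push Algebra.TensorProduct.includeLeft ψ *
        push Algebra.TensorProduct.includeRight (idC k H)) : WithConv (H →ₗ[k] H ⊗[k] H)) =
        push Algebra.TensorProduct.includeRight (idC k H) := by
      rw [← mul_assoc, ← push_mul, h, push_one, one_mul]
    have e' := congrArg (fun φ : WithConv (H →ₗ[k] H ⊗[k] H) => φ y) e
    rw [(ℛ k y).convMul_apply] at e'
    rw [hl, (ℛ k y).convMul_apply, map_sum]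
    have e2 (i) : (f (push Algebra.TensorProduct.includeLeft ψ *
        push Algebra.TensorProduct.includeRight (idC k H)).ofConv)
        (push Algebra.TensorProduct.includeLeft φ ((ℛ k y).left i) *
          push Algebra.TensorProduct.includeRight (idC k H) ((ℛ k y).right i)) =
        push Algebra.TensorProduct.includeLeft φ ((ℛ k y).left i) *
        (push Algebra.TensorProduct.includeLeft ψ *
          push Algebra.TensorProduct.includeRight (idC k H) : WithConv (H →ₗ[k] H ⊗[k] H))
          ((ℛ k y).right i) := by
      rw [push_apply, Algebra.TensorProduct.includeLeft_apply, hl]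
      congr 1
      change ((1 : H) ⊗ₜ[k] (1 : H)) * _ = _
      rw [← Algebra.TensorProduct.one_def, one_mul]
      rfl
    rw [Finset.sum_congr rfl fun i _ => e2 i, e']
    simp [push, idC]
  LinearEquiv.ofLinearMap _ _ (hf (antC k H) (idC k H) antC_mul_idC)
    (hf (idC k H) (antC k H) idC_mul_antC)

lemma galois_tmul (g h : H) : galois k H (g ⊗ₜ h) =
    (g ⊗ₜ 1) * (push Algebra.TensorProduct.includeLeft (idC k H) *
        push Algebra.TensorProduct.includeRight (idC k H) : WithConv (H →ₗ[k] H ⊗[k] H)) h := rfl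

/-- `h ↦ (1 # h₁) ⊗ h₂` -/
noncomputable def coactSect : WithConv (H →ₗ[k] X.CrossedProduct ⊗[k] H) :=
  push Algebra.TensorProduct.includeLeft X.sectC *
    push Algebra.TensorProduct.includeRight (idC k H)

/-- `a ⊗ h ↦ a (1 # h₁) ⊗ h₂` -/
noncomputable def can : X.CrossedProduct ⊗[k] H →ₗ[k] X.CrossedProduct ⊗[k] H :=
  TensorProduct.lift ((LinearMap.mul k (X.CrossedProduct ⊗[k] H)).compl₂ X.coactSect.ofConv ∘ₗ
    (Algebra.TensorProduct.includeLeft :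
      X.CrossedProduct →ₐ[k] X.CrossedProduct ⊗[k] H).toLinearMap)

lemma can_tmul (a : X.CrossedProduct) (h : H) :
    X.can (a ⊗ₜ h) = (a ⊗ₜ 1) * X.coactSect h := rfl

lemma can_mul (a : X.CrossedProduct) (z : X.CrossedProduct ⊗[k] H) :
    X.can ((a ⊗ₜ 1) * z) = (a ⊗ₜ 1) * X.can z := by
  induction z with
  | zero => simp
  | add z w hz hw => simp only [mul_add, map_add, hz, hw]
  | tmul b h =>
    rw [Algebra.TensorProduct.tmul_mul_tmul, can_tmul, can_tmul, ← mul_assoc,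
      Algebra.TensorProduct.tmul_mul_tmul, one_mul, one_mul]

/-- `g ⊗ h ↦ (1 # g) ⊗ h` -/
noncomputable def sectId : WithConv (H ⊗[k] H →ₗ[k] X.CrossedProduct ⊗[k] H) :=
  toConv (TensorProduct.map X.sect LinearMap.id)

/-- `r ↦ (r # 1) ⊗ 1` -/
noncomputable def inclLeft : R →ₐ[k] X.CrossedProduct ⊗[k] H :=
  (Algebra.TensorProduct.includeLeft : X.CrossedProduct →ₐ[k] X.CrossedProduct ⊗[k] H).comp X.incl

/-- The decomposition of `(R #_σ H) ⊗ H` as `R ⊗ (H ⊗ H)`. -/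
noncomputable def decomp : X.CrossedProduct ⊗[k] H ≃ₗ[k] R ⊗[k] (H ⊗[k] H) :=
  (TensorProduct.congr X.hash.symm (LinearEquiv.refl k H)).trans (TensorProduct.assoc k R H H)

lemma decomp_apply (r : R) (x : H ⊗[k] H) :
    X.decomp (X.inclLeft r * X.sectId x) = r ⊗ₜ x := by
  induction x with
  | zero => simp
  | add x y hx hy => simp only [map_add, mul_add, hx, hy, TensorProduct.tmul_add]
  | tmul g h =>
    change X.decomp ((X.incl r ⊗ₜ 1) * (X.sect g ⊗ₜ h)) = r ⊗ₜ (g ⊗ₜ h)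
    rw [Algebra.TensorProduct.tmul_mul_tmul, incl_mul_sect, one_mul]
    rfl

lemma decomp_symm (r : R) (x : H ⊗[k] H) :
    X.decomp.symm (r ⊗ₜ x) = X.inclLeft r * X.sectId x := by
  rw [LinearEquiv.symm_apply_eq, decomp_apply]

lemma sectId_galois : (toConv (X.sectId.ofConv ∘ₗ (galois k H).toLinearMap) :
      WithConv (H ⊗[k] H →ₗ[k] X.CrossedProduct ⊗[k] H)) =
    push Algebra.TensorProduct.includeLeft (pull (Bialgebra.mulCoalgHom k H) X.sectC) *
      push Algebra.TensorProduct.includeRight (pull (sndC k H H) (idC k H)) := by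
  apply WithConv.ext
  ext g h
  change X.sectId (galois k H (g ⊗ₜ h)) = (push Algebra.TensorProduct.includeLeft
    (pull (Bialgebra.mulCoalgHom k H) X.sectC) * push Algebra.TensorProduct.includeRight
      (pull (sndC k H H) (idC k H)) : WithConv (H ⊗[k] H →ₗ[k] X.CrossedProduct ⊗[k] H)) (g ⊗ₜ h)
  rw [galois_tmul, ← pull_push _ (idC k H), mul_snd_apply _ _ _ (ℛ k h), (ℛ k h).convMul_apply,
    Finset.mul_sum, map_sum]
  refine Finset.sum_congr rfl fun i _ => ?_
  simp only [push_apply, Algebra.TensorProduct.includeLeft_apply,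
    Algebra.TensorProduct.includeRight_apply, Algebra.TensorProduct.tmul_mul_tmul, one_mul, mul_one]
  rfl

/-- Because γ(g) γ(h) = ∑ σ(g₁, h₁) γ(g₂ h₂), the map `can` is, on R ⊗ (H ⊗ H), the Galois map of H
convolved with σ. Both ingredients are invertible, which dictates the formula for `canInv`. -/
lemma can_sectId : (toConv (X.can ∘ₗ X.sectId.ofConv) :
      WithConv (H ⊗[k] H →ₗ[k] X.CrossedProduct ⊗[k] H)) =
    push X.inclLeft X.σ.val * toConv (X.sectId.ofConv ∘ₗ (galois k H).toLinearMap) := by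
  have h1 : (toConv (X.can ∘ₗ X.sectId.ofConv) :
      WithConv (H ⊗[k] H →ₗ[k] X.CrossedProduct ⊗[k] H)) =
      push Algebra.TensorProduct.includeLeft (pull (fstC k H H) X.sectC) *
        pull (sndC k H H) X.coactSect := by
    apply WithConv.ext
    ext g h
    rw [← pull_push]
    exact (fst_mul_snd_apply (push Algebra.TensorProduct.includeLeft X.sectC) X.coactSect g h).symm
  rw [h1, coactSect, pull_mul, pull_push, pull_push, ← mul_assoc, ← push_mul, sectC_mul_sectC,
    push_mul, mul_assoc, sectId_galois]
  rfl

/-- The inverse of `can`. -/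
noncomputable def canInv : X.CrossedProduct ⊗[k] H →ₗ[k] X.CrossedProduct ⊗[k] H :=
  TensorProduct.lift ((LinearMap.mul k (X.CrossedProduct ⊗[k] H)).compl₂
    ((push X.inclLeft X.σ⁻¹.val * X.sectId).ofConv ∘ₗ (galois k H).symm.toLinearMap) ∘ₗ
    X.inclLeft.toLinearMap) ∘ₗ X.decomp.toLinearMap

lemma canInv_apply (r : R) (x : H ⊗[k] H) : X.canInv (X.inclLeft r * X.sectId x) =
    X.inclLeft r * (push X.inclLeft X.σ⁻¹.val * X.sectId) ((galois k H).symm x) := by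
  change TensorProduct.lift _ (X.decomp _) = _
  rw [decomp_apply]
  rfl

lemma crossedProduct_tensor_induction {p : X.CrossedProduct ⊗[k] H → Prop}
    (z : X.CrossedProduct ⊗[k] H) (h0 : p 0) (hadd : ∀ x y, p x → p y → p (x + y))
    (h : ∀ r x, p (X.inclLeft r * X.sectId x)) : p z := by
  obtain ⟨x, rfl⟩ := X.decomp.symm.surjective z
  induction x with
  | zero => rwa [map_zero]
  | add x y hx hy => rw [map_add]; exact hadd _ _ hx hy
  | tmul r x => rw [decomp_symm]; exact h r x

lemma canInv_mul (r : R) (z : X.CrossedProduct ⊗[k] H) :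
    X.canInv (X.inclLeft r * z) = X.inclLeft r * X.canInv z := by
  induction z using crossedProduct_tensor_induction X with
  | h0 => simp
  | hadd x y hx hy => simp only [mul_add, map_add, hx, hy]
  | h s x => rw [← mul_assoc, ← map_mul, canInv_apply, canInv_apply, map_mul, mul_assoc]

lemma can_inclLeft_mul (r : R) (z : X.CrossedProduct ⊗[k] H) :
    X.can (X.inclLeft r * z) = X.inclLeft r * X.can z := X.can_mul _ _

lemma conv_map_left {D A B : Type*} [AddCommMonoid D] [Module k D] [Coalgebra k D] [Ring A]
    [Algebra k A] [Ring B] [Algebra k B] (i : A →ₐ[k] B) (f : B →ₗ[k] B)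
    (hf : ∀ a b, f (i a * b) = i a * f b) (φ : WithConv (D →ₗ[k] A)) (ψ : WithConv (D →ₗ[k] B)) :
    (toConv (f ∘ₗ (push i φ * ψ).ofConv) : WithConv (D →ₗ[k] B)) =
      push i φ * toConv (f ∘ₗ ψ.ofConv) := by
  apply WithConv.ext
  refine LinearMap.ext fun d => ?_
  change f ((push i φ * ψ) d) = (push i φ * toConv (f ∘ₗ ψ.ofConv)) d
  rw [(ℛ k d).convMul_apply, (ℛ k d).convMul_apply, map_sum]
  exact Finset.sum_congr rfl fun i _ => hf _ _

lemma canInv_sectId_galois : (toConv (X.canInv ∘ₗ X.sectId.ofConv ∘ₗ (galois k H).toLinearMap) :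
      WithConv (H ⊗[k] H →ₗ[k] X.CrossedProduct ⊗[k] H)) =
    push X.inclLeft X.σ⁻¹.val * X.sectId := by
  apply WithConv.ext
  refine LinearMap.ext fun x => ?_
  change X.canInv (X.sectId (galois k H x)) = _
  rw [← one_mul (X.sectId _), ← map_one X.inclLeft, canInv_apply, map_one, one_mul,
    LinearEquiv.symm_apply_apply]

lemma canInv_can (z : X.CrossedProduct ⊗[k] H) : X.canInv (X.can z) = z := by
  have h : (toConv (X.canInv ∘ₗ X.can ∘ₗ X.sectId.ofConv) :
      WithConv (H ⊗[k] H →ₗ[k] X.CrossedProduct ⊗[k] H)) = X.sectId := by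
    have := congrArg (fun φ : WithConv (H ⊗[k] H →ₗ[k] X.CrossedProduct ⊗[k] H) =>
      toConv (X.canInv ∘ₗ φ.ofConv)) X.can_sectId
    dsimp only at this
    rw [conv_map_left _ _ X.canInv_mul] at this
    refine Eq.trans this ?_
    have h2 := X.canInv_sectId_galois
    refine (congrArg (push X.inclLeft X.σ.val * ·) h2).trans ?_
    rw [← mul_assoc, ← push_mul, Units.mul_inv, push_one, one_mul]
  induction z using crossedProduct_tensor_induction X with
  | h0 => simp
  | hadd x y hx hy => simp only [map_add, hx, hy]
  | h r x =>
    rw [can_inclLeft_mul, canInv_mul]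
    congr 1
    exact congrArg (fun φ : WithConv (H ⊗[k] H →ₗ[k] X.CrossedProduct ⊗[k] H) => φ x) h

lemma can_canInv (z : X.CrossedProduct ⊗[k] H) : X.can (X.canInv z) = z := by
  have h : (toConv (X.can ∘ₗ X.canInv ∘ₗ X.sectId.ofConv ∘ₗ (galois k H).toLinearMap) :
      WithConv (H ⊗[k] H →ₗ[k] X.CrossedProduct ⊗[k] H)) =
      toConv (X.sectId.ofConv ∘ₗ (galois k H).toLinearMap) := by
    have := congrArg (fun φ : WithConv (H ⊗[k] H →ₗ[k] X.CrossedProduct ⊗[k] H) =>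
      toConv (X.can ∘ₗ φ.ofConv)) X.canInv_sectId_galois
    dsimp only at this
    rw [conv_map_left _ _ X.can_inclLeft_mul, can_sectId, ← mul_assoc, ← push_mul, Units.inv_mul,
      push_one, one_mul] at this
    exact this
  induction z using crossedProduct_tensor_induction X with
  | h0 => simp
  | hadd x y hx hy => simp only [map_add, hx, hy]
  | h r x =>
    rw [canInv_mul, can_inclLeft_mul]
    congr 1
    have := congrArg (fun φ : WithConv (H ⊗[k] H →ₗ[k] X.CrossedProduct ⊗[k] H) =>
      φ ((galois k H).symm x)) h
    change X.can (X.canInv (X.sectId (galois k H _))) = X.sectId (galois k H _) at this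
    rwa [LinearEquiv.apply_symm_apply] at this

/-- By construction `canInv` is only R-linear; linearity over the crossed product is inherited from
its inverse `can`. -/
lemma canInv_left_mul (a : X.CrossedProduct) (z : X.CrossedProduct ⊗[k] H) :
    X.canInv ((a ⊗ₜ 1) * z) = (a ⊗ₜ 1) * X.canInv z := by
  conv_lhs => rw [← X.can_canInv z, ← can_mul, canInv_can]

/-- The map `a ⊗ h ↦ a ε(h)`. -/
noncomputable def counitRight : X.CrossedProduct ⊗[k] H →ₗ[k] X.CrossedProduct :=
  (TensorProduct.rid k X.CrossedProduct).toLinearMap ∘ₗ counit.lTensor X.CrossedProduct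

lemma counitRight_mul (a : X.CrossedProduct) (z : X.CrossedProduct ⊗[k] H) :
    X.counitRight ((a ⊗ₜ 1) * z) = a * X.counitRight z := by
  induction z with
  | zero => simp
  | add z w hz hw => simp only [mul_add, map_add, hz, hw]
  | tmul b h => simp [counitRight]

/-- The convolution inverse of `h ↦ 1 # h`. -/
noncomputable def sectInv : WithConv (H →ₗ[k] X.CrossedProduct) :=
  toConv (X.counitRight ∘ₗ X.canInv ∘ₗ
    (Algebra.TensorProduct.includeRight : H →ₐ[k] X.CrossedProduct ⊗[k] H).toLinearMap)

/-- Apply id ⊗ ε to the identity canInv(can(1 ⊗ h)) = 1 ⊗ h and use left linearity. -/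
lemma sectC_mul_sectInv : X.sectC * X.sectInv = 1 := by
  apply WithConv.ext
  refine LinearMap.ext fun h => ?_
  change (X.sectC * X.sectInv) h = algebraMap k X.CrossedProduct (counit h)
  have e : X.can (1 ⊗ₜ h) = ∑ i ∈ (ℛ k h).index, (X.sect ((ℛ k h).left i) ⊗ₜ[k] (1 : H)) *
      (1 ⊗ₜ (ℛ k h).right i) := by
    rw [can_tmul, ← Algebra.TensorProduct.one_def, one_mul, coactSect, (ℛ k h).convMul_apply]
    rfl
  have e2 := congrArg X.counitRight (X.canInv_can (1 ⊗ₜ h))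
  rw [e, map_sum, map_sum] at e2
  rw [(ℛ k h).convMul_apply]
  refine Eq.trans ?_ (e2.trans ?_)
  · refine Finset.sum_congr rfl fun i _ => ?_
    rw [canInv_left_mul, counitRight_mul]
    rfl
  · simp [counitRight, Algebra.algebraMap_eq_smul_one]

/-- With θ the right inverse of γ, the map f sending a ⊗ h to a θ(h₁) ⊗ h₂ is a left inverse of
`can`. Since `can` is bijective, f is also a right inverse, and can(f(1 ⊗ h)) = 1 ⊗ h reads θ * γ =
1 after the second leg is removed. -/
lemma sectInv_mul_sectC : X.sectInv * X.sectC = 1 := by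
  let φ : WithConv (H →ₗ[k] X.CrossedProduct ⊗[k] H) :=
    push Algebra.TensorProduct.includeLeft X.sectInv *
      push Algebra.TensorProduct.includeRight (idC k H)
  let f : X.CrossedProduct ⊗[k] H →ₗ[k] X.CrossedProduct ⊗[k] H :=
    TensorProduct.lift ((LinearMap.mul k (X.CrossedProduct ⊗[k] H)).compl₂ φ.ofConv ∘ₗ
      (Algebra.TensorProduct.includeLeft :
        X.CrossedProduct →ₐ[k] X.CrossedProduct ⊗[k] H).toLinearMap)
  have hf (a h) : f (a ⊗ₜ h) = (a ⊗ₜ 1) * φ h := rfl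
  have hfl (a z) : f ((a ⊗ₜ 1) * z) = (a ⊗ₜ 1) * f z := by
    induction z with
    | zero => simp
    | add z w hz hw => simp only [mul_add, map_add, hz, hw]
    | tmul b h =>
      rw [Algebra.TensorProduct.tmul_mul_tmul, hf, hf, ← mul_assoc,
        Algebra.TensorProduct.tmul_mul_tmul, one_mul, one_mul]
  have hg (g : X.CrossedProduct ⊗[k] H →ₗ[k] X.CrossedProduct ⊗[k] H)
      (ψ : WithConv (H →ₗ[k] X.CrossedProduct ⊗[k] H)) (θ : WithConv (H →ₗ[k] X.CrossedProduct))
      (hg : ∀ a h, g (a ⊗ₜ h) = (a ⊗ₜ 1) * ψ h) (h : H) :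
      g ((push Algebra.TensorProduct.includeLeft θ * push Algebra.TensorProduct.includeRight
        (idC k H) : WithConv (H →ₗ[k] X.CrossedProduct ⊗[k] H)) h) =
        (push Algebra.TensorProduct.includeLeft θ * ψ :
          WithConv (H →ₗ[k] X.CrossedProduct ⊗[k] H)) h := by
    rw [(ℛ k h).convMul_apply, (ℛ k h).convMul_apply, map_sum]
    refine Finset.sum_congr rfl fun i _ => ?_
    rw [push_apply, push_apply, Algebra.TensorProduct.includeLeft_apply,
      Algebra.TensorProduct.includeRight_apply, Algebra.TensorProduct.tmul_mul_tmul, mul_one,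
      one_mul, hg]
    rfl
  have hfcan (h : H) : f (X.can (1 ⊗ₜ h)) = 1 ⊗ₜ h := by
    rw [can_tmul, ← Algebra.TensorProduct.one_def, one_mul, coactSect, hg f φ _ hf, ← mul_assoc,
      ← push_mul, sectC_mul_sectInv, push_one, one_mul]
    rfl
  have hfcan' (z) : f (X.can z) = z := by
    induction z with
    | zero => simp
    | add z w hz hw => simp only [map_add, hz, hw]
    | tmul a h =>
      have : (a ⊗ₜ[k] h : X.CrossedProduct ⊗[k] H) = (a ⊗ₜ 1) * (1 ⊗ₜ h) := by simp
      rw [this, can_mul, hfl, hfcan]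
  have hcanf (z) : X.can (f z) = z := by
    conv_lhs => rw [← X.can_canInv z, hfcan', can_canInv]
  have h1 : push Algebra.TensorProduct.includeLeft (X.sectInv * X.sectC) *
      push Algebra.TensorProduct.includeRight (idC k H) =
        (push Algebra.TensorProduct.includeRight (idC k H) :
          WithConv (H →ₗ[k] X.CrossedProduct ⊗[k] H)) := by
    apply WithConv.ext
    refine LinearMap.ext fun h => ?_
    have := hcanf (1 ⊗ₜ h)
    rw [hf, ← Algebra.TensorProduct.one_def, one_mul, hg X.can X.coactSect _ X.can_tmul] at this
    rw [push_mul, mul_assoc]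
    exact this
  have h2 := congrArg (· * push Algebra.TensorProduct.includeRight (antC k H)) h1
  simp only [mul_assoc] at h2
  rw [← push_mul, idC_mul_antC, push_one, mul_one] at h2
  apply WithConv.ext
  refine LinearMap.ext fun h => ?_
  have h3 := congrArg (fun φ : WithConv (H →ₗ[k] X.CrossedProduct ⊗[k] H) =>
    X.counitRight (φ h)) h2
  simpa [push, counitRight, Algebra.algebraMap_eq_smul_one, Algebra.TensorProduct.one_def] using h3

/-- `h ↦ 1 # h` as a unit of the convolution algebra. -/
noncomputable def sectUnit : (WithConv (H →ₗ[k] X.CrossedProduct))ˣ :=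
  ⟨X.sectC, X.sectInv, X.sectC_mul_sectInv, X.sectInv_mul_sectC⟩

end CleftInverse

end CrossedSystem

/-! ### Coinduced modules and Maschke's theorem -/

namespace CrossedSystem

section Convolution

variable {k : Type*} [Field k] {D E A B : Type*}
  [AddCommMonoid D] [Module k D] [Coalgebra k D] [AddCommMonoid E] [Module k E] [Coalgebra k E]
  [Ring A] [Algebra k A] [Ring B] [Algebra k B]

lemma snd_mul_apply {κ : Type*} (φ : WithConv (E →ₗ[k] A)) (ψ : WithConv (D ⊗[k] E →ₗ[k] A))
    (x : D) {y : E} (𝓡 : Coalgebra.Repr k y κ) :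
    (pull (sndC k D E) φ * ψ) (x ⊗ₜ y) =
      ∑ i ∈ 𝓡.index, φ (𝓡.left i) * ψ (x ⊗ₜ 𝓡.right i) := by
  rw [convMul_tmul _ _ (ℛ k x) 𝓡, Finset.sum_comm]
  simp only [pull_apply, sndC_tmul]
  refine Finset.sum_congr rfl fun i _ => ?_
  conv_rhs => rw [← sum_counit_smul (ℛ k x)]
  simp [TensorProduct.sum_tmul, Finset.mul_sum, ← TensorProduct.smul_tmul']

variable (k D) in
/-- Postcomposition with an algebra homomorphism, as an algebra homomorphism of convolution
algebras. -/
noncomputable def pushHom (f : A →ₐ[k] B) : WithConv (D →ₗ[k] A) →ₐ[k] WithConv (D →ₗ[k] B) :=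
  AlgHom.ofLinearMap
    { toFun := push f
      map_add' := fun a b => by apply WithConv.ext; ext d; simp [push]
      map_smul' := fun r a => by apply WithConv.ext; ext d; simp [push] }
    (push_one f) (push_mul f)

variable {M : Type*} [AddCommGroup M] [Module k M]

variable (k D) in
/-- The action on the values of linear maps. -/
noncomputable def ptAct (α : B →ₐ[k] Module.End k M) : B →ₐ[k] Module.End k (D →ₗ[k] M) :=
  (convActHom k D (Module.End k M) M).comp ((cstHom k D (Module.End k M)).comp α)

lemma ptAct_apply (α : B →ₐ[k] Module.End k M) (b : B) (φ : D →ₗ[k] M) (d : D) :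
    ptAct k D α b φ d = α b (φ d) := convAct_cst (α b) φ d

end Convolution

/-- A basis of D identifies Hom(D, M) with a finite power of M. -/
lemma completelyReducible_ptAct {k D B M : Type*} [Field k] [AddCommGroup D] [Module k D]
    [Coalgebra k D] [Module.Finite k D] [Ring B] [Algebra k B] [AddCommGroup M] [Module k M]
    {α : B →ₐ[k] Module.End k M} (h : CompletelyReducible (Set.range α)) :
    CompletelyReducible (Set.range (ptAct k D α)) := by
  let _ : Module B M := Module.compHom M α.toRingHom
  have : IsScalarTower k B M := ⟨fun r a m => by
    change α (r • a) m = r • α a m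
    simp⟩
  have : SMulCommClass k B M := IsScalarTower.to_smulCommClass
  have := (completelyReducible_range_iff α fun _ _ => rfl).1 h
  have := IsSemisimpleModule.congr ((Module.finBasis k D).constr (M' := M) B).symm
  exact (completelyReducible_range_iff _ fun b φ => LinearMap.ext (ptAct_apply α b φ)).2 this

variable {k : Type u} {H : Type v} {R : Type w} [Field k] [Ring H]
    [HopfAlgebra k H] [Ring R] [Algebra k R] (X : CrossedSystem k H R)

section Coind

variable {V : Type*} [AddCommGroup V] [Module k V] (ρ : R →ₐ[k] Module.End k V)

/-- The `R`-linear extension `r # h ↦ r φ(h)` of a linear map on `H`. -/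
noncomputable def ext (φ : H →ₗ[k] V) : X.CrossedProduct →ₗ[k] V :=
  TensorProduct.lift (ρ.toLinearMap.compl₂ φ) ∘ₗ X.hash.symm.toLinearMap

lemma ext_hash (φ : H →ₗ[k] V) (r : R) (h : H) : X.ext ρ φ (X.hash (r ⊗ₜ h)) = ρ r (φ h) := rfl

lemma ext_add (φ ψ : H →ₗ[k] V) : X.ext ρ (φ + ψ) = X.ext ρ φ + X.ext ρ ψ := by
  ext z
  induction z using crossedProduct_induction X with
  | h0 => simp
  | hadd x y hx hy => rw [map_add, map_add, hx, hy]
  | h r h => rw [incl_mul_sect, LinearMap.add_apply, ext_hash, ext_hash, ext_hash,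
      LinearMap.add_apply, map_add]

lemma ext_smul (c : k) (φ : H →ₗ[k] V) : X.ext ρ (c • φ) = c • X.ext ρ φ := by
  ext z
  induction z using crossedProduct_induction X with
  | h0 => simp
  | hadd x y hx hy => rw [map_add, map_add, hx, hy]
  | h r h => rw [incl_mul_sect, LinearMap.smul_apply, ext_hash, ext_hash, LinearMap.smul_apply,
      map_smul]

lemma ext_incl_mul (φ : H →ₗ[k] V) (r : R) (z : X.CrossedProduct) :
    X.ext ρ φ (X.incl r * z) = ρ r (X.ext ρ φ z) := by
  induction z using crossedProduct_induction X with
  | h0 => simp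
  | hadd x y hx hy => simp only [mul_add, map_add, hx, hy]
  | h s h =>
    rw [← mul_assoc, ← map_mul, incl_mul_sect, incl_mul_sect, ext_hash, ext_hash, map_mul,
      Module.End.mul_apply]

lemma ext_sect (φ : H →ₗ[k] V) (h : H) : X.ext ρ φ (X.sect h) = φ h := by
  change ρ 1 (φ h) = φ h
  simp

/-- An R-linear map on the crossed product is determined by its restriction to 1 # H. This is what
makes `coind` multiplicative. -/
lemma ext_ext_mulRight_sect (φ : H →ₗ[k] V) (a z : X.CrossedProduct) :
    X.ext ρ (X.ext ρ φ ∘ₗ LinearMap.mulRight k a ∘ₗ X.sect) z = X.ext ρ φ (z * a) := by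
  induction z using crossedProduct_induction X with
  | h0 => simp
  | hadd x y hx hy => simp only [add_mul, map_add, hx, hy]
  | h s h =>
    rw [ext_incl_mul, ext_sect, mul_assoc, ext_incl_mul]
    rfl

/-- The action of `R #_σ H` on `Hom_R(R #_σ H, V) = Hom(H, V)`, for an `R`-module `V`. -/
noncomputable def coind : X.CrossedProduct →ₐ[k] Module.End k (H →ₗ[k] V) :=
  AlgHom.ofLinearMap
    { toFun := fun a =>
        { toFun := fun φ => X.ext ρ φ ∘ₗ LinearMap.mulRight k a ∘ₗ X.sect
          map_add' := fun φ ψ => by rw [ext_add, LinearMap.add_comp]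
          map_smul' := fun c φ => by rw [ext_smul, LinearMap.smul_comp]; rfl }
      map_add' := fun a b => by
        ext φ h
        simp [mul_add]
      map_smul' := fun c a => by
        ext φ h
        simp }
    (by
      ext φ h
      simp [ext_sect])
    (fun a b => by
      ext φ g
      change X.ext ρ φ (X.sect g * (a * b)) = X.ext ρ
        (X.ext ρ φ ∘ₗ LinearMap.mulRight k b ∘ₗ X.sect) (X.sect g * a)
      rw [ext_ext_mulRight_sect, mul_assoc])

lemma coind_apply (a : X.CrossedProduct) (φ : H →ₗ[k] V) (g : H) :
    X.coind ρ a φ g = X.ext ρ φ (X.sect g * a) := rfl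

lemma coind_incl (r : R) :
    X.coind ρ (X.incl r) = convActHom k H (Module.End k V) V (push ρ (X.actH r)) := by
  ext φ g
  rw [coind_apply, X.sect_mul_incl g r (ℛ k g), convActHom_apply, convAct_apply _ _ (ℛ k g),
    map_sum]
  simp only [ext_incl_mul, ext_sect]
  rfl

lemma coind_sect_apply (h g : H) (φ : H →ₗ[k] V) : X.coind ρ (X.sect h) φ g =
    convAct (push ρ X.σ.val) (φ ∘ₗ LinearMap.mul' k H) (g ⊗ₜ h) := by
  have := congrArg (fun φ : WithConv (H ⊗[k] H →ₗ[k] X.CrossedProduct) => φ (g ⊗ₜ h))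
    X.sectC_mul_sectC
  rw [fst_mul_snd_apply, sectC_apply, sectC_apply, (ℛ k (g ⊗ₜ[k] h)).convMul_apply] at this
  rw [coind_apply, this, convAct_apply _ _ (ℛ k (g ⊗ₜ[k] h)), map_sum]
  refine Finset.sum_congr rfl fun i _ => ?_
  exact (ext_incl_mul X ρ φ _ _).trans (congrArg _ (ext_sect X ρ φ _))

lemma ext_eq_zero_of_mem_jacobson (h : CompletelyReducible (Set.range (X.coind ρ)))
    {z : X.CrossedProduct} (hz : z ∈ Ring.jacobson X.CrossedProduct) (φ : H →ₗ[k] V) :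
    X.ext ρ φ z = 0 := by
  have := LinearMap.congr_fun (LinearMap.congr_fun (h.jacobson_apply hz) φ) 1
  rwa [coind_apply, sect_one, one_mul] at this

end Coind

section Maschke

variable {M : Type*} [AddCommGroup M] [Module k M]

/-- Maschke's theorem for crossed products with a semisimple Hopf algebra. -/
lemma completelyReducible_of_comp_incl {t : H} (ht : ∀ h : H, t * h = counit (R := k) h • t)
    (ht1 : counit (R := k) t = 1) (α : X.CrossedProduct →ₐ[k] Module.End k M)
    (hα : CompletelyReducible (Set.range (α.comp X.incl))) :
    CompletelyReducible (Set.range α) := by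
  intro W hW
  obtain ⟨π, h1, h2, h3⟩ := hα W (by rintro _ ⟨r, rfl⟩; exact hW _ ⟨_, rfl⟩)
  have h3' (r : R) : Commute π (α (X.incl r)) := (h3 _ ⟨r, rfl⟩).symm
  set G : (WithConv (H →ₗ[k] Module.End k M))ˣ := pushUnits α X.sectUnit with hG
  have hGs (h : H) : G.val h = α (X.sect h) := rfl
  -- The averaged projection is x(t), where x(h) = ∑ γ⁻¹(h₁) π γ(h₂) inside End(M).
  set x := G⁻¹.val * cst k H π * G.val with hx
  have hxt (d : H) : x d = ∑ i ∈ (ℛ k d).index,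
      α (X.sectInv ((ℛ k d).left i)) * (π * α (X.sect ((ℛ k d).right i))) := by
    rw [hx, mul_assoc, (ℛ k d).convMul_apply]
    refine Finset.sum_congr rfl fun i _ => ?_
    rw [cst_mul_apply]
    rfl
  have hincl (r : R) : Commute (α (X.incl r)) (x t) := by
    have hGr : G.val * cst k H (α (X.incl r)) = push (α.comp X.incl) (X.actH r) * G.val := by
      have := congrArg (push α) (X.sectC_mul_cst r)
      rw [push_mul, push_mul, push_cst] at this
      exact this
    have hc : Commute (cst k H π) (push (α.comp X.incl) (X.actH r)) :=
      cst_commute _ _ fun d => h3' _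
    have hGr' : cst k H (α (X.incl r)) * G⁻¹.val =
        G⁻¹.val * push (α.comp X.incl) (X.actH r) := by
      rw [Units.mul_inv_eq_iff_eq_mul, mul_assoc, ← hGr, Units.inv_mul_cancel_left]
    have : cst k H (α (X.incl r)) * x = x * cst k H (α (X.incl r)) := by
      rw [hx, mul_assoc _ _ (cst k H (α (X.incl r))), hGr, ← mul_assoc, ← mul_assoc, hGr',
        mul_assoc _ _ (cst k H π), ← hc.eq]
      simp only [mul_assoc]
    have := congrArg (fun φ : WithConv (H →ₗ[k] Module.End k M) => φ t) this
    simp only [cst_mul_apply, mul_cst_apply] at this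
    exact this
  have hsect (h : H) : Commute (α (X.sect h)) (x t) := by
    let p₁ := fstC k H H
    let p₂ := sndC k H H
    let m := Bialgebra.mulCoalgHom k H
    have hσ : pull p₁ G.val * pull p₂ G.val =
        push (α.comp X.incl) X.σ.val * pull m G.val := by
      have := congrArg (push α) X.sectC_mul_sectC
      rw [push_mul, push_mul, ← pull_push, ← pull_push, ← pull_push] at this
      exact this
    have hc : Commute (cst k (H ⊗[k] H) π) (push (α.comp X.incl) X.σ.val) :=
      cst_commute _ _ fun d => h3' _
    have hσ' : pull p₁ G⁻¹.val * push (α.comp X.incl) X.σ.val =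
        pull p₂ G.val * pull m G⁻¹.val := by
      have e1 : pull p₁ G⁻¹.val * pull p₁ G.val = 1 := by rw [← pull_mul, Units.inv_mul, pull_one]
      have e2 : pull m G.val * pull m G⁻¹.val = 1 := by rw [← pull_mul, Units.mul_inv, pull_one]
      have := congrArg (fun y => pull p₁ G⁻¹.val * y * pull m G⁻¹.val) hσ
      rw [← mul_assoc, e1, one_mul] at this
      rw [this, mul_assoc, mul_assoc, e2, mul_one]
    -- That is, x(g) γ(h) = ∑ γ(h₁) x(g h₂); the cocycle drops out because its values commute with
    -- π. At g = t the right integral property reduces this to commutation with γ(h).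
    have key : pull p₁ x * pull p₂ G.val = pull p₂ G.val * pull m x := by
      rw [hx, pull_mul, pull_mul, pull_cst, mul_assoc _ (pull p₁ G.val), hσ, mul_assoc,
        ← mul_assoc (cst k _ π), hc.eq, pull_mul, pull_mul, pull_cst, ← mul_assoc, ← mul_assoc,
        hσ']
      simp only [mul_assoc]
    have := congrArg (fun φ : WithConv (H ⊗[k] H →ₗ[k] Module.End k M) => φ (t ⊗ₜ h)) key
    rw [fst_mul_snd_apply, snd_mul_apply _ _ _ (ℛ k h)] at this
    refine Eq.symm (this.trans ?_)
    have e (d : H) : pull m x (t ⊗ₜ d) = counit (R := k) d • x t := by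
      change x (t * d) = _
      rw [ht, map_smul]
    simp only [e]
    conv_rhs => rw [← sum_counit_smul_left (ℛ k h)]
    simp [hGs, Finset.sum_mul]
  refine ⟨x t, fun v => ?_, fun v hv => ?_, ?_⟩
  · rw [hxt, LinearMap.sum_apply]
    exact W.sum_mem fun i _ => hW _ ⟨_, rfl⟩ _ (h1 _)
  · have := congrArg (fun φ : WithConv (H →ₗ[k] Module.End k M) => φ t v) G.inv_mul
    rw [(ℛ k t).convMul_apply, LinearMap.sum_apply] at this
    rw [hxt, LinearMap.sum_apply]
    refine Eq.trans (Finset.sum_congr rfl fun i _ => ?_) (this.trans ?_)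
    · exact congrArg _ (h2 _ (hW _ ⟨_, rfl⟩ _ hv))
    · change algebraMap k (Module.End k M) (counit t) v = v
      rw [ht1, map_one, Module.End.one_apply]
  · rintro _ ⟨z, rfl⟩
    induction z using crossedProduct_induction X with
    | h0 => rw [map_zero]; exact Commute.zero_left _
    | hadd a b ha hb => rw [map_add]; exact ha.add_left hb
    | h r h => rw [map_mul]; exact (hincl r).mul_left (hsect h)

/-- If `H` is cosemisimple and the module coinduced from `V` is completely reducible, then so
is `V`. -/
lemma completelyReducible_of_coind {l : H →ₗ[k] k} (hl1 : l 1 = 1)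
    (hl : idC k H * push (Algebra.ofId k H) (toConv l) = push (Algebra.ofId k H) (toConv l))
    (ρ : R →ₐ[k] Module.End k M) (hρ : CompletelyReducible (Set.range (X.coind ρ))) :
    CompletelyReducible (Set.range ρ) := by
  intro W hW
  let P : Submodule k (H →ₗ[k] M) :=
    { carrier := {φ | ∀ g, φ g ∈ W}
      add_mem' := fun hx hy g => W.add_mem (hx g) (hy g)
      zero_mem' := fun g => W.zero_mem
      smul_mem' := fun c x hx g => W.smul_mem c (hx g) }
  have hP : ∀ f ∈ Set.range (X.coind ρ), ∀ φ ∈ P, f φ ∈ P := by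
    rintro _ ⟨a, rfl⟩ φ hφ g
    rw [coind_apply]
    generalize X.sect g * a = z
    induction z using crossedProduct_induction X with
    | h0 => rw [map_zero]; exact W.zero_mem
    | hadd a b ha hb => rw [map_add]; exact W.add_mem ha hb
    | h r h => rw [ext_incl_mul, ext_sect]; exact hW _ ⟨r, rfl⟩ _ (hφ h)
  obtain ⟨p, h1, h2, h3⟩ := hρ P hP
  -- The map m ↦ l(·) m is R-linear into the coinduced module because ∑ l(g₂) g₁ = l(g) 1.
  -- Evaluation at 1 is R-linear and splits it since l(1) = 1, so M inherits a projection from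
  -- Hom(H, M).
  let ι : M →ₗ[k] (H →ₗ[k] M) := (LinearMap.smulRightₗ : (H →ₗ[k] k) →ₗ[k] M →ₗ[k] H →ₗ[k] M) l
  have hι (m : M) (g : H) : ι m g = l g • m := rfl
  have hιr (r : R) (m : M) : X.coind ρ (X.incl r) (ι m) = ι (ρ r m) := by
    ext g
    rw [coind_incl, convActHom_apply, convAct_apply _ _ (ℛ k g), hι]
    have := congrArg (fun φ : WithConv (H →ₗ[k] H) => ρ (X.act (φ g) r) m) hl
    rw [(ℛ k g).convMul_apply] at this
    simp only [map_sum, LinearMap.sum_apply] at this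
    refine Eq.trans (Finset.sum_congr rfl fun i _ => ?_) (this.trans ?_)
    · simp [push_apply, idC, hι, ← Algebra.smul_def, Algebra.ofId_apply, ← Algebra.commutes]
      rfl
    · simp [push_apply, Algebra.ofId_apply, Algebra.algebraMap_eq_smul_one, X.one_act]
  refine ⟨LinearMap.applyₗ 1 ∘ₗ p ∘ₗ ι, fun m => h1 _ _, fun m hm => ?_, ?_⟩
  · change p (ι m) 1 = m
    rw [h2 (ι m) fun g => W.smul_mem _ hm, hι, hl1, one_smul]
  · rintro _ ⟨r, rfl⟩
    ext m
    change ρ r (p (ι m) 1) = p (ι (ρ r m)) 1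
    rw [← hιr]
    have := LinearMap.congr_fun (LinearMap.congr_fun (h3 _ ⟨X.incl r, rfl⟩) (ι m)) 1
    refine Eq.trans ?_ this
    change _ = X.coind ρ (X.incl r) (p (ι m)) 1
    rw [coind_apply, sect_one, one_mul, ← mul_one (X.incl r), ← sect_one, ext_incl_mul, ext_sect]

end Maschke
end CrossedSystem

/-! ### Complete reducibility of coinduced modules -/

lemma CompletelyReducible.of_conj {k M : Type*} [Field k] [AddCommGroup M] [Module k M]
    {T : Set (Module.End k M)} (u : (Module.End k M)ˣ)
    (h : CompletelyReducible ((fun f => u⁻¹.val * f * u.val) '' T)) : CompletelyReducible T := by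
  intro W hW
  have huu (m : M) : u.val (u⁻¹.val m) = m := LinearMap.congr_fun u.mul_inv m
  obtain ⟨π, h1, h2, h3⟩ := h (W.comap u.val) (by
    rintro _ ⟨f, hf, rfl⟩ m hm
    change u.val (u⁻¹.val (f (u.val m))) ∈ W
    rw [huu]
    exact hW f hf _ hm)
  refine ⟨u.val * π * u⁻¹.val, fun m => h1 _, fun m hm => ?_, fun f hf => ?_⟩
  · change u.val (π (u⁻¹.val m)) = m
    rw [h2 _ (by rwa [Submodule.mem_comap, huu]), huu]
  · have := (h3 _ ⟨f, hf, rfl⟩).eq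
    simp only [mul_assoc] at this
    have := congrArg (fun g => u.val * g * u⁻¹.val) this
    simp only [mul_assoc, Units.mul_inv_cancel_left, Units.mul_inv, mul_one] at this
    rw [commute_iff_eq]
    simpa only [mul_assoc] using this

namespace CrossedSystem

open HopfAlgebra

variable {k : Type u} {H : Type v} {R : Type w} [Field k] [Ring H]
    [HopfAlgebra k H] [Ring R] [Algebra k R] (X : CrossedSystem k H R)

/-! ### The cocommutative case: convolution over the dual -/

section Cocomm

/-- Dual basis formula: for finite-dimensional D, scalar-valued maps and constants generate the
convolution algebra. -/
lemma eq_sum_coord_mul_cst {k D A : Type*} [Field k] [AddCommGroup D] [Module k D]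
    [Coalgebra k D] [Module.Finite k D] [Ring A] [Algebra k A] (y : WithConv (D →ₗ[k] A)) :
    y = ∑ i, push (Algebra.ofId k A) (toConv ((Module.finBasis k D).coord i)) *
      cst k D (y (Module.finBasis k D i)) := by
  apply WithConv.ext
  refine LinearMap.ext fun d => ?_
  have e (s : Finset (Fin (Module.finrank k D))) (f : _ → WithConv (D →ₗ[k] A)) :
      (∑ i ∈ s, f i) d = ∑ i ∈ s, f i d := by
    rw [WithConv.ofConv_sum, LinearMap.sum_apply]
  change y d = (∑ i, push (Algebra.ofId k A) (toConv ((Module.finBasis k D).coord i)) *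
      cst k D (y (Module.finBasis k D i))) d
  rw [e]
  conv_lhs => rw [← (Module.finBasis k D).sum_repr d]
  simp only [mul_cst_apply, map_sum, map_smul, push_apply, Algebra.ofId_apply, Algebra.smul_def]
  rfl

variable [IsCocomm k H]

lemma pull_comulAntipode_actH (r : R) :
    pull (comulAntipode k H) (pull (Bialgebra.mulCoalgHom k H) (X.actH r)) = cst k H r := by
  apply WithConv.ext
  refine LinearMap.ext fun d => ?_
  change X.act (LinearMap.mul' k H (TensorProduct.map LinearMap.id (antipode k) (comul d))) r =
    counit (R := k) d • r
  have := mul_antipode_lTensor_comul_apply (R := k) d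
  rw [LinearMap.lTensor] at this
  rw [this, Algebra.algebraMap_eq_smul_one, map_smul, LinearMap.smul_apply, X.one_act]

/-- Expanding h₂ in a basis exhibits h ↦ ∑ h₁ · (S(h₂) · r) inside the algebra generated by the maps
`actH` and the dual of H. -/
lemma pull_comulAntipode_actL [Module.Finite k H] (r : R) :
    pull (comulAntipode k H) (X.actL (X.actH r)) =
      ∑ i, X.actH (X.act (antipode k (Module.finBasis k H i)) r) *
        push (Algebra.ofId k R) (toConv ((Module.finBasis k H).coord i)) := by
  apply WithConv.ext
  refine LinearMap.ext fun d => ?_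
  have e (s : Finset (Fin (Module.finrank k H))) (f : _ → WithConv (H →ₗ[k] R)) :
      (∑ i ∈ s, f i) d = ∑ i ∈ s, f i d := by
    rw [WithConv.ofConv_sum, LinearMap.sum_apply]
  change X.actL (X.actH r) (TensorProduct.map LinearMap.id (antipode k) (comul d)) =
    (∑ i, X.actH (X.act (antipode k (Module.finBasis k H i)) r) *
        push (Algebra.ofId k R) (toConv ((Module.finBasis k H).coord i))) d
  rw [e, ← (ℛ k d).eq]
  simp only [(ℛ k d).convMul_apply, map_sum, TensorProduct.map_tmul, LinearMap.id_apply, actL_tmul]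
  rw [Finset.sum_comm]
  refine Finset.sum_congr rfl fun j _ => ?_
  change X.act _ (X.act _ r) = _
  conv_lhs => rw [← (Module.finBasis k H).sum_repr ((ℛ k d).right j)]
  simp only [map_sum, map_smul, LinearMap.sum_apply, LinearMap.smul_apply]
  refine Finset.sum_congr rfl fun i _ => ?_
  rw [Algebra.smul_def, Algebra.commutes]
  rfl

/-- For cocommutative `H`, the maps `h ↦ h · r` generate the convolution algebra `Hom(H, R)` over
the dual of `H`. -/
lemma adjoin_actH_union [Module.Finite k H] :
    Algebra.adjoin k (Set.range X.actH ∪ Set.range (pushHom k H (Algebra.ofId k R))) = ⊤ := by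
  set S := Algebra.adjoin k (Set.range X.actH ∪ Set.range (pushHom k H (Algebra.ofId k R))) with hS
  have hact (r : R) : X.actH r ∈ S := Algebra.subset_adjoin (Or.inl ⟨r, rfl⟩)
  have hdual (s : WithConv (H →ₗ[k] k)) : push (Algebra.ofId k R) s ∈ S :=
    Algebra.subset_adjoin (Or.inr ⟨s, rfl⟩)
  -- Here ν(h) = ∑ σ(h₁, S(h₂)). Along h ↦ ∑ h₁ ⊗ S(h₂) the twisted module law says that h₁ · (S(h₂)
  -- · r) is the constant r conjugated by ν.
  set ν := pullUnits (comulAntipode k H) X.σ with hν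
  have hcst (r : R) : ν.val * cst k H r * ν⁻¹.val ∈ S := by
    have h := congrArg (pull (comulAntipode k H)) (X.twisted_mul r)
    rw [pull_mul, pull_mul, pull_comulAntipode_actH, pull_comulAntipode_actL] at h
    have h' := (Units.eq_mul_inv_iff_mul_eq (c := ν)).2 h
    rw [hν] at h' ⊢
    refine h' ▸ ?_
    exact S.sum_mem fun i _ => S.mul_mem (hact _) (hdual _)
  rw [eq_top_iff]
  rintro y -
  -- The dual basis formula is applied to the conjugate of y: conjugating back fixes the central
  -- dual part and turns constants into elements already known to lie in S.
  have h := eq_sum_coord_mul_cst (ν⁻¹.val * y * ν.val)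
  have h' := congrArg (fun z => ν.val * z * ν⁻¹.val) h
  simp only [mul_assoc, Units.mul_inv_cancel_left, Units.mul_inv, mul_one] at h'
  rw [h', Finset.sum_mul, Finset.mul_sum]
  refine S.sum_mem fun i _ => ?_
  rw [mul_assoc, ← mul_assoc, ← (push_ofId_commute _ _).eq, mul_assoc, ← mul_assoc ν.val]
  exact S.mul_mem (hdual _) (hcst _)

/-- For cocommutative cosemisimple `H`, the restriction to `R` of the module coinduced from a
completely reducible `R`-module is completely reducible. -/
lemma completelyReducible_coind_comp_incl {V : Type*} [AddCommGroup V] [Module k V]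
    [Module.Finite k H] {l : H →ₗ[k] k} (hl1 : l 1 = 1)
    (hl : idC k H * push (Algebra.ofId k H) (toConv l) = push (Algebra.ofId k H) (toConv l))
    {ρ : R →ₐ[k] Module.End k V} (hρ : CompletelyReducible (Set.range ρ)) :
    CompletelyReducible (Set.range ((X.coind ρ).comp X.incl)) := by
  obtain ⟨e, he⟩ := exists_isCasimir_dual hl1 hl
  have : Module.Finite k (WithConv (H →ₗ[k] k)) :=
    Module.Finite.equiv (WithConv.linearEquiv k (H →ₗ[k] k)).symm
  -- Pointwise and coinduced actions of r are the images under Θ of the constant r and of h ↦ h · r,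
  -- so the comparison takes place in Hom(H, R).
  let Θ := (convActHom k H (Module.End k V) V).comp (pushHom k H ρ)
  let c := Θ.comp (pushHom k H (Algebra.ofId k R))
  have hpt (r : R) : ptAct k H ρ r = Θ (cst k H r) :=
    congrArg (convActHom k H (Module.End k V) V) (push_cst ρ r).symm
  have hco (r : R) : (X.coind ρ).comp X.incl r = Θ (X.actH r) := X.coind_incl ρ r
  refine (completelyReducible_ptAct hρ).of_centralizing he c ?_ ?_ ?_ ?_
  · rintro _ ⟨r, rfl⟩ s
    rw [hpt]
    exact (push_ofId_commute s (cst k H r)).symm.map Θ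
  · rintro _ ⟨r, rfl⟩ s
    rw [hco]
    exact (push_ofId_commute s (X.actH r)).symm.map Θ
  · have h1 : Set.range ((X.coind ρ).comp X.incl) ∪ Set.range c =
        Θ '' (Set.range X.actH ∪ Set.range (pushHom k H (Algebra.ofId k R))) := by
      rw [Set.image_union, ← Set.range_comp, ← Set.range_comp]
      congr 1
      exact congrArg Set.range (funext hco)
    rintro _ ⟨r, rfl⟩
    rw [h1, ← AlgHom.map_adjoin, adjoin_actH_union, hpt]
    exact ⟨_, trivial, rfl⟩
  · rintro _ ⟨r, rfl⟩
    rw [hco, eq_sum_coord_mul_cst (X.actH r), map_sum]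
    refine Subalgebra.sum_mem _ fun i _ => ?_
    rw [map_mul]
    refine Subalgebra.mul_mem _ (Algebra.subset_adjoin (Or.inr ⟨_, rfl⟩))
      (Algebra.subset_adjoin (Or.inl ⟨_, hpt _⟩))

end Cocomm

/-! ### The commutative case: translations and the diagonal action -/

section Comm

variable {N : Type*} [AddCommGroup N] [Module k N]

variable (k H N) in
/-- The action of `H` on `Hom(H, N)` by right translation. -/
noncomputable def translation : H →ₐ[k] Module.End k (H →ₗ[k] N) :=
  AlgHom.ofLinearMap
    { toFun := fun h =>
        { toFun := fun φ => φ ∘ₗ LinearMap.mulRight k h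
          map_add' := fun _ _ => LinearMap.add_comp _ _ _
          map_smul' := fun _ _ => LinearMap.smul_comp _ _ _ }
      map_add' := fun a b => by ext φ g; simp [mul_add]
      map_smul' := fun c a => by ext φ g; simp }
    (by ext φ g; simp) (fun a b => by ext φ g; simp [mul_assoc])

lemma translation_apply (h g : H) (φ : H →ₗ[k] N) : translation k H N h φ g = φ (g * h) := rfl

lemma ptAct_translation_commute {B : Type*} [Ring B] [Algebra k B] (α : B →ₐ[k] Module.End k N)
    (b : B) (h : H) : Commute (ptAct k H α b) (translation k H N h) := by
  ext φ g
  simp only [Module.End.mul_apply, ptAct_apply, translation_apply]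

/-- The map `h ↦ ∑ (h₁ acting on values) (translation by h₂)` -/
noncomputable def diagonalAct (α : X.CrossedProduct →ₐ[k] Module.End k N) :
    WithConv (H →ₗ[k] Module.End k (H →ₗ[k] N)) :=
  push (ptAct k H α) X.sectC * push (translation k H N) (idC k H)

lemma diagonalAct_apply (α : X.CrossedProduct →ₐ[k] Module.End k N) {ι : Type*} {h : H}
    (𝓡 : Coalgebra.Repr k h ι) : X.diagonalAct α h =
      ∑ i ∈ 𝓡.index, ptAct k H α (X.sect (𝓡.left i)) * translation k H N (𝓡.right i) :=
  𝓡.convMul_apply _ _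

/-- Convolving with the antipode undoes the translation part, so the pointwise action is recovered
from the diagonal one and translations. -/
lemma ptAct_sect (α : X.CrossedProduct →ₐ[k] Module.End k N) {ι : Type*} {h : H}
    (𝓡 : Coalgebra.Repr k h ι) : ptAct k H α (X.sect h) =
      ∑ i ∈ 𝓡.index, X.diagonalAct α (𝓡.left i) *
        translation k H N (antipode k (𝓡.right i)) := by
  have : X.diagonalAct α * push (translation k H N) (antC k H) = push (ptAct k H α) X.sectC := by
    rw [diagonalAct, mul_assoc, ← push_mul, idC_mul_antC, push_one, mul_one]
  have := congrArg (fun φ : WithConv (H →ₗ[k] Module.End k (H →ₗ[k] N)) => φ h) this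
  rw [𝓡.convMul_apply] at this
  exact this.symm

/-- The automorphism of `Hom(H, N)` intertwining the coinduced action and the diagonal one. -/
noncomputable def twist (α : X.CrossedProduct →ₐ[k] Module.End k N) :
    (Module.End k (H →ₗ[k] N))ˣ :=
  Units.map (convActHom k H (Module.End k N) N).toMonoidHom (pushUnits α X.sectUnit)

lemma twist_apply (α : X.CrossedProduct →ₐ[k] Module.End k N) (φ : H →ₗ[k] N) :
    (X.twist α).val φ = convAct (push α X.sectC) φ := rfl

lemma coind_incl_mul_twist (α : X.CrossedProduct →ₐ[k] Module.End k N) (r : R) :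
    X.coind (α.comp X.incl) (X.incl r) * (X.twist α).val =
      (X.twist α).val * ptAct k H α (X.incl r) := by
  have := congrArg (push α) (X.sectC_mul_cst r)
  rw [push_mul, push_mul, push_cst] at this
  have := congrArg (convActHom k H (Module.End k N) N) this
  rw [map_mul, map_mul] at this
  rw [coind_incl]
  exact this.symm

/-- At g both sides are ∑ γ(g₁) γ(h₁) φ(g₂ h₂): the cocycle of the coinduced action is exactly
absorbed by ∑ σ(g₁, h₁) γ(g₂ h₂) = γ(g) γ(h). -/
lemma coind_sect_mul_twist (α : X.CrossedProduct →ₐ[k] Module.End k N) (h : H) :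
    X.coind (α.comp X.incl) (X.sect h) * (X.twist α).val =
      (X.twist α).val * X.diagonalAct α h := by
  ext φ g
  rw [Module.End.mul_apply, Module.End.mul_apply, coind_sect_apply, twist_apply, twist_apply]
  have e1 := convAct_pull (Bialgebra.mulCoalgHom k H) (push α X.sectC) φ
  have e2 : convAct (push α X.sectC) φ ∘ₗ LinearMap.mul' k H =
    convAct (pull (Bialgebra.mulCoalgHom k H) (push α X.sectC)) (φ ∘ₗ LinearMap.mul' k H) := e1.symm
  have e3 := congrArg (push α) X.sectC_mul_sectC
  rw [push_mul, push_mul, ← pull_push, ← pull_push, ← pull_push] at e3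
  have e4 : push (α.comp X.incl) X.σ.val * pull (Bialgebra.mulCoalgHom k H) (push α X.sectC) =
    pull (fstC k H H) (push α X.sectC) * pull (sndC k H H) (push α X.sectC) := e3.symm
  rw [e2, ← convAct_mul, e4, convAct_apply _ _ ((ℛ k g).tmul (ℛ k h)),
    convAct_apply _ _ (ℛ k g), diagonalAct_apply _ _ (ℛ k h)]
  simp only [Coalgebra.Repr.tmul_index, Coalgebra.Repr.tmul_left, Coalgebra.Repr.tmul_right,
    Finset.sum_product, fst_mul_snd_apply, LinearMap.sum_apply, Module.End.mul_apply,
    Finset.smul_sum, ptAct_apply, translation_apply]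
  rfl

/-- For commutative semisimple `H`, the module coinduced from the restriction to `R` of a completely
reducible `R #_σ H`-module is completely reducible. -/
lemma completelyReducible_coind (hcomm : ∀ x y : H, x * y = y * x) [Module.Finite k H] {t : H}
    (ht : ∀ h : H, h * t = counit (R := k) h • t) (ht1 : counit (R := k) t = 1)
    {α : X.CrossedProduct →ₐ[k] Module.End k N} (hα : CompletelyReducible (Set.range α)) :
    CompletelyReducible (Set.range (X.coind (α.comp X.incl))) := by
  set β := X.coind (α.comp X.incl) with hβ
  set Ψ := X.twist α with hΨ
  have hincl (r : R) : Ψ⁻¹.val * β (X.incl r) * Ψ.val = ptAct k H α (X.incl r) := by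
    rw [mul_assoc, coind_incl_mul_twist, Units.inv_mul_cancel_left]
  have hsect (h : H) : Ψ⁻¹.val * β (X.sect h) * Ψ.val = X.diagonalAct α h := by
    rw [mul_assoc, coind_sect_mul_twist, Units.inv_mul_cancel_left]
  have hmul (a b : X.CrossedProduct) : Ψ⁻¹.val * β (a * b) * Ψ.val =
      (Ψ⁻¹.val * β a * Ψ.val) * (Ψ⁻¹.val * β b * Ψ.val) := by
    simp only [mul_assoc, Units.mul_inv_cancel_left, map_mul]
  refine CompletelyReducible.of_conj Ψ ?_
  refine (completelyReducible_ptAct hα).of_centralizing (isCasimir_of_left_integral ht ht1)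
    (translation k H N) ?_ ?_ ?_ ?_
  · rintro _ ⟨a, rfl⟩ h
    exact ptAct_translation_commute α a h
  · rintro _ ⟨_, ⟨a, rfl⟩, rfl⟩ x
    dsimp only
    induction a using crossedProduct_induction X with
    | h0 => rw [map_zero, mul_zero, zero_mul]; exact Commute.zero_left _
    | hadd a b ha hb => rw [map_add, mul_add, add_mul]; exact ha.add_left hb
    | h r h =>
      rw [hmul, hincl, hsect, diagonalAct_apply _ _ (ℛ k h)]
      -- Commutativity of H enters here: translations must centralize the diagonal action, which
      -- itself contains translations.
      have htr (y : H) : Commute (translation k H N y) (translation k H N x) := by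
        rw [commute_iff_eq, ← map_mul, ← map_mul, hcomm]
      exact (ptAct_translation_commute α _ x).mul_left (Commute.sum_left _ _ _ fun i _ =>
        (ptAct_translation_commute α _ x).mul_left (htr _))
  · rintro _ ⟨a, rfl⟩
    induction a using crossedProduct_induction X with
    | h0 => rw [map_zero]; exact Subalgebra.zero_mem _
    | hadd a b ha hb => rw [map_add]; exact Subalgebra.add_mem _ ha hb
    | h r h =>
      rw [map_mul]
      refine Subalgebra.mul_mem _
        (Algebra.subset_adjoin (Or.inl ⟨_, ⟨X.incl r, rfl⟩, hincl r⟩)) ?_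
      rw [ptAct_sect _ _ (ℛ k h)]
      exact Subalgebra.sum_mem _ fun i _ => Subalgebra.mul_mem _
        (Algebra.subset_adjoin (Or.inl ⟨_, ⟨X.sect _, rfl⟩, hsect _⟩))
        (Algebra.subset_adjoin (Or.inr ⟨_, rfl⟩))
  · rintro _ ⟨_, ⟨a, rfl⟩, rfl⟩
    dsimp only
    induction a using crossedProduct_induction X with
    | h0 => rw [map_zero, mul_zero, zero_mul]; exact Subalgebra.zero_mem _
    | hadd a b ha hb => rw [map_add, mul_add, add_mul]; exact Subalgebra.add_mem _ ha hb
    | h r h =>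
      rw [hmul, hincl, hsect, diagonalAct_apply _ _ (ℛ k h)]
      exact Subalgebra.mul_mem _ (Algebra.subset_adjoin (Or.inl ⟨_, rfl⟩))
        (Subalgebra.sum_mem _ fun i _ => Subalgebra.mul_mem _
          (Algebra.subset_adjoin (Or.inl ⟨_, rfl⟩)) (Algebra.subset_adjoin (Or.inr ⟨_, rfl⟩)))

end Comm
end CrossedSystem

/-! ### The Jacobson radical of a crossed product -/

section Jacobson

variable {k B : Type*} [Field k] [Ring B] [Algebra k B]

/-- The radical is the intersection of the maximal left ideals P, so it suffices to kill the class
of 1 in each simple module B ⧸ P. -/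
lemma mem_jacobson_of_forall_isMaximal {z : B}
    (h : ∀ P : Ideal B, P.IsMaximal →
      Algebra.lsmul k k (B ⧸ P) z (Submodule.Quotient.mk 1) = 0) : z ∈ Ring.jacobson B := by
  rw [Ring.jacobson_eq_sInf_isMaximal, Submodule.mem_sInf]
  intro P hP
  have h1 : z • (Submodule.Quotient.mk 1 : B ⧸ P) = 0 := h P hP
  rwa [← Submodule.Quotient.mk_smul, smul_eq_mul, mul_one, Submodule.Quotient.mk_eq_zero] at h1

lemma completelyReducible_lsmul_quotient (P : Ideal B) (hP : P.IsMaximal) :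
    CompletelyReducible (Set.range (Algebra.lsmul k k (B ⧸ P) : B →ₐ[k] _)) := by
  have : IsSimpleModule B (B ⧸ P) := isSimpleModule_iff_isCoatom.2 hP.out
  exact (completelyReducible_range_iff _ fun _ _ => rfl).2 inferInstance

lemma exists_mul_one_add_of_mem_jacobson {z : B} (hz : z ∈ Ring.jacobson B) :
    ∃ y, y * (1 + z) = 1 := by
  rw [← Ideal.jacobson_bot] at hz
  obtain ⟨y, hy⟩ := Ideal.mem_jacobson_iff.1 hz 1
  refine ⟨y, ?_⟩
  rw [Ideal.mem_bot, sub_eq_zero, mul_one] at hy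
  rw [mul_add, mul_one, add_comm, hy]

/-- A left inverse y = 1 - yz again has the form 1 plus a radical element, so y has a left inverse
too and is a two-sided inverse. -/
lemma isUnit_one_add_of_mem_jacobson {z : B} (hz : z ∈ Ring.jacobson B) : IsUnit (1 + z) := by
  obtain ⟨y, hy⟩ := exists_mul_one_add_of_mem_jacobson hz
  have hy' : y = 1 + -(y * z) := by
    rw [mul_add, mul_one] at hy
    rw [← hy]; abel
  obtain ⟨x, hx⟩ := exists_mul_one_add_of_mem_jacobson
    ((Ring.jacobson B).neg_mem ((Ring.jacobson B).mul_mem_left y hz))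
  rw [← hy'] at hx
  exact ⟨⟨1 + z, y, by rw [← left_inv_eq_right_inv hx hy, hx], hy⟩, rfl⟩

/-- The radical criterion asks for left inverses. A right inverse of an element of 1 + K lies in 1 +
K as K is two-sided, hence has a right inverse itself and is two-sided. -/
lemma le_jacobson_of_exists_right_inverse {K : Ideal B} [K.IsTwoSided]
    (h : ∀ x ∈ K, ∃ y, (1 + x) * y = 1) : K ≤ Ring.jacobson B := by
  intro x hx
  rw [← Ideal.jacobson_bot, Ideal.mem_jacobson_iff]
  intro b
  have hbx := K.mul_mem_left b hx
  obtain ⟨y, hy⟩ := h _ hbx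
  have hy' : y = 1 + -(b * x * y) := by
    rw [add_mul, one_mul] at hy
    rw [← hy]; abel
  obtain ⟨c, hc⟩ := h _ (K.neg_mem (K.mul_mem_right y hbx))
  rw [← hy'] at hc
  refine ⟨y, ?_⟩
  rw [Ideal.mem_bot, sub_eq_zero]
  have := left_inv_eq_right_inv hy hc
  rw [← this, mul_add, mul_one, ← mul_assoc, add_comm] at hc
  exact hc

end Jacobson

/-! ### Coefficients in R and comparison of the radicals -/

namespace CrossedSystem

variable {k : Type u} {H : Type v} {R : Type w} [Field k] [Ring H]
    [HopfAlgebra k H] [Ring R] [Algebra k R] (X : CrossedSystem k H R)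

/-- The coefficient `r # h ↦ f(h) r`. -/
noncomputable def coeff (f : H →ₗ[k] k) : X.CrossedProduct →ₗ[k] R :=
  X.ext (Algebra.lmul k R) (Algebra.linearMap k R ∘ₗ f)

lemma coeff_incl_mul_sect (f : H →ₗ[k] k) (r : R) (h : H) :
    X.coeff f (X.incl r * X.sect h) = f h • r := by
  rw [incl_mul_sect, coeff, ext_hash]
  change r * algebraMap k R (f h) = _
  rw [← Algebra.commutes, ← Algebra.smul_def]

lemma coeff_incl_mul (f : H →ₗ[k] k) (r : R) (z : X.CrossedProduct) :
    X.coeff f (X.incl r * z) = r * X.coeff f z := X.ext_incl_mul _ _ r z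

lemma coeff_counit_one : X.coeff counit 1 = 1 := by
  have := X.coeff_incl_mul_sect counit 1 1
  rwa [map_one, sect_one, one_mul, Bialgebra.counit_one, one_smul] at this

lemma coeff_counit_sect_mul_incl (h : H) (r : R) :
    X.coeff counit (X.sect h * X.incl r) = X.act h r := by
  rw [X.sect_mul_incl h r (ℛ k h), map_sum]
  conv_rhs => rw [← sum_counit_smul_left (ℛ k h)]
  simp [coeff_incl_mul_sect]

/-- Rank-one maps f ⊗ v translate vanishing on a coinduced module into coefficients annihilating v.
-/
lemma ext_smulRight {V : Type*} [AddCommGroup V] [Module k V] (ρ : R →ₐ[k] Module.End k V)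
    (f : H →ₗ[k] k) (v : V) (z : X.CrossedProduct) :
    X.ext ρ (f.smulRight v) z = ρ (X.coeff f z) v := by
  induction z using crossedProduct_induction X with
  | h0 => simp
  | hadd x y hx hy => simp only [map_add, hx, hy, LinearMap.add_apply]
  | h r h => simp [ext_incl_mul, ext_sect, coeff_incl_mul_sect]

lemma sum_coeff [Module.Finite k H] (z : X.CrossedProduct) :
    z = ∑ i, X.hash (X.coeff ((Module.finBasis k H).coord i) z ⊗ₜ Module.finBasis k H i) := by
  induction z using crossedProduct_induction X with
  | h0 => simp
  | hadd x y hx hy =>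
    conv_lhs => rw [hx, hy]
    simp only [map_add, TensorProduct.add_tmul, Finset.sum_add_distrib]
  | h r h =>
    simp only [coeff_incl_mul_sect, TensorProduct.smul_tmul, ← map_sum, ← TensorProduct.tmul_sum]
    rw [incl_mul_sect]
    congr 2
    exact ((Module.finBasis k H).sum_repr h).symm

lemma mem_smashIdeal_of_coeff_mem [Module.Finite k H] {I : Ideal R} {z : X.CrossedProduct}
    (h : ∀ f, X.coeff f z ∈ I) : z ∈ X.smashIdeal I := by
  rw [X.sum_coeff z]
  exact Submodule.sum_mem _ fun i _ => Submodule.subset_span ⟨_, h _, _, rfl⟩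

lemma smashIdeal_le {I : Ideal R} (hI : ∀ x ∈ I, X.incl x ∈ Ring.jacobson X.CrossedProduct) :
    X.smashIdeal I ≤ (Ring.jacobson X.CrossedProduct).restrictScalars k := by
  refine Submodule.span_le.2 ?_
  rintro _ ⟨x, hx, h, rfl⟩
  rw [← incl_mul_sect]
  exact Ideal.mul_mem_right _ _ (hI x hx)

/-- The ε-coefficient is left R-linear and sends 1 to 1, so it carries an inverse of 1 + x in the
crossed product to a right inverse in R. -/
lemma comap_incl_jacobson_le :
    (Ring.jacobson X.CrossedProduct).comap X.incl ≤ Ring.jacobson R := by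
  refine le_jacobson_of_exists_right_inverse fun x hx => ?_
  obtain ⟨u, hu⟩ := isUnit_one_add_of_mem_jacobson (Ideal.mem_comap.1 hx)
  refine ⟨X.coeff counit u⁻¹.val, ?_⟩
  rw [← coeff_incl_mul, map_add, map_one, ← hu, Units.mul_inv, coeff_counit_one]

/-- By stability J(R)M is a submodule over the crossed product, so it is 0 or M. As H is
finite-dimensional, M is finitely generated over R, and in the second case Nakayama's lemma gives M
= 0. -/
lemma incl_smul_eq_zero [Module.Finite k H] (hJ : ∀ x ∈ Ring.jacobson R, ∀ h,
    X.act h x ∈ Ring.jacobson R) {M : Type*} [AddCommGroup M] [Module X.CrossedProduct M]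
    [IsSimpleModule X.CrossedProduct M] {x : R} (hx : x ∈ Ring.jacobson R) (m : M) :
    X.incl x • m = 0 := by
  let _ : Module R M := Module.compHom _ X.incl.toRingHom
  have hsmul (r : R) (m : M) : r • m = X.incl r • m := rfl
  let U : Submodule R M := Ring.jacobson R • ⊤
  have hsect (h : H) (m : M) (hm : m ∈ U) : X.sect h • m ∈ U := by
    refine Submodule.smul_induction_on hm (fun y hy n _ => ?_) fun m n hm hn => ?_
    · rw [hsmul, ← mul_smul, X.sect_mul_incl h y (ℛ k h), Finset.sum_smul]
      refine U.sum_mem fun i _ => ?_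
      rw [mul_smul, ← hsmul]
      exact Submodule.smul_mem_smul (hJ y hy _) trivial
    · rw [smul_add]; exact U.add_mem hm hn
  have hU (a : X.CrossedProduct) (m : M) (hm : m ∈ U) : a • m ∈ U := by
    induction a using crossedProduct_induction X with
    | h0 => rw [zero_smul]; exact U.zero_mem
    | hadd a b ha hb => rw [add_smul]; exact U.add_mem ha hb
    | h r h =>
      rw [mul_smul, ← hsmul]
      exact U.smul_mem r (hsect h m hm)
  obtain ⟨U', hU'⟩ : ∃ U' : Submodule X.CrossedProduct M, ∀ n, n ∈ U' ↔ n ∈ U :=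
    ⟨{ U.toAddSubmonoid with smul_mem' := hU }, fun _ => Iff.rfl⟩
  have hmem : X.incl x • m ∈ U' :=
    (hU' _).2 (Submodule.smul_mem_smul hx (Submodule.mem_top (x := m)))
  rcases eq_bot_or_eq_top U' with h | h
  · rwa [h, Submodule.mem_bot] at hmem
  · by_cases hm0 : m = 0
    · rw [hm0, smul_zero]
    have hspan : (⊤ : Submodule R M) = Submodule.span R
        (Set.range fun i => X.sect (Module.finBasis k H i) • m) := by
      rw [eq_comm, eq_top_iff]
      rintro n -
      obtain ⟨a, rfl⟩ := IsSimpleModule.toSpanSingleton_surjective X.CrossedProduct hm0 n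
      rw [LinearMap.toSpanSingleton_apply, X.sum_coeff a, Finset.sum_smul]
      refine Submodule.sum_mem _ fun i _ => ?_
      rw [← incl_mul_sect, mul_smul]
      exact Submodule.smul_mem _ _ (Submodule.subset_span ⟨i, rfl⟩)
    have hfg : (⊤ : Submodule R M).FG := by
      rw [hspan]
      exact Submodule.fg_span (Set.finite_range _)
    have hU : (⊤ : Submodule R M) ≤ U := fun n _ => (hU' n).1 (h ▸ Submodule.mem_top)
    have hn : X.incl x • m ∈ (⊤ : Submodule R M) := Submodule.mem_top
    rwa [hfg.eq_bot_of_le_jacobson_smul hU, Submodule.mem_bot] at hn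

lemma incl_mem_jacobson [Module.Finite k H] (hJ : ∀ x ∈ Ring.jacobson R, ∀ h,
    X.act h x ∈ Ring.jacobson R) {x : R} (hx : x ∈ Ring.jacobson R) :
    X.incl x ∈ Ring.jacobson X.CrossedProduct := by
  refine mem_jacobson_of_forall_isMaximal (k := k) fun P hP => ?_
  have : IsSimpleModule X.CrossedProduct (X.CrossedProduct ⧸ P) :=
    isSimpleModule_iff_isCoatom.2 hP.out
  exact X.incl_smul_eq_zero hJ hx _

/-! ### R-H-modules as modules over the crossed product -/

section HJacobson

variable {X}

namespace RHModule

section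

variable {M : Type*} [AddCommGroup M] [Module k M] [Module R M] [IsScalarTower k R M]
  (V : X.RHModule M)

/-- The linear map underlying the action of `R #_σ H` on an `R`-`H`-module. -/
noncomputable def toEndLinear : X.CrossedProduct →ₗ[k] Module.End k M :=
  TensorProduct.lift ((LinearMap.mul k (Module.End k M)).compl₁₂
    (Algebra.lsmul k k M).toLinearMap V.hsmul) ∘ₗ X.hash.symm.toLinearMap

lemma toEndLinear_incl_mul_sect (r : R) (h : H) (m : M) :
    V.toEndLinear (X.incl r * X.sect h) m = r • V.hsmul h m := by
  rw [incl_mul_sect]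
  rfl

lemma toEndLinear_incl_mul (r : R) (z : X.CrossedProduct) (m : M) :
    V.toEndLinear (X.incl r * z) m = r • V.toEndLinear z m := by
  induction z using crossedProduct_induction X with
  | h0 => simp
  | hadd x y hx hy => simp only [mul_add, map_add, LinearMap.add_apply, hx, hy, smul_add]
  | h s h =>
    rw [← mul_assoc, ← map_mul, toEndLinear_incl_mul_sect, toEndLinear_incl_mul_sect, mul_smul]

lemma toEndLinear_sect (h : H) (m : M) : V.toEndLinear (X.sect h) m = V.hsmul h m := by
  have := V.toEndLinear_incl_mul_sect 1 h m
  rwa [map_one, one_mul, one_smul] at this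

lemma toEndLinear_sect_mul_sect (h g : H) (m : M) :
    V.toEndLinear (X.sect h * X.sect g) m = V.hsmul h (V.hsmul g m) := by
  have := congrArg (fun φ : WithConv (H ⊗[k] H →ₗ[k] X.CrossedProduct) => φ (h ⊗ₜ g))
    X.sectC_mul_sectC
  rw [fst_mul_snd_apply, convMul_tmul _ _ (ℛ k h) (ℛ k g)] at this
  have := congrArg (fun z => V.toEndLinear z m) this
  simp only [map_sum, LinearMap.sum_apply] at this
  rw [V.hsmul_hsmul]
  refine this.trans (Finset.sum_congr rfl fun i _ => Finset.sum_congr rfl fun j _ => ?_)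
  exact V.toEndLinear_incl_mul_sect _ _ m

lemma toEndLinear_sect_mul (h : H) (z : X.CrossedProduct) (m : M) :
    V.toEndLinear (X.sect h * z) m = V.hsmul h (V.toEndLinear z m) := by
  induction z using crossedProduct_induction X with
  | h0 => simp
  | hadd x y hx hy => simp only [mul_add, map_add, LinearMap.add_apply, hx, hy]
  | h s g =>
    rw [← mul_assoc, X.sect_mul_incl h s (ℛ k h), toEndLinear_incl_mul_sect, V.hsmul_smul,
      Finset.sum_mul, map_sum, LinearMap.sum_apply]
    simp only [mul_assoc, toEndLinear_incl_mul, toEndLinear_sect_mul_sect]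

/-- The action of `R #_σ H` on an `R`-`H`-module. -/
noncomputable def toEnd : X.CrossedProduct →ₐ[k] Module.End k M :=
  AlgHom.ofLinearMap V.toEndLinear
    (by
      ext m
      rw [← sect_one, toEndLinear_sect, V.one_hsmul, Module.End.one_apply])
    (fun a b => by
      ext m
      rw [Module.End.mul_apply]
      induction a using crossedProduct_induction X with
      | h0 => simp
      | hadd x y hx hy => simp only [add_mul, map_add, LinearMap.add_apply, hx, hy]
      | h r h =>
        rw [mul_assoc, toEndLinear_incl_mul, toEndLinear_sect_mul, toEndLinear_incl_mul_sect])

lemma toEnd_sect (h : H) (m : M) : V.toEnd (X.sect h) m = V.hsmul h m := V.toEndLinear_sect h m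

lemma toEnd_incl (r : R) (m : M) : V.toEnd (X.incl r) m = r • m := by
  have := V.toEndLinear_incl_mul_sect r 1 m
  rwa [sect_one, mul_one, V.one_hsmul] at this

/-- A stable subspace is an R-H-submodule, hence 0 or M, and the projections 0 and 1 serve. -/
lemma IsIrreducible.completelyReducible {V : X.RHModule M} (hV : V.IsIrreducible) :
    CompletelyReducible (Set.range V.toEnd) := by
  intro W hW
  let N : Submodule R M :=
    { W.toAddSubmonoid with
      smul_mem' := fun r m hm => by
        rw [← V.toEnd_incl]
        exact hW _ ⟨_, rfl⟩ m hm }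
  have hN (m : M) : m ∈ N ↔ m ∈ W := Iff.rfl
  rcases hV.2 N (fun h m hm => by
    rw [hN, ← V.toEnd_sect]
    exact hW _ ⟨_, rfl⟩ m hm) with h | h
  · refine ⟨0, fun m => W.zero_mem, fun m hm => ?_, fun f _ => Commute.zero_right f⟩
    rw [← hN, h, Submodule.mem_bot] at hm
    exact hm.symm
  · refine ⟨1, fun m => ?_, fun m hm => rfl, fun f _ => Commute.one_right f⟩
    rw [← hN, h]
    exact Submodule.mem_top

end

variable (X) in
/-- A module over `R #_σ H` as an `R`-`H`-module. -/
noncomputable def ofModule (M : Type*) [AddCommGroup M] [Module k M] [Module X.CrossedProduct M]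
    [IsScalarTower k X.CrossedProduct M] [Module R M] [IsScalarTower k R M]
    (hR : ∀ (r : R) (m : M), r • m = X.incl r • m) : X.RHModule M where
  hsmul := (Algebra.lsmul k k M).toLinearMap ∘ₗ X.sect
  one_hsmul m := one_smul X.CrossedProduct m
  hsmul_smul h a m := by
    change X.sect h • a • m = ∑ i ∈ (ℛ k h).index, X.act ((ℛ k h).left i) a •
      X.sect ((ℛ k h).right i) • m
    rw [hR, ← mul_smul, X.sect_mul_incl h a (ℛ k h), Finset.sum_smul]
    simp only [hR, mul_smul]
  hsmul_hsmul h g m := by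
    have := congrArg (fun φ : WithConv (H ⊗[k] H →ₗ[k] X.CrossedProduct) => φ (h ⊗ₜ g))
      X.sectC_mul_sectC
    rw [fst_mul_snd_apply, convMul_tmul _ _ (ℛ k h) (ℛ k g)] at this
    have := congrArg (fun z => z • m) this
    simp only [Finset.sum_smul, mul_smul] at this
    refine this.trans (Finset.sum_congr rfl fun i _ => Finset.sum_congr rfl fun j _ => ?_)
    exact (hR _ _).symm

lemma isIrreducible_ofModule (M : Type*) [AddCommGroup M] [Module k M] [Module X.CrossedProduct M]
    [IsScalarTower k X.CrossedProduct M] [Module R M] [IsScalarTower k R M]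
    (hR : ∀ (r : R) (m : M), r • m = X.incl r • m) [IsSimpleModule X.CrossedProduct M] :
    (ofModule X M hR).IsIrreducible := by
  constructor
  · have := IsSimpleModule.nontrivial X.CrossedProduct M
    obtain ⟨m, hm⟩ := exists_ne (0 : M)
    exact ⟨1, m, by rwa [one_smul]⟩
  · intro N hN
    obtain ⟨U, hU⟩ : ∃ U : Submodule X.CrossedProduct M, ∀ n, n ∈ U ↔ n ∈ N :=
      ⟨{ N.toAddSubmonoid with
        smul_mem' := fun a m hm => by
          change a • m ∈ N
          induction a using crossedProduct_induction X with
          | h0 => rw [zero_smul]; exact N.zero_mem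
          | hadd a b ha hb => rw [add_smul]; exact N.add_mem ha hb
          | h r h =>
            rw [mul_smul, ← hR]
            exact N.smul_mem r (hN h m hm) }, fun _ => Iff.rfl⟩
    rcases eq_bot_or_eq_top U with h | h
    · left
      ext m
      rw [← hU, h, Submodule.mem_bot, Submodule.mem_bot]
    · right
      ext m
      rw [← hU, h]
      exact iff_of_true trivial trivial

end RHModule

variable (X) in
-- Quotients of the crossed product by maximal left ideals are irreducible R-H-modules in the
-- universe fixed by `hJacobson`; conversely every irreducible R-H-module is killed by the radical
-- of the crossed product.
lemma hJacobson_eq : X.hJacobson = (Ring.jacobson X.CrossedProduct).comap X.incl := by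
  apply le_antisymm
  · intro x hx
    refine Ideal.mem_comap.2 (mem_jacobson_of_forall_isMaximal (k := k) fun P hP => ?_)
    have : IsSimpleModule X.CrossedProduct (X.CrossedProduct ⧸ P) :=
      isSimpleModule_iff_isCoatom.2 hP.out
    let _ : Module R (X.CrossedProduct ⧸ P) := Module.compHom _ X.incl.toRingHom
    have hsmul (r : R) (m : X.CrossedProduct ⧸ P) : r • m = X.incl r • m := rfl
    have : IsScalarTower k R (X.CrossedProduct ⧸ P) := ⟨fun c r m => by
      rw [hsmul, hsmul, map_smul, smul_assoc]⟩
    have := hx (X.CrossedProduct ⧸ P) _ (RHModule.isIrreducible_ofModule _ hsmul)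
      (Submodule.Quotient.mk 1)
    rwa [hsmul] at this
  · intro x hx M _ _ _ _ V hV m
    have := LinearMap.congr_fun (hV.completelyReducible.jacobson_apply (Ideal.mem_comap.1 hx)) m
    rwa [V.toEnd_incl] at this

end HJacobson

lemma jacobson_eq_of_stable [Module.Finite k H]
    (hJ : ∀ x ∈ Ring.jacobson R, ∀ h, X.act h x ∈ Ring.jacobson R)
    (hcoeff : ∀ z ∈ Ring.jacobson X.CrossedProduct, ∀ f, X.coeff f z ∈ Ring.jacobson R) :
    (Ring.jacobson R = X.hJacobson ∧ X.hJacobson = X.jacobsonH) ∧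
      (Ring.jacobson X.CrossedProduct).restrictScalars k = X.smashIdeal X.hJacobson := by
  have h1 : Ring.jacobson R = X.hJacobson := by
    rw [hJacobson_eq]
    exact le_antisymm (fun x hx => X.incl_mem_jacobson hJ hx) X.comap_incl_jacobson_le
  have h2 : Ring.jacobson R = X.jacobsonH :=
    le_antisymm (fun x hx h => hJ x hx h) fun x hx => X.one_act x ▸ hx 1
  refine ⟨⟨h1, h1 ▸ h2⟩, ?_⟩
  rw [← h1]
  exact le_antisymm (fun z hz => X.mem_smashIdeal_of_coeff_mem (hcoeff z hz))
    (X.smashIdeal_le fun x hx => X.incl_mem_jacobson hJ hx)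

lemma jacobson_eq_of_isCocomm [IsCocomm k H] [Module.Finite k H] {t : H}
    (ht : ∀ h : H, t * h = counit (R := k) h • t) (ht1 : counit (R := k) t = 1)
    {l : H →ₗ[k] k} (hl1 : l 1 = 1)
    (hl : idC k H * push (Algebra.ofId k H) (toConv l) = push (Algebra.ofId k H) (toConv l)) :
    (Ring.jacobson R = X.hJacobson ∧ X.hJacobson = X.jacobsonH) ∧
      (Ring.jacobson X.CrossedProduct).restrictScalars k = X.smashIdeal X.hJacobson := by
  have hCR (P : Ideal R) (hP : P.IsMaximal) :=
    X.completelyReducible_coind_comp_incl hl1 hl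
      (completelyReducible_lsmul_quotient (k := k) P hP)
  refine X.jacobson_eq_of_stable (fun x hx h => ?_) fun z hz f => ?_
  · refine mem_jacobson_of_forall_isMaximal (k := k) fun P hP => ?_
    -- J(R) kills the restricted coinduced module; on the test map ε ⊗ v, evaluated at h, the
    -- element x acts as h · x on v.
    have := (hCR P hP).jacobson_apply hx
    have := LinearMap.congr_fun (LinearMap.congr_fun this
      ((counit (R := k) (A := H)).smulRight (Submodule.Quotient.mk 1))) h
    change X.coind _ (X.incl x) _ h = 0 at this
    rwa [coind_apply, ext_smulRight, coeff_counit_sect_mul_incl] at this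
  · refine mem_jacobson_of_forall_isMaximal (k := k) fun P hP => ?_
    rw [← ext_smulRight]
    exact X.ext_eq_zero_of_mem_jacobson _
      (X.completelyReducible_of_comp_incl ht ht1 _ (hCR P hP)) hz _

lemma jacobson_eq_of_comm (hcomm : ∀ x y : H, x * y = y * x) [Module.Finite k H] {t : H}
    (ht : ∀ h : H, h * t = counit (R := k) h • t) (ht1 : counit (R := k) t = 1)
    {l : H →ₗ[k] k} (hl1 : l 1 = 1)
    (hl : idC k H * push (Algebra.ofId k H) (toConv l) = push (Algebra.ofId k H) (toConv l)) :
    (Ring.jacobson R = X.hJacobson ∧ X.hJacobson = X.jacobsonH) ∧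
      (Ring.jacobson X.CrossedProduct).restrictScalars k = X.smashIdeal X.hJacobson := by
  have hCR (P : Ideal X.CrossedProduct) (hP : P.IsMaximal) :=
    X.completelyReducible_coind hcomm ht ht1 (completelyReducible_lsmul_quotient (k := k) P hP)
  have hK (x) (hx : x ∈ Ring.jacobson R) : X.incl x ∈ Ring.jacobson X.CrossedProduct := by
    refine mem_jacobson_of_forall_isMaximal (k := k) fun P hP => ?_
    exact LinearMap.congr_fun
      ((X.completelyReducible_of_coind hl1 hl _ (hCR P hP)).jacobson_apply hx) _
  have hcoeff (z) (hz : z ∈ Ring.jacobson X.CrossedProduct) (f) :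
      X.coeff f z ∈ Ring.jacobson R := by
    -- The test modules are simple over the crossed product, so the coefficient is first seen to lie
    -- in its radical and then descends to J(R).
    refine X.comap_incl_jacobson_le (Ideal.mem_comap.2
      (mem_jacobson_of_forall_isMaximal (k := k) fun P hP => ?_))
    have := X.ext_eq_zero_of_mem_jacobson _ (hCR P hP) hz (f.smulRight (Submodule.Quotient.mk 1))
    rwa [ext_smulRight] at this
  refine X.jacobson_eq_of_stable (fun x hx h => ?_) hcoeff
  -- Stability follows from the coefficient condition: h · x is the ε-coefficient of (1 # h)(x # 1),
  -- which lies in the radical.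
  rw [← coeff_counit_sect_mul_incl]
  exact hcoeff _ (Ideal.mul_mem_left _ _ (hK x hx)) _

end CrossedSystem

theorem corollary2p13 {k : Type u} {H : Type v} {R : Type w} [Field k] [Ring H] [HopfAlgebra k H]
    [Ring R] [Algebra k R]
    (hss : IsSemisimpleRing H) (hcoss : IsCosemisimple k H)
    (hcomm : (∀ x y : H, x * y = y * x) ∨ Coalgebra.IsCocomm k H)
    (F : Type*) [Field F] [Algebra k F] [IsAlgClosure k F] [Algebra.IsSeparable k F]
    (X : CrossedSystem k H R) :
    (Ring.jacobson R = X.hJacobson ∧ X.hJacobson = X.jacobsonH) ∧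
      (Ring.jacobson X.CrossedProduct).restrictScalars k = X.smashIdeal X.hJacobson := by
  -- The left integral yields finite dimension and the separability idempotent of H; the right one
  -- is used for averaging over the crossed product in the cocommutative case.
  obtain ⟨t, ht1, ht⟩ := CrossedSystem.exists_left_integral (k := k) (H := H)
  obtain ⟨t', ht1', ht'⟩ := CrossedSystem.exists_right_integral (k := k) (H := H)
  obtain ⟨l, hl1, hl⟩ := CrossedSystem.exists_dual_integral hcoss
  have := CrossedSystem.finite_of_left_integral ht ht1
  rcases hcomm with hcomm | hcocomm
  · exact X.jacobson_eq_of_comm hcomm ht ht1 hl1 hl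
  · exact X.jacobson_eq_of_isCocomm ht' ht1' hl1 hl
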